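/- Let $k_1,k_2>0$. Let $\pi_{k}^{+}$ and $\pi_{k}^{-}$ denote the positive and negative discrete series representations of $\mathfrak{su}(1,1)$ (relations $[H,B]=2B$, $[H,C]=-2C$, $[B,C]=H$) on finite linear combinations of the standard orthonormal basis $\{e_n\}_{n\ge 0}$ of $\ell^2(\mathbb Z_{\ge 0})$: $$\pi_k^+(H)e_n=2(k+n)e_n,\quad \pi_k^+(B)e_n=\sqrt{(n+1)(2k+n)}\,e_{n+1},\quad \pi_k^+(C)e_n=-\sqrt{n(2k+n-1)}\,e_{n-1},$$ $$\pi_k^-(H)e_n=-2(k+n)e_n,\quad \pi_k^-(B)e_n=-\sqrt{n(2k+n-1)}\,e_{n-1},\quad \pi_k^-(C)e_n=\sqrt{(n+1)(2k+n)}\,e_{n+1}.$$ Let $\Omega=-\tfrac14(H^2+2H+4CB)$ be the Casimir element, and let $\Delta$ be the algebra homomorphism with $\Delta(Y)=1\otimes Y+Y\otimes 1$ for $Y\in\mathfrak{su}(1,1)$. For $p\in\mathbb Z$ and $n\ge 0$ put, in the Hilbert space tensor product $\ell^2(\mathbb Z_{\ge0})\otimes\ell^2(\mathbb Z_{\ge0})$,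 $$f_n^p=(-1)^n e_n\otimes e_{n-p}\ \ (p\le 0),\qquad f_n^p=(-1)^n e_{n+p}\otimes e_n\ \ (p\ge 0),$$ and let $H_p$ be the closed linear span of $\{f_n^p: n\ge 0\}$. The operator $T_p=(\pi_{k_1}^+\otimes\pi_{k_2}^-)(\Delta(\Omega))|_{H_p}$ is considered as an unbounded operator on $H_p$ whose domain is the space of finite linear combinations of the $f_n^p$. Let $b=k_1+k_2-\tfrac12$ and $$(a,c)=\big(k_1-k_2+\tfrac12,\;k_2-k_1-p+\tfrac12\big)\ \ (p\le 0),\qquad (a,c)=\big(k_2-k_1+\tfrac12,\;k_1-k_2+p+\tfrac12\big)\ \ (p\ge 0)$$ (either choice if $p=0$). With $(a)_n=a(a+1)\cdots(a+n-1)$, let $$S_n(y;a,b,c)=(a+b)_n(a+c)_n\;{}_3F_2\!\left(\begin{matrix}-n,\;a+ix,\;a-ix\\ a+b,\;a+c\end{matrix};1\right),\ x^2=y,\qquad \hat S_n(y;p)=\frac{(-1)^nS_n(y;a,b,c)}{\sqrt{n!\,(a+b)_n(a+c)_n(b+c)_n}}.$$ Let $d\mu^2(y;p)$ be the measure $d\mu^2(y;a,b,c)$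 on $\mathbb R$ which is symmetric in $a,b,c$ and which, when the parameters are permuted so that $a$ is the smallest of them, is given by $$\int_{\mathbb R} f\,d\mu^2=\frac1{2\pi}\int_0^\infty\left|\frac{\Gamma(a+ix)\Gamma(b+ix)\Gamma(c+ix)}{\Gamma(2ix)}\right|^2\frac{f(x^2)}{\Gamma(a+b)\Gamma(a+c)\Gamma(b+c)}\,dx$$ $$\qquad+\frac{\Gamma(b-a)\Gamma(c-a)}{\Gamma(-2a)\Gamma(b+c)}\sum_{k\ge0,\;a+k<0}(-1)^k\frac{(2a)_k(a+1)_k(a+b)_k(a+c)_k}{(a)_k(a-b+1)_k(a-c+1)_k\,k!}\,f(-(a+k)^2)$$ (the second term is absent if $a\ge 0$). Then there is exactly one bounded linear operator $\Lambda_p: H_p\to L^2(\mathbb R,d\mu^2(y;p))$ with $\Lambda_p f_n^p=\hat S_n(\cdot\,;p)$ for all $n\ge0$. It is unitary (an isometry onto $L^2(\mathbb R,d\mu^2(y;p))$), and it intertwines $T_p$ with the operator $M_{y+1/4}$ of multiplication by $y+\tfrac14$, taken with its maximal domain $\{g\in L^2: (y+\tfrac14)g\in L^2\}$: for every finite linear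 combination $v$ of the $f_n^p$ one has $\Lambda_pv\in \operatorname{dom} M_{y+1/4}$ and $\Lambda_pT_pv=M_{y+1/4}\Lambda_pv$; moreover $T_p$ is closable and $\Lambda_p\,\overline{T_p}\,\Lambda_p^{-1}=M_{y+1/4}$, including equality of domains. -/

import Mathlib

open scoped TensorProduct

noncomputable section

namespace SU11

/-! ### The discrete series representations on finite linear combinations of basis vectors

`ℕ →₀ ℂ` is the space of finite linear combinations of the basis vectors
`e n = Finsupp.single n 1`. The subtraction `n - 1` only occurs with a coefficient
that vanishes at `n = 0`. -/

/-- The space of finite linear combinations of `e 0, e 1, e 2, …`. -/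
abbrev Fin0 : Type := ℕ →₀ ℂ

/-- Positive discrete series: `H e_n = 2 (k + n) e_n`. -/
def posH (k : ℝ) : Module.End ℂ Fin0 :=
  Finsupp.linearCombination ℂ fun n : ℕ =>
    Finsupp.single n ((2 * (k + n) : ℝ) : ℂ)

/-- Positive discrete series: `B e_n = √((n + 1) (2k + n)) e_{n+1}`. -/
def posB (k : ℝ) : Module.End ℂ Fin0 :=
  Finsupp.linearCombination ℂ fun n : ℕ =>
    Finsupp.single (n + 1) ((Real.sqrt ((n + 1) * (2 * k + n)) : ℝ) : ℂ)

/-- Positive discrete series: `C e_n = -√(n (2k + n - 1)) e_{n-1}`. -/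
def posC (k : ℝ) : Module.End ℂ Fin0 :=
  Finsupp.linearCombination ℂ fun n : ℕ =>
    Finsupp.single (n - 1) ((-Real.sqrt (n * (2 * k + n - 1)) : ℝ) : ℂ)

/-- Negative discrete series: `H e_n = -2 (k + n) e_n`. -/
def negH (k : ℝ) : Module.End ℂ Fin0 :=
  Finsupp.linearCombination ℂ fun n : ℕ =>
    Finsupp.single n ((-2 * (k + n) : ℝ) : ℂ)

/-- Negative discrete series: `B e_n = -√(n (2k + n - 1)) e_{n-1}`. -/
def negB (k : ℝ) : Module.End ℂ Fin0 :=
  Finsupp.linearCombination ℂ fun n : ℕ =>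
    Finsupp.single (n - 1) ((-Real.sqrt (n * (2 * k + n - 1)) : ℝ) : ℂ)

/-- Negative discrete series: `C e_n = √((n + 1) (2k + n)) e_{n+1}`. -/
def negC (k : ℝ) : Module.End ℂ Fin0 :=
  Finsupp.linearCombination ℂ fun n : ℕ =>
    Finsupp.single (n + 1) ((Real.sqrt ((n + 1) * (2 * k + n)) : ℝ) : ℂ)

/-- The Casimir element `Ω = -(1/4) (H² + 2 H + 4 C B)`, evaluated on operators `H`, `B`, `C`. -/
def casimir {V : Type*} [AddCommMonoid V] [Module ℂ V] (H B C : Module.End ℂ V) :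
    Module.End ℂ V :=
  (-(1 / 4) : ℂ) • (H * H + (2 : ℂ) • H + (4 : ℂ) • (C * B))

/-- The image of `Δ(Y) = Y ⊗ 1 + 1 ⊗ Y` when `Y` acts by `S` on the first factor
and by `T` on the second. -/
def comul (S T : Module.End ℂ Fin0) : Module.End ℂ (Fin0 ⊗[ℂ] Fin0) :=
  TensorProduct.map S LinearMap.id + TensorProduct.map LinearMap.id T

/-- `(π⁺_{k₁} ⊗ π⁻_{k₂})(Δ(Ω))` on finite linear combinations of the `e_n ⊗ e_m`; as `Δ` is an
algebra homomorphism, this is the Casimir element evaluated on `Δ(H)`, `Δ(B)`, `Δ(C)`. -/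
def tensorCasimir (k₁ k₂ : ℝ) : Module.End ℂ (Fin0 ⊗[ℂ] Fin0) :=
  casimir (comul (posH k₁) (negH k₂)) (comul (posB k₁) (negB k₂)) (comul (posC k₁) (negC k₂))

/-! ### The Hilbert space tensor product and the subspaces `H_p` -/

/-- `ℓ²(ℤ_{≥0})`. -/
abbrev Ell2 : Type := lp (fun _ : ℕ => ℂ) 2

/-- The Hilbert space tensor product `ℓ²(ℤ_{≥0}) ⊗ ℓ²(ℤ_{≥0})`: the completion of the algebraic
tensor product with inner product `⟪u ⊗ v, u' ⊗ v'⟫ = ⟪u, u'⟫ ⟪v, v'⟫`. -/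
abbrev TensorEll2 : Type := UniformSpace.Completion (Ell2 ⊗[ℂ] Ell2)

/-- The inclusion of finite linear combinations in `ℓ²(ℤ_{≥0})`, with `e_n` sent to the
`n`-th standard basis vector. -/
def incl : Fin0 →ₗ[ℂ] Ell2 :=
  Finsupp.linearCombination ℂ fun n : ℕ => lp.single (E := fun _ : ℕ => ℂ) 2 n (1 : ℂ)

/-- The inclusion of finite linear combinations of the `e_n ⊗ e_m` in the Hilbert space
tensor product. -/
def tensorIncl : Fin0 ⊗[ℂ] Fin0 →ₗ[ℂ] TensorEll2 :=
  (UniformSpace.Completion.toComplL (𝕜 := ℂ) (E := Ell2 ⊗[ℂ] Ell2)).toLinearMap ∘ₗ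
    TensorProduct.map incl incl

theorem incl_apply (v : Fin0) (m : ℕ) : (incl v : ∀ _ : ℕ, ℂ) m = v m := by
  induction v using Finsupp.induction_linear with
  | zero => simp
  | add f g hf hg => simp [map_add, hf, hg]
  | single n a =>
    simp [incl, Finsupp.linearCombination_single, lp.single_apply, Finsupp.single_apply,
      Pi.single_apply, eq_comm]

theorem incl_injective : Function.Injective incl := fun v w h =>
  Finsupp.ext fun m => by rw [← incl_apply v m, ← incl_apply w m, h]

theorem tensorIncl_injective : Function.Injective tensorIncl := by
  have h : Function.Injective (TensorProduct.map incl incl) :=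
    TensorProduct.map_injective_of_flat_flat _ _ incl_injective incl_injective
  exact (UniformSpace.Completion.coe_injective (Ell2 ⊗[ℂ] Ell2)).comp h

/-- The vector `f_n^p = (-1)^n e_n ⊗ e_{n-p}` for `p ≤ 0` and `(-1)^n e_{n+p} ⊗ e_n` for `p ≥ 0`,
as a finite linear combination of basis vectors. Note that `p.toNat = max p 0`. -/
def fAlg (p : ℤ) (n : ℕ) : Fin0 ⊗[ℂ] Fin0 :=
  ((-1 : ℂ) ^ n) • (Finsupp.single (n + p.toNat) 1 ⊗ₜ[ℂ] Finsupp.single (n + (-p).toNat) 1)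

/-- The vector `f_n^p` in the Hilbert space tensor product. -/
def fVec (p : ℤ) (n : ℕ) : TensorEll2 := tensorIncl (fAlg p n)

/-- The closed subspace `H_p` spanned by the `f_n^p`, `n ≥ 0`. -/
def Hp (p : ℤ) : Submodule ℂ TensorEll2 :=
  (Submodule.span ℂ (Set.range (fVec p))).topologicalClosure

theorem span_le_Hp (p : ℤ) : Submodule.span ℂ (Set.range (fVec p)) ≤ Hp p :=
  Submodule.le_topologicalClosure _

theorem fVec_mem (p : ℤ) (n : ℕ) : fVec p n ∈ Hp p :=
  span_le_Hp p (Submodule.subset_span ⟨n, rfl⟩)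

/-- The vector `f_n^p` as an element of `H_p`. -/
def fHp (p : ℤ) (n : ℕ) : Hp p := ⟨fVec p n, fVec_mem p n⟩

/-! ### The Casimir operator as an unbounded operator -/

/-- `(π⁺_{k₁} ⊗ π⁻_{k₂})(Δ(Ω))` as an unbounded operator on the Hilbert space tensor product, with
domain the finite linear combinations of the `e_n ⊗ e_m`. -/
def casimirOp (k₁ k₂ : ℝ) : TensorEll2 →ₗ.[ℂ] TensorEll2 where
  domain := LinearMap.range tensorIncl
  toFun := tensorIncl ∘ₗ tensorCasimir k₁ k₂ ∘ₗ
    (LinearEquiv.ofInjective tensorIncl tensorIncl_injective).symm.toLinearMap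

theorem casimirOp_apply (k₁ k₂ : ℝ) (v : Fin0 ⊗[ℂ] Fin0)
    (h : tensorIncl v ∈ (casimirOp k₁ k₂).domain) :
    casimirOp k₁ k₂ ⟨tensorIncl v, h⟩ = tensorIncl (tensorCasimir k₁ k₂ v) := by
  have e : (LinearEquiv.ofInjective tensorIncl tensorIncl_injective).symm ⟨tensorIncl v, h⟩ = v := by
    rw [LinearEquiv.symm_apply_eq]
    rfl
  change tensorIncl (tensorCasimir k₁ k₂
    ((LinearEquiv.ofInjective tensorIncl tensorIncl_injective).symm ⟨tensorIncl v, h⟩)) = _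
  rw [e]

theorem tensorCasimir_fAlg_mem (k₁ k₂ : ℝ) (p : ℤ) (n : ℕ) :
    tensorCasimir k₁ k₂ (fAlg p n) ∈ Submodule.span ℂ (Set.range (fAlg p)) := by
  have key : ∀ (m : ℕ) (i j : ℕ) (x y : ℂ), i = m + p.toNat → j = m + (-p).toNat →
      (Finsupp.single i x ⊗ₜ[ℂ] Finsupp.single j y : Fin0 ⊗[ℂ] Fin0) ∈
        Submodule.span ℂ (Set.range (fAlg p)) := by
    intro m i j x y hi hj
    have : (Finsupp.single i x ⊗ₜ[ℂ] Finsupp.single j y : Fin0 ⊗[ℂ] Fin0) =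
        (x * y * (-1) ^ m) • fAlg p m := by
      have h1 : (Finsupp.single i x : Fin0) = x • Finsupp.single i 1 := by simp
      have h2 : (Finsupp.single j y : Fin0) = y • Finsupp.single j 1 := by simp
      rw [h1, h2, TensorProduct.smul_tmul_smul, fAlg, smul_smul, hi, hj, mul_assoc (x * y),
        ← mul_pow]
      simp
    rw [this]
    exact Submodule.smul_mem _ _ (Submodule.subset_span ⟨m, rfl⟩)
  -- the term with both indices lowered
  have low : ∀ (x y : ℂ), (n = 0 → x = 0 ∨ y = 0) →
      (Finsupp.single (n + p.toNat - 1) x ⊗ₜ[ℂ] Finsupp.single (n + (-p).toNat - 1) y :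
        Fin0 ⊗[ℂ] Fin0) ∈ Submodule.span ℂ (Set.range (fAlg p)) := by
    intro x y hxy
    rcases Nat.eq_zero_or_pos n with h | h
    · rcases hxy h with h | h <;> simp [h]
    · exact key (n - 1) _ _ _ _ (by omega) (by omega)
  rw [fAlg, map_smul]
  refine Submodule.smul_mem _ _ ?_
  simp only [tensorCasimir, casimir, comul, posH, posB, posC, negH, negB, negC,
    LinearMap.smul_apply, LinearMap.add_apply, Module.End.mul_apply, TensorProduct.map_tmul,
    LinearMap.id_apply, Finsupp.linearCombination_single, one_smul, map_add, Finsupp.smul_single,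
    smul_eq_mul]
  refine Submodule.smul_mem _ _ (Submodule.add_mem _ (Submodule.add_mem _ ?_
    (Submodule.smul_mem _ _ ?_)) (Submodule.smul_mem _ _ ?_))
  · exact Submodule.add_mem _ (Submodule.add_mem _ (key n _ _ _ _ rfl rfl) (key n _ _ _ _ rfl rfl))
      (Submodule.add_mem _ (key n _ _ _ _ rfl rfl) (key n _ _ _ _ rfl rfl))
  · exact Submodule.add_mem _ (key n _ _ _ _ rfl rfl) (key n _ _ _ _ rfl rfl)
  · refine Submodule.add_mem _ (Submodule.add_mem _ (key n _ _ _ _ (by omega) rfl)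
      (key (n + 1) _ _ _ _ (by omega) (by omega))) (Submodule.add_mem _ (low _ _ ?_) ?_)
    · intro hn
      rcases le_total p 0 with hp | hp
      · left
        simp [hn, Int.toNat_of_nonpos hp]
      · right
        simp [hn, Int.toNat_of_nonpos (neg_nonpos.2 hp)]
    · rcases Nat.eq_zero_or_pos (n + (-p).toNat) with h | h
      · simp [h]
      · exact key n _ _ _ _ rfl (by omega)

theorem casimirOp_mem (k₁ k₂ : ℝ) (p : ℤ) {x : TensorEll2}
    (hx : x ∈ Submodule.span ℂ (Set.range (fVec p))) :
    ∃ h : x ∈ (casimirOp k₁ k₂).domain,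
      casimirOp k₁ k₂ ⟨x, h⟩ ∈ Submodule.span ℂ (Set.range (fVec p)) := by
  have hr : Set.range (fVec p) = tensorIncl '' Set.range (fAlg p) := by
    rw [← Set.range_comp]
    rfl
  rw [hr, Submodule.span_image] at hx ⊢
  obtain ⟨v, hv, rfl⟩ := hx
  have hd : tensorIncl v ∈ (casimirOp k₁ k₂).domain := LinearMap.mem_range_self tensorIncl v
  refine ⟨hd, ?_⟩
  rw [casimirOp_apply k₁ k₂ v hd]
  refine Submodule.mem_map_of_mem ?_
  clear hd
  induction hv using Submodule.span_induction with
  | mem y hy =>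
    obtain ⟨n, rfl⟩ := hy
    exact tensorCasimir_fAlg_mem k₁ k₂ p n
  | zero => simp
  | add y z _ _ hy hz =>
    rw [map_add]
    exact Submodule.add_mem _ hy hz
  | smul c y _ hy =>
    rw [map_smul]
    exact Submodule.smul_mem _ _ hy

/-- The restriction of `(π⁺_{k₁} ⊗ π⁻_{k₂})(Δ(Ω))` to `H_p`: an unbounded operator on `H_p` whose
domain is the space of finite linear combinations of the `f_n^p`. -/
def casimirHp (k₁ k₂ : ℝ) (p : ℤ) : Hp p →ₗ.[ℂ] Hp p where
  domain := (Submodule.span ℂ (Set.range (fVec p))).comap (Hp p).subtype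
  toFun :=
    { toFun := fun x => ⟨casimirOp k₁ k₂ ⟨((x : Hp p) : TensorEll2), (casimirOp_mem k₁ k₂ p x.2).1⟩,
        span_le_Hp p (casimirOp_mem k₁ k₂ p x.2).2⟩
      map_add' := fun x y => Subtype.ext ((casimirOp k₁ k₂).map_add
        ⟨((x : Hp p) : TensorEll2), (casimirOp_mem k₁ k₂ p x.2).1⟩
        ⟨((y : Hp p) : TensorEll2), (casimirOp_mem k₁ k₂ p y.2).1⟩)
      map_smul' := fun c x => Subtype.ext ((casimirOp k₁ k₂).map_smul c
        ⟨((x : Hp p) : TensorEll2), (casimirOp_mem k₁ k₂ p x.2).1⟩) }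

/-! ### Continuous dual Hahn polynomials -/

/-- The Pochhammer symbol `(a)_n = a (a + 1) ⋯ (a + n - 1)`. -/
def poch (a : ℝ) (n : ℕ) : ℝ := (ascPochhammer ℝ n).eval a

/-- The continuous dual Hahn polynomial
`S_n(y; a, b, c) = (a+b)_n (a+c)_n ₃F₂(-n, a + ix, a - ix; a + b, a + c; 1)`, `x² = y`.
The series terminates at `j = n`, and `(a + ix)_j (a - ix)_j = ∏_{l < j} ((a + l)² + y)`. -/
def dualHahn (a b c : ℝ) (n : ℕ) (y : ℝ) : ℝ :=
  poch (a + b) n * poch (a + c) n *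
    ∑ j ∈ Finset.range (n + 1), poch (-(n : ℝ)) j * (∏ l ∈ Finset.range j, ((a + l) ^ 2 + y)) /
      (poch (a + b) j * poch (a + c) j * (j.factorial : ℝ))

/-- The orthonormal continuous dual Hahn polynomial
`Ŝ_n = (-1)^n S_n / √(n! (a+b)_n (a+c)_n (b+c)_n)`. -/
def dualHahnON (a b c : ℝ) (n : ℕ) (y : ℝ) : ℝ :=
  (-1) ^ n * dualHahn a b c n y /
    Real.sqrt ((n.factorial : ℝ) * poch (a + b) n * poch (a + c) n * poch (b + c) n)

/-- The weight
`(1 / 2π) |Γ(a+ix) Γ(b+ix) Γ(c+ix) / Γ(2ix)|² / (Γ(a+b) Γ(a+c) Γ(b+c))` on `x > 0`. -/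
def dualHahnWeight (a b c : ℝ) (x : ℝ) : ℝ :=
  1 / (2 * Real.pi) *
    ‖Complex.Gamma (a + Complex.I * x) * Complex.Gamma (b + Complex.I * x) *
      Complex.Gamma (c + Complex.I * x) / Complex.Gamma (2 * Complex.I * x)‖ ^ 2 /
    (Real.Gamma (a + b) * Real.Gamma (a + c) * Real.Gamma (b + c))

/-- The mass at the point `-(a + k)²`, when `a` is the smallest parameter and `a + k < 0`. -/
def dualHahnMass (a b c : ℝ) (k : ℕ) : ℝ :=
  Real.Gamma (b - a) * Real.Gamma (c - a) / (Real.Gamma (-2 * a) * Real.Gamma (b + c)) *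
    ((-1) ^ k * (poch (2 * a) k * poch (a + 1) k * poch (a + b) k * poch (a + c) k) /
      (poch a k * poch (a - b + 1) k * poch (a - c + 1) k * (k.factorial : ℝ)))

/-- The orthogonality measure when `a` is the smallest parameter: the image under `x ↦ x²` of the
weight on `(0, ∞)`, plus the point masses at `-(a + k)²` for the integers `k ≥ 0` with `a + k < 0`,
that is, `k < ⌈-a⌉₊`. -/
def dualHahnMeasureAux (a b c : ℝ) : MeasureTheory.Measure ℝ :=
  MeasureTheory.Measure.map (fun x : ℝ => x ^ 2)
      ((MeasureTheory.volume.restrict (Set.Ioi (0 : ℝ))).withDensity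
        fun x => ENNReal.ofReal (dualHahnWeight a b c x)) +
    ∑ k ∈ Finset.range ⌈-a⌉₊,
      ENNReal.ofReal (dualHahnMass a b c k) • MeasureTheory.Measure.dirac (-(a + k) ^ 2)

/-- The measure `dμ²(·; a, b, c)`. The polynomials are symmetric in `a`, `b`, `c`; the measure is
given by the above formula after the parameters are permuted so that the smallest one comes
first. -/
def dualHahnMeasure (a b c : ℝ) : MeasureTheory.Measure ℝ :=
  if a ≤ b ∧ a ≤ c then dualHahnMeasureAux a b c
  else if b ≤ c then dualHahnMeasureAux b a c
  else dualHahnMeasureAux c a b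

/-! ### Multiplication operators -/

/-- The operator `M_g` of multiplication by `g` on `L²(ℝ, μ)`, with its maximal domain
`{f ∈ L² : g f ∈ L²}`. -/
def mulOp (μ : MeasureTheory.Measure ℝ) (g : ℝ → ℂ) :
    MeasureTheory.Lp ℂ 2 μ →ₗ.[ℂ] MeasureTheory.Lp ℂ 2 μ where
  domain :=
    { carrier := {f | MeasureTheory.MemLp (fun y => g y * f y) 2 μ}
      zero_mem' := by
        refine (MeasureTheory.memLp_congr_ae ?_).2 (MeasureTheory.MemLp.zero (ε := ℂ))
        filter_upwards [MeasureTheory.Lp.coeFn_zero ℂ 2 μ] with y hy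
        simp only [hy, Pi.zero_apply, mul_zero]
      add_mem' := by
        intro f h hf hh
        refine (MeasureTheory.memLp_congr_ae ?_).2 (hf.add hh)
        filter_upwards [MeasureTheory.Lp.coeFn_add f h] with y hy
        simp only [hy, Pi.add_apply, mul_add]
      smul_mem' := by
        intro c f hf
        refine (MeasureTheory.memLp_congr_ae ?_).2 (hf.const_smul c)
        filter_upwards [MeasureTheory.Lp.coeFn_smul c f] with y hy
        simp only [hy, Pi.smul_apply, smul_eq_mul, mul_left_comm] }
  toFun :=
    { toFun := fun f => MeasureTheory.MemLp.toLp _ f.2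
      map_add' := by
        intro f h
        rw [← MeasureTheory.MemLp.toLp_add]
        refine MeasureTheory.MemLp.toLp_congr _ _ ?_
        filter_upwards [MeasureTheory.Lp.coeFn_add (f : MeasureTheory.Lp ℂ 2 μ) h] with y hy
        simp only [Submodule.coe_add, hy, Pi.add_apply, mul_add]
      map_smul' := by
        intro c f
        rw [RingHom.id_apply, ← MeasureTheory.MemLp.toLp_const_smul]
        refine MeasureTheory.MemLp.toLp_congr _ _ ?_
        filter_upwards [MeasureTheory.Lp.coeFn_smul c (f : MeasureTheory.Lp ℂ 2 μ)] with y hy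
        simp only [Submodule.coe_smul, hy, Pi.smul_apply, smul_eq_mul, mul_left_comm] }

end SU11

end

/-!
The vectors `f_n^p` form an orthonormal basis of `H_p`, and on it the Casimir operator acts as a
Jacobi matrix (`tensorCasimir_fAlg`) whose entries are, once `1/4` is subtracted on the diagonal, the
coefficients in the three-term recurrence relation of the normalized continuous dual Hahn
polynomials `Ŝ_n` (`mul_dualHahnON`). So `f_n^p ↦ Ŝ_n` intertwines the Casimir operator with
multiplication by `y + 1/4`, and everything rests on `Ŝ_n` being an orthonormal basis of
`L²(dμ²)`. All three sums `a + b`, `a + c`, `b + c` are positive, the recurrence coefficients are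
symmetric in the parameters (`dualHahnON_swap`, `dualHahnON_swap'`), and so `a` may be taken to be
the smallest parameter; then `b` and `c` are positive while `a` may be negative.

*Orthogonality.* Multiplication by `y + a²` turns the measure with parameters `a, b, c` into
`(a + b)(a + c)` times the one with parameters `a + 1, b, c`, point masses included
(`withDensity_dualHahnMeasureAux`). Since `S_n` is a combination of the products
`∏_{i < j} (y + (a + i)²)`, its integral is determined by the total masses of the shifted measures,
and vanishes for `n ≥ 1` if they are all `1`. Orthonormality follows from this by the recurrence
relation alone (`functional_mul_eq`). It remains to see that the total mass is `1`.

*Total mass, positive parameters.* Shifting a contour by `1` shows that the integral of the weight,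
divided by the expected product of Gamma functions, is invariant under `a ↦ a + 1`
(`hahnIntegral_add_one`). As `|Γ(s + iτ)| / Γ(s)` is increasing in `s`, this ratio is also
monotone in each parameter, hence constant (`hahnRatio_eq`), and for `a = b = c = 1/2` it is an
elementary integral. The case `a = 0` is a limit.

*Total mass, negative `a`.* Assume that the mass is `1` for `a + 1`, and let `T` be the mass for `a`.
Then the Gram matrix of the `Ŝ_n` is the identity plus `T - 1` times the rank-one matrix with entries
`Ŝ_n(-a²) Ŝ_m(-a²)`. By Gauss's summation formula, `∑ Ŝ_n(-a²)² = 1 / m` where `m` is the mass of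
the atom at `-a²`. The indicator function of this atom is then a vector which forces `T = 1`, by
completeness of the polynomials (`perturbation_eq_zero`).

*Completeness.* The measure has exponential moments in `√|y|`. A function orthogonal to all
polynomials vanishes because a measure on `[0, ∞)` with such moments, viewed as a symmetric measure
on the real line by `y = t²`, has an analytic moment generating function
(`measure_ext_of_moments`); negative `a` is reduced to `a + 1`.

*Closures.* The same completeness applied with the weight `y + 1/4 + i` shows that the Casimir
operator plus `i` has dense range. Its closure therefore has everywhere defined resolvent
`(y + 1/4 + i)⁻¹`, and is the maximal multiplication operator (`topologicalClosure_graph_eq`).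
-/

namespace SU11

open Filter Topology MeasureTheory ProbabilityTheory Polynomial

/-! ### Bounds for the Gamma function on vertical lines -/

theorem norm_add_I_mul_sq (s τ : ℝ) : ‖(s : ℂ) + Complex.I * τ‖ ^ 2 = s ^ 2 + τ ^ 2 := by
  rw [← Complex.normSq_eq_norm_sq]
  simp [Complex.normSq_apply]
  ring

theorem norm_add_I_mul_mul_le {s t : ℝ} (hs : 0 ≤ s) (hst : s ≤ t) (τ : ℝ) :
    ‖(t : ℂ) + Complex.I * τ‖ * s ≤ ‖(s : ℂ) + Complex.I * τ‖ * t := by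
  have ht := hs.trans hst
  refine (pow_le_pow_iff_left₀ (by positivity) (by positivity) two_ne_zero).1 ?_
  rw [mul_pow, mul_pow, norm_add_I_mul_sq, norm_add_I_mul_sq]
  have : s ^ 2 ≤ t ^ 2 := pow_le_pow_left₀ hs hst 2
  nlinarith [sq_nonneg τ, mul_le_mul_of_nonneg_left this (sq_nonneg τ)]

theorem norm_GammaSeq (s τ : ℝ) {n : ℕ} (hn : n ≠ 0) :
    ‖Complex.GammaSeq (s + Complex.I * τ) n‖ =
      (n : ℝ) ^ s * n.factorial / ∏ j ∈ Finset.range (n + 1), ‖((s + j : ℝ) : ℂ) + Complex.I * τ‖ := by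
  rw [Complex.GammaSeq, norm_div, norm_mul, norm_prod, ← Complex.ofReal_natCast,
    Complex.norm_cpow_eq_rpow_re_of_pos (by positivity)]
  simp only [Complex.add_re, Complex.ofReal_re, Complex.mul_re, Complex.I_re, Complex.I_im,
    Complex.ofReal_im, zero_mul, one_mul, sub_self, add_zero, Complex.norm_natCast]
  congr 1
  refine Finset.prod_congr rfl fun j _ => ?_
  congr 1
  push_cast
  ring

/-- The quotient `|Γ(s + iτ)| / Γ(s)` increases with `s`: in Euler's product for `Γ` every factor
`s / |s + iτ|` does. -/
theorem norm_Gamma_mul_Gamma_le {s t : ℝ} (hs : 0 < s) (hst : s ≤ t) (τ : ℝ) :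
    ‖Complex.Gamma (s + Complex.I * τ)‖ * Real.Gamma t ≤
      ‖Complex.Gamma (t + Complex.I * τ)‖ * Real.Gamma s := by
  have ht := hs.trans_le hst
  have l1 := ((Complex.GammaSeq_tendsto_Gamma (s + Complex.I * τ)).norm).mul
    (Real.GammaSeq_tendsto_Gamma t)
  have l2 := ((Complex.GammaSeq_tendsto_Gamma (t + Complex.I * τ)).norm).mul
    (Real.GammaSeq_tendsto_Gamma s)
  refine le_of_tendsto_of_tendsto l1 l2 ?_
  filter_upwards [eventually_ne_atTop 0] with n hn
  rw [norm_GammaSeq _ _ hn, norm_GammaSeq _ _ hn, Real.GammaSeq, Real.GammaSeq,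
    div_mul_div_comm, div_mul_div_comm]
  have pos : ∀ r : ℝ, 0 < r → ∀ j : ℕ, 0 < ‖((r + j : ℝ) : ℂ) + Complex.I * τ‖ := by
    intro r hr j
    have := norm_add_I_mul_sq (r + j) τ
    have h : 0 < (r + j) ^ 2 + τ ^ 2 := by positivity
    rw [← this] at h
    refine norm_pos_iff.2 fun h0 => ?_
    rw [h0] at h
    simp at h
  rw [mul_comm ((n : ℝ) ^ t * n.factorial)]
  refine div_le_div_of_nonneg_left (by positivity) ?_ ?_
  · exact mul_pos (Finset.prod_pos fun j _ => pos t ht j) (Finset.prod_pos fun j _ => by positivity)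
  · rw [← Finset.prod_mul_distrib, ← Finset.prod_mul_distrib]
    exact Finset.prod_le_prod (fun j _ => by positivity)
      fun j _ => norm_add_I_mul_mul_le (by positivity) (by linarith) τ

theorem Gamma_conj_I (s τ : ℝ) :
    Complex.Gamma (s - Complex.I * τ) = (starRingEnd ℂ) (Complex.Gamma (s + Complex.I * τ)) := by
  rw [← Complex.Gamma_conj]
  congr 1
  simp
  ring

theorem Gamma_mul_Gamma_conj (s τ : ℝ) :
    Complex.Gamma (s + Complex.I * τ) * Complex.Gamma (s - Complex.I * τ) =
      ((‖Complex.Gamma (s + Complex.I * τ)‖ ^ 2 : ℝ) : ℂ) := by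
  rw [Gamma_conj_I, Complex.mul_conj, Complex.normSq_eq_norm_sq]

theorem norm_Gamma_half_sq (τ : ℝ) :
    ‖Complex.Gamma ((1 / 2 : ℝ) + Complex.I * τ)‖ ^ 2 = Real.pi / Real.cosh (Real.pi * τ) := by
  have h := Complex.Gamma_mul_Gamma_one_sub ((1 / 2 : ℝ) + Complex.I * τ)
  have e : (1 : ℂ) - ((1 / 2 : ℝ) + Complex.I * τ) = (1 / 2 : ℝ) - Complex.I * τ := by
    push_cast; ring
  have e2 : (Real.pi : ℂ) * ((1 / 2 : ℝ) + Complex.I * τ) =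
      (Real.pi * τ : ℝ) * Complex.I + Real.pi / 2 := by push_cast; ring
  rw [e, Gamma_mul_Gamma_conj, e2, Complex.sin_add_pi_div_two, Complex.cos_mul_I] at h
  exact_mod_cast h

theorem norm_Gamma_add_one_sq (s τ : ℝ) (h : s ≠ 0 ∨ τ ≠ 0) :
    ‖Complex.Gamma ((s + 1 : ℝ) + Complex.I * τ)‖ ^ 2 =
      (s ^ 2 + τ ^ 2) * ‖Complex.Gamma (s + Complex.I * τ)‖ ^ 2 := by
  have hne : (s : ℂ) + Complex.I * τ ≠ 0 := by
    intro h0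
    have := norm_add_I_mul_sq s τ
    rw [h0, norm_zero] at this
    rcases h with h | h <;> have := sq_pos_of_ne_zero h <;> nlinarith [sq_nonneg s, sq_nonneg τ]
  have e : ((s + 1 : ℝ) : ℂ) + Complex.I * τ = (s + Complex.I * τ) + 1 := by push_cast; ring
  rw [e, Complex.Gamma_add_one _ hne, norm_mul, mul_pow, norm_add_I_mul_sq]

theorem norm_Gamma_half_add_nat_sq_le (n : ℕ) : ∃ C : ℝ, 0 ≤ C ∧ ∀ τ : ℝ,
    ‖Complex.Gamma ((1 / 2 + n : ℝ) + Complex.I * τ)‖ ^ 2 ≤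
      C * (1 + τ ^ 2) ^ n * Real.exp (-(Real.pi * |τ|)) := by
  induction n with
  | zero =>
    refine ⟨2 * Real.pi, by positivity, fun τ => ?_⟩
    have h := norm_Gamma_half_sq τ
    simp only [Nat.cast_zero, add_zero, pow_zero, mul_one]
    rw [h, div_le_iff₀ (Real.cosh_pos _), ← Real.cosh_abs, abs_mul, abs_of_pos Real.pi_pos,
      Real.cosh_eq, Real.exp_neg]
    have := Real.exp_pos (Real.pi * |τ|)
    field_simp
    nlinarith [Real.pi_pos, Real.exp_pos (-(Real.pi * |τ|))]
  | succ n ih =>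
    obtain ⟨C, hC, h⟩ := ih
    refine ⟨C * (1 / 2 + n) ^ 2 + C, by positivity, fun τ => ?_⟩
    have e : (1 / 2 + (n + 1 : ℕ) : ℝ) = (1 / 2 + n) + 1 := by push_cast; ring
    rw [e, norm_Gamma_add_one_sq _ _ (Or.inl (by positivity))]
    calc _ ≤ ((1 / 2 + n : ℝ) ^ 2 + τ ^ 2) * (C * (1 + τ ^ 2) ^ n * Real.exp (-(Real.pi * |τ|))) := by
          gcongr; exact h τ
      _ ≤ (((1 / 2 + n : ℝ) ^ 2 + 1) * (1 + τ ^ 2)) *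
          (C * (1 + τ ^ 2) ^ n * Real.exp (-(Real.pi * |τ|))) := by
          gcongr
          nlinarith [sq_nonneg τ, mul_nonneg (sq_nonneg τ) (sq_nonneg (1 / 2 + n : ℝ))]
      _ = _ := by ring

/-- On a vertical strip inside the right half plane, `|Γ(σ + iτ)|²` is at most `exp(-π|τ|)` times a
polynomial. -/
theorem norm_Gamma_sq_le {σ₀ : ℝ} (h0 : 0 < σ₀) (σ₁ : ℝ) : ∃ (C : ℝ) (N : ℕ), 0 ≤ C ∧
    ∀ σ ∈ Set.Icc σ₀ σ₁, ∀ τ : ℝ, ‖Complex.Gamma (σ + Complex.I * τ)‖ ^ 2 ≤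
      C * (1 + τ ^ 2) ^ N * Real.exp (-(Real.pi * |τ|)) := by
  obtain ⟨N, hN⟩ := exists_nat_gt σ₁
  obtain ⟨C, hC, h⟩ := norm_Gamma_half_add_nat_sq_le N
  have hc : ContinuousOn Real.Gamma (Set.Icc σ₀ σ₁) := fun x hx =>
    (Real.differentiableAt_Gamma fun m => by
      have : (0 : ℝ) ≤ m := m.cast_nonneg
      linarith [hx.1]).continuousAt.continuousWithinAt
  obtain ⟨M, hM⟩ := isCompact_Icc.exists_bound_of_continuousOn hc
  set G := Real.Gamma (1 / 2 + N) with hG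
  have hGpos : 0 < G := Real.Gamma_pos_of_pos (by positivity)
  refine ⟨(M / G) ^ 2 * C, N, by positivity, fun σ hσ τ => ?_⟩
  have hσ0 : 0 < σ := h0.trans_le hσ.1
  have hm := norm_Gamma_mul_Gamma_le hσ0 (t := 1 / 2 + N) (by linarith [hσ.2]) τ
  have hΓ : Real.Gamma σ ≤ M := (le_abs_self _).trans (hM σ hσ)
  have hM0 : 0 ≤ M := (Real.Gamma_pos_of_pos hσ0).le.trans hΓ
  have h1 : ‖Complex.Gamma (σ + Complex.I * τ)‖ ≤
      M / G * ‖Complex.Gamma ((1 / 2 + N : ℝ) + Complex.I * τ)‖ := by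
    rw [div_mul_eq_mul_div, le_div_iff₀ hGpos, mul_comm M]
    exact hm.trans (by gcongr)
  calc _ ≤ (M / G * ‖Complex.Gamma ((1 / 2 + N : ℝ) + Complex.I * τ)‖) ^ 2 := by gcongr
    _ = (M / G) ^ 2 * ‖Complex.Gamma ((1 / 2 + N : ℝ) + Complex.I * τ)‖ ^ 2 := by ring
    _ ≤ (M / G) ^ 2 * (C * (1 + τ ^ 2) ^ N * Real.exp (-(Real.pi * |τ|))) := by
        gcongr; exact h τ
    _ = _ := by ring

theorem norm_Gamma_two_I_sq (x : ℝ) (hx : x ≠ 0) :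
    ‖Complex.Gamma (2 * Complex.I * x)‖ ^ 2 = Real.pi / (2 * x * Real.sinh (2 * Real.pi * x)) := by
  have h := Complex.Gamma_mul_Gamma_one_sub (2 * Complex.I * x)
  have hne : -(2 * Complex.I * x : ℂ) ≠ 0 := by simp [hx]
  have e : (1 : ℂ) - 2 * Complex.I * x = -(2 * Complex.I * x) + 1 := by ring
  have e2 : (Real.pi : ℂ) * (2 * Complex.I * x) = (2 * Real.pi * x : ℝ) * Complex.I := by
    push_cast; ring
  have e3 : Complex.Gamma (-(2 * Complex.I * x)) =
      (starRingEnd ℂ) (Complex.Gamma (2 * Complex.I * x)) := by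
    rw [← Complex.Gamma_conj]; congr 1; simp [map_ofNat]
  rw [e, Complex.Gamma_add_one _ hne, e2, Complex.sin_mul_I, mul_left_comm, e3, Complex.mul_conj,
    Complex.normSq_eq_norm_sq, ← Complex.ofReal_sinh] at h
  have hs : Real.sinh (2 * Real.pi * x) ≠ 0 := by
    rw [Ne, Real.sinh_eq_zero]
    simp [hx, Real.pi_ne_zero]
  have hs' : (Real.sinh (2 * Real.pi * x) : ℂ) ≠ 0 := by exact_mod_cast hs
  have hx' : (x : ℂ) ≠ 0 := by exact_mod_cast hx
  rw [eq_div_iff (by positivity)]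
  rw [eq_div_iff (mul_ne_zero hs' Complex.I_ne_zero)] at h
  have : ((‖Complex.Gamma (2 * Complex.I * x)‖ ^ 2 * (2 * x * Real.sinh (2 * Real.pi * x)) : ℝ) : ℂ)
      = (Real.pi : ℂ) := by
    rw [← h]
    push_cast
    ring_nf
    simp
  exact_mod_cast this

theorem one_add_sq_pow_le_exp (N : ℕ) {ε : ℝ} (hε : 0 < ε) : ∃ K : ℝ, 0 ≤ K ∧
    ∀ x : ℝ, (1 + x ^ 2) ^ N ≤ K * Real.exp (ε * |x|) := by
  set δ := ε / (2 * N + 1) with hδ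
  have hδ0 : 0 < δ := by positivity
  set M := 1 + 1 / δ with hM
  have hM0 : 0 < M := by positivity
  refine ⟨(M ^ 2) ^ N, by positivity, fun x => ?_⟩
  have h1 : 1 + |x| ≤ M * Real.exp (δ * |x|) := by
    have h := Real.add_one_le_exp (δ * |x|)
    have hx := abs_nonneg x
    calc 1 + |x| ≤ M * (δ * |x| + 1) := by
          rw [hM]; field_simp; nlinarith [mul_nonneg hδ0.le hx]
      _ ≤ _ := by gcongr
  have h2 : 1 + x ^ 2 ≤ M ^ 2 * Real.exp (2 * δ * |x|) := by
    calc 1 + x ^ 2 ≤ (1 + |x|) ^ 2 := by rw [← sq_abs x]; nlinarith [abs_nonneg x]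
      _ ≤ (M * Real.exp (δ * |x|)) ^ 2 := by gcongr
      _ = _ := by rw [mul_pow, ← Real.exp_nat_mul]; congr 2; push_cast; ring
  calc (1 + x ^ 2) ^ N ≤ (M ^ 2 * Real.exp (2 * δ * |x|)) ^ N := by gcongr
    _ = (M ^ 2) ^ N * Real.exp (N * (2 * δ * |x|)) := by rw [mul_pow, ← Real.exp_nat_mul]
    _ ≤ _ := by
      refine mul_le_mul_of_nonneg_left (Real.exp_le_exp.2 ?_) (by positivity)
      have hle : 2 * N * δ ≤ ε := by
        rw [hδ, mul_div_assoc', div_le_iff₀ (by positivity)]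
        nlinarith
      calc _ = 2 * N * δ * |x| := by ring
        _ ≤ _ := by gcongr

theorem norm_Gamma_sq_le_exp {σ₀ : ℝ} (h0 : 0 < σ₀) (σ₁ : ℝ) {ε : ℝ} (hε : 0 < ε) :
    ∃ C : ℝ, 0 ≤ C ∧ ∀ σ ∈ Set.Icc σ₀ σ₁, ∀ τ : ℝ,
      ‖Complex.Gamma (σ + Complex.I * τ)‖ ^ 2 ≤ C * Real.exp (-(Real.pi - ε) * |τ|) := by
  obtain ⟨C, N, hC, h⟩ := norm_Gamma_sq_le h0 σ₁
  obtain ⟨K, hK, hK'⟩ := one_add_sq_pow_le_exp N hε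
  refine ⟨C * K, by positivity, fun σ hσ τ => (h σ hσ τ).trans ?_⟩
  calc _ ≤ C * (K * Real.exp (ε * |τ|)) * Real.exp (-(Real.pi * |τ|)) := by gcongr; exact hK' τ
    _ = C * K * (Real.exp (ε * |τ|) * Real.exp (-(Real.pi * |τ|))) := by ring
    _ = _ := by rw [← Real.exp_add]; congr 2; ring

/-- In contrast to `norm_Gamma_sq_le_exp`, the line may lie anywhere: the factor `x²` compensates
for the pole of `Γ` that it may hit. -/
theorem sq_mul_norm_Gamma_sq_le_exp (a : ℝ) {ε : ℝ} (hε : 0 < ε) :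
    ∃ C : ℝ, 0 ≤ C ∧ ∀ x : ℝ,
      x ^ 2 * ‖Complex.Gamma (a + Complex.I * x)‖ ^ 2 ≤ C * Real.exp (-(Real.pi - ε) * |x|) := by
  obtain ⟨n, hn⟩ := exists_nat_gt (-a)
  induction n generalizing a with
  | zero =>
    have ha : 0 < a := by simpa using hn
    obtain ⟨C, hC, h⟩ := norm_Gamma_sq_le_exp ha a (half_pos hε)
    obtain ⟨K, hK, hK'⟩ := one_add_sq_pow_le_exp 1 (half_pos hε)
    refine ⟨K * C, by positivity, fun x => ?_⟩
    have h1 : x ^ 2 ≤ K * Real.exp (ε / 2 * |x|) := by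
      have := hK' x
      rw [pow_one] at this
      linarith
    calc _ ≤ (K * Real.exp (ε / 2 * |x|)) * (C * Real.exp (-(Real.pi - ε / 2) * |x|)) := by
          gcongr; exact h a ⟨le_rfl, le_rfl⟩ x
      _ = K * C * (Real.exp (ε / 2 * |x|) * Real.exp (-(Real.pi - ε / 2) * |x|)) := by ring
      _ = _ := by rw [← Real.exp_add]; congr 2; ring
  | succ n ih =>
    rcases eq_or_ne a 0 with rfl | ha
    · obtain ⟨C, hC, h⟩ := norm_Gamma_sq_le_exp (σ₀ := 1) one_pos 1 hε
      refine ⟨C, hC, fun x => ?_⟩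
      rcases eq_or_ne x 0 with rfl | hx
      · simpa using hC
      · have := norm_Gamma_add_one_sq 0 x (Or.inr hx)
        have h2 := h 1 ⟨le_rfl, le_rfl⟩ x
        rw [zero_add] at this
        rw [this] at h2
        simpa using h2
    · obtain ⟨C, hC, h⟩ := ih (a + 1) (by push_cast at hn; linarith)
      refine ⟨C / a ^ 2, by positivity, fun x => ?_⟩
      have h2 := h x
      rw [norm_Gamma_add_one_sq a x (Or.inl ha)] at h2
      have ha2 : 0 < a ^ 2 := by positivity
      rw [div_mul_eq_mul_div, le_div_iff₀ ha2]
      refine le_trans ?_ h2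
      have : 0 ≤ x ^ 2 * ‖Complex.Gamma (a + Complex.I * x)‖ ^ 2 * x ^ 2 := by positivity
      nlinarith

/-! ### The weight -/

/-- The weight of the continuous dual Hahn polynomials without its normalising constant:
`|Γ(a+ix) Γ(b+ix) Γ(c+ix)|² x sinh(2πx)`, where `|Γ(2ix)|² = π / (2x sinh(2πx))`. -/
noncomputable def hahnKernel (a b c x : ℝ) : ℝ :=
  ‖Complex.Gamma (a + Complex.I * x)‖ ^ 2 * ‖Complex.Gamma (b + Complex.I * x)‖ ^ 2 *
    ‖Complex.Gamma (c + Complex.I * x)‖ ^ 2 * (x * Real.sinh (2 * Real.pi * x))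

theorem mul_sinh_nonneg (x : ℝ) : 0 ≤ x * Real.sinh (2 * Real.pi * x) := by
  rcases le_total 0 x with h | h
  · exact mul_nonneg h (Real.sinh_nonneg_iff.2 (by positivity))
  · exact mul_nonneg_of_nonpos_of_nonpos h
      (Real.sinh_nonpos_iff.2 (mul_nonpos_of_nonneg_of_nonpos (by positivity) h))

theorem hahnKernel_nonneg (a b c x : ℝ) : 0 ≤ hahnKernel a b c x :=
  mul_nonneg (by positivity) (mul_sinh_nonneg x)

theorem hahnKernel_swap (a b c x : ℝ) : hahnKernel a b c x = hahnKernel b a c x := by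
  simp only [hahnKernel]; ring

theorem hahnKernel_swap' (a b c x : ℝ) : hahnKernel a b c x = hahnKernel a c b x := by
  simp only [hahnKernel]; ring

theorem norm_Gamma_neg (a x : ℝ) :
    ‖Complex.Gamma (a + Complex.I * (-x : ℝ))‖ = ‖Complex.Gamma (a + Complex.I * x)‖ := by
  have : (a : ℂ) + Complex.I * (-x : ℝ) = a - Complex.I * x := by push_cast; ring
  rw [this, Gamma_conj_I, Complex.norm_conj]

theorem hahnKernel_neg (a b c x : ℝ) : hahnKernel a b c (-x) = hahnKernel a b c x := by
  simp only [hahnKernel, norm_Gamma_neg, mul_neg, Real.sinh_neg, neg_mul, neg_neg]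

theorem hahnKernel_abs (a b c x : ℝ) : hahnKernel a b c |x| = hahnKernel a b c x := by
  rcases abs_choice x with h | h <;> rw [h]
  exact hahnKernel_neg a b c x

theorem mul_sinh_le (x : ℝ) :
    x * Real.sinh (2 * Real.pi * x) ≤ 2 * Real.pi * (x ^ 2 * Real.exp (2 * Real.pi * |x|)) := by
  wlog hx : 0 ≤ x generalizing x
  · have := this (-x) (by linarith)
    simpa [Real.sinh_neg] using this
  rw [abs_of_nonneg hx]
  have hp := Real.pi_pos
  set t := 2 * Real.pi * x with ht
  have ht0 : 0 ≤ t := by positivity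
  have h : Real.sinh t ≤ t * Real.exp t := by
    have h1 := Real.add_one_le_exp (-(2 * t))
    have h2 : Real.exp (-t) = Real.exp (-(2 * t)) * Real.exp t := by
      rw [← Real.exp_add]; congr 1; ring
    rw [Real.sinh_eq, h2]
    nlinarith [Real.exp_pos t]
  calc x * Real.sinh t ≤ x * (t * Real.exp t) := by gcongr
    _ = _ := by rw [ht]; ring

/-- The exponent is `-π` up to any positive number; `-3` leaves room for the factor `exp(5x/2)`. -/
theorem hahnKernel_le_exp (a : ℝ) {b c : ℝ} (hb : 0 < b) (hc : 0 < c) :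
    ∃ C : ℝ, 0 ≤ C ∧ ∀ x : ℝ, hahnKernel a b c x ≤ C * Real.exp (-3 * |x|) := by
  have hε : (0 : ℝ) < 3 / 100 := by norm_num
  obtain ⟨A, hA, hA'⟩ := sq_mul_norm_Gamma_sq_le_exp a hε
  obtain ⟨B, hB, hB'⟩ := norm_Gamma_sq_le_exp hb b hε
  obtain ⟨D, hD, hD'⟩ := norm_Gamma_sq_le_exp hc c hε
  refine ⟨2 * Real.pi * (A * B * D), by positivity, fun x => ?_⟩
  set E := Real.exp (-(Real.pi - 3 / 100) * |x|)
  have hE : 0 < E := Real.exp_pos _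
  set G := Real.exp (2 * Real.pi * |x|)
  calc hahnKernel a b c x
      ≤ ‖Complex.Gamma (a + Complex.I * x)‖ ^ 2 * ‖Complex.Gamma (b + Complex.I * x)‖ ^ 2 *
          ‖Complex.Gamma (c + Complex.I * x)‖ ^ 2 * (2 * Real.pi * (x ^ 2 * G)) := by
        exact mul_le_mul_of_nonneg_left (mul_sinh_le x) (by positivity)
    _ = 2 * Real.pi * (x ^ 2 * ‖Complex.Gamma (a + Complex.I * x)‖ ^ 2) *
          ‖Complex.Gamma (b + Complex.I * x)‖ ^ 2 * ‖Complex.Gamma (c + Complex.I * x)‖ ^ 2 * G := by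
        ring
    _ ≤ 2 * Real.pi * (A * E) * (B * E) * (D * E) * G := by
        have h1 := hA' x
        have h2 := hB' b ⟨le_rfl, le_rfl⟩ x
        have h3 := hD' c ⟨le_rfl, le_rfl⟩ x
        refine mul_le_mul_of_nonneg_right ?_ (Real.exp_pos _).le
        refine mul_le_mul (mul_le_mul ?_ h2 (by positivity) (by positivity)) h3
          (by positivity) (by positivity)
        exact mul_le_mul_of_nonneg_left h1 (by positivity)
    _ = 2 * Real.pi * (A * B * D) * (E * E * E * G) := by ring
    _ ≤ _ := by
        gcongr
        rw [← Real.exp_add, ← Real.exp_add, ← Real.exp_add]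
        gcongr
        nlinarith [Real.pi_gt_d2, abs_nonneg x]

theorem integrable_exp_neg_mul_abs {r : ℝ} (hr : 0 < r) :
    Integrable fun x : ℝ => Real.exp (-r * |x|) := by
  have h1 : IntegrableOn (fun x : ℝ => Real.exp (-r * |x|)) (Set.Ioi 0) :=
    (exp_neg_integrableOn_Ioi 0 hr).congr_fun (fun x hx => by
      simp only [Set.mem_Ioi] at hx
      simp [abs_of_pos hx]) measurableSet_Ioi
  have h2 : IntegrableOn (fun x : ℝ => Real.exp (-r * |x|)) (Set.Iic 0) := by
    have := (integrableOn_Ici_iff_integrableOn_Ioi (μ := volume)).2 h1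
    rw [← neg_zero] at this
    simpa using this.comp_neg_Iic
  have := h2.union h1
  rwa [Set.Iic_union_Ioi, integrableOn_univ] at this

theorem continuous_norm_Gamma {a : ℝ} (ha : 0 < a) :
    Continuous fun x : ℝ => ‖Complex.Gamma (a + Complex.I * x)‖ := by
  refine continuous_iff_continuousAt.2 fun x => ?_
  refine ContinuousAt.norm ?_
  have h1 : ContinuousAt Complex.Gamma (a + Complex.I * x) := by
    refine (Complex.differentiableAt_Gamma _ fun m h => ?_).continuousAt
    have := congrArg Complex.re h
    have hm : (0 : ℝ) ≤ m := m.cast_nonneg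
    simp at this
    linarith
  exact ContinuousAt.comp (f := fun x : ℝ => (a + Complex.I * x : ℂ)) h1 (by fun_prop)

theorem continuousOn_norm_Gamma (a : ℝ) :
    ContinuousOn (fun x : ℝ => ‖Complex.Gamma (a + Complex.I * x)‖) (Set.Ioi 0) := by
  intro x hx
  refine ContinuousAt.continuousWithinAt (ContinuousAt.norm ?_)
  have h1 : ContinuousAt Complex.Gamma (a + Complex.I * x) := by
    refine (Complex.differentiableAt_Gamma _ fun m h => ?_).continuousAt
    have := congrArg Complex.im h
    simp at this
    exact (ne_of_gt (Set.mem_Ioi.1 hx)) this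
  exact ContinuousAt.comp (f := fun x : ℝ => (a + Complex.I * x : ℂ)) h1 (by fun_prop)

theorem continuous_hahnKernel {a b c : ℝ} (ha : 0 < a) (hb : 0 < b) (hc : 0 < c) :
    Continuous (hahnKernel a b c) := by
  have := continuous_norm_Gamma ha
  have := continuous_norm_Gamma hb
  have := continuous_norm_Gamma hc
  unfold hahnKernel
  fun_prop

theorem continuousOn_hahnKernel (a b c : ℝ) : ContinuousOn (hahnKernel a b c) (Set.Ioi 0) := by
  have := continuousOn_norm_Gamma a
  have := continuousOn_norm_Gamma b
  have := continuousOn_norm_Gamma c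
  unfold hahnKernel
  fun_prop

theorem integrable_hahnKernel {a b c : ℝ} (ha : 0 < a) (hb : 0 < b) (hc : 0 < c) :
    Integrable (hahnKernel a b c) := by
  obtain ⟨C, hC, h⟩ := hahnKernel_le_exp a hb hc
  refine ((integrable_exp_neg_mul_abs three_pos).const_mul C).mono'
    (continuous_hahnKernel ha hb hc).aestronglyMeasurable (ae_of_all _ fun x => ?_)
  rw [Real.norm_of_nonneg (hahnKernel_nonneg a b c x)]
  exact h x

theorem hahnKernel_add_one {a b c : ℝ} (x : ℝ) (h : a ≠ 0 ∨ x ≠ 0) :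
    hahnKernel (a + 1) b c x = (a ^ 2 + x ^ 2) * hahnKernel a b c x := by
  simp only [hahnKernel]
  rw [norm_Gamma_add_one_sq a x h]
  ring

/-- Two vertical lines carry the same integral of a function which is holomorphic on the strip
between them and decays at its ends. -/
theorem integral_vertical_eq {f : ℂ → ℂ} {r : ℝ} (hr : 0 ≤ r)
    (hf : ∀ z : ℂ, |z.re| ≤ r → DifferentiableAt ℂ f z) {C : ℝ}
    (hC : ∀ σ τ : ℝ, |σ| ≤ r → ‖f (σ + τ * Complex.I)‖ ≤ C * Real.exp (-|τ|)) :
    ∫ τ : ℝ, f (r + τ * Complex.I) = ∫ τ : ℝ, f (-r + τ * Complex.I) := by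
  have hint : ∀ s : ℝ, |s| ≤ r → Integrable fun τ : ℝ => f (s + τ * Complex.I) := by
    intro s hs
    have hcont : Continuous fun τ : ℝ => f (s + τ * Complex.I) := by
      refine continuous_iff_continuousAt.2 fun τ => ?_
      have h1 : ContinuousAt f (s + τ * Complex.I) := (hf _ (by simpa using hs)).continuousAt
      exact ContinuousAt.comp (f := fun τ : ℝ => (s + τ * Complex.I : ℂ)) h1 (by fun_prop)
    have h1 : Integrable fun x : ℝ => C * Real.exp (-|x|) := by
      simpa using (integrable_exp_neg_mul_abs one_pos).const_mul C
    exact h1.mono' hcont.aestronglyMeasurable (ae_of_all _ fun τ => hC s τ hs)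
  have hr' : |r| ≤ r := (abs_of_nonneg hr).le
  have hr'' : |-r| ≤ r := by rw [abs_neg]; exact hr'
  have l1 := intervalIntegral_tendsto_integral (hint r hr') tendsto_neg_atTop_atBot tendsto_id
  have l2 := intervalIntegral_tendsto_integral (hint (-r) hr'') tendsto_neg_atTop_atBot tendsto_id
  push_cast at l2
  have hdecay : Tendsto (fun T : ℝ => C * Real.exp (-|T|) * (2 * r)) atTop (𝓝 0) := by
    have : Tendsto (fun T : ℝ => Real.exp (-|T|)) atTop (𝓝 0) :=
      Real.tendsto_exp_neg_atTop_nhds_zero.comp tendsto_abs_atTop_atTop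
    simpa using (this.const_mul C).mul_const (2 * r)
  have hhor : ∀ T : ℝ, ‖∫ σ : ℝ in (-r)..r, f (σ + T * Complex.I)‖ ≤ C * Real.exp (-|T|) * (2 * r) := by
    intro T
    have := intervalIntegral.norm_integral_le_of_norm_le_const (a := -r) (b := r)
      (f := fun σ : ℝ => f (σ + T * Complex.I)) (C := C * Real.exp (-|T|)) (fun σ hσ => by
        rw [Set.uIoc_of_le (by linarith)] at hσ
        exact hC σ T (abs_le.2 ⟨hσ.1.le, hσ.2⟩))
    rwa [sub_neg_eq_add, ← two_mul, abs_of_nonneg (by linarith : (0 : ℝ) ≤ 2 * r)] at this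
  have h1 : Tendsto (fun T : ℝ => ∫ σ : ℝ in (-r)..r, f (σ + T * Complex.I)) atTop (𝓝 0) :=
    squeeze_zero_norm hhor hdecay
  have h2 : Tendsto (fun T : ℝ => ∫ σ : ℝ in (-r)..r, f (σ + (-T : ℝ) * Complex.I)) atTop (𝓝 0) :=
    squeeze_zero_norm (fun T => by simpa using hhor (-T)) hdecay
  have hrect : ∀ T : ℝ, (∫ σ : ℝ in (-r)..r, f (σ + (-T : ℝ) * Complex.I)) -
      (∫ σ : ℝ in (-r)..r, f (σ + T * Complex.I)) +
      Complex.I • (∫ τ : ℝ in (-T)..T, f (r + τ * Complex.I)) -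
      Complex.I • (∫ τ : ℝ in (-T)..T, f (-r + τ * Complex.I)) = 0 := by
    intro T
    have := Complex.integral_boundary_rect_eq_zero_of_differentiableOn f
      ((-r : ℝ) + (-T : ℝ) * Complex.I) (r + T * Complex.I) (fun z hz => by
        refine (hf z ?_).differentiableWithinAt
        have h := hz.1
        simp only [Set.mem_preimage] at h
        rw [Set.uIcc_of_le (by simpa using by linarith)] at h
        simpa [abs_le] using h)
    simpa using this
  have hlim := ((h2.sub h1).add (l1.const_smul Complex.I)).sub (l2.const_smul Complex.I)
  have h0 := tendsto_nhds_unique hlim ((tendsto_const_nhds (x := (0 : ℂ))).congr fun T =>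
    (hrect T).symm)
  simp only [sub_zero, zero_add, smul_eq_mul, ← mul_sub, mul_eq_zero, Complex.I_ne_zero,
    false_or] at h0
  exact sub_eq_zero.1 h0

/-! ### The integral of the weight, for positive parameters -/

/-- The function `∏ Γ(s + 1/2 + z) Γ(s + 1/2 - z) · sin(2πz)`, the product being over the
parameters `s = a, b, c`. It is holomorphic for `|Re z| ≤ 1/2`, and the difference of its values at
`ix + 1/2` and `ix - 1/2` is the weight times a linear polynomial in `x²`. -/
noncomputable def shiftFun (a b c : ℝ) (z : ℂ) : ℂ :=
  Complex.Gamma (a + 1 / 2 + z) * Complex.Gamma (a + 1 / 2 - z) *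
    (Complex.Gamma (b + 1 / 2 + z) * Complex.Gamma (b + 1 / 2 - z)) *
    (Complex.Gamma (c + 1 / 2 + z) * Complex.Gamma (c + 1 / 2 - z)) * Complex.sin (2 * Real.pi * z)

theorem differentiableAt_shiftFun {a b c : ℝ} (ha : 0 < a) (hb : 0 < b) (hc : 0 < c) {z : ℂ}
    (hz : |z.re| ≤ 1 / 2) : DifferentiableAt ℂ (shiftFun a b c) z := by
  have hz' := abs_le.1 hz
  have key : ∀ s : ℝ, 0 < s → DifferentiableAt ℂ (fun z : ℂ => Complex.Gamma (s + 1 / 2 + z)) z ∧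
      DifferentiableAt ℂ (fun z : ℂ => Complex.Gamma (s + 1 / 2 - z)) z := by
    intro s hs
    have h : ∀ w : ℂ, 0 < w.re → DifferentiableAt ℂ Complex.Gamma w := fun w hw =>
      Complex.differentiableAt_Gamma _ fun m h => by
        have := congrArg Complex.re h
        have hm : (0 : ℝ) ≤ m := m.cast_nonneg
        simp at this
        linarith
    refine ⟨DifferentiableAt.comp (f := fun z : ℂ => (s + 1 / 2 + z : ℂ)) z (h _ ?_) (by fun_prop),
      DifferentiableAt.comp (f := fun z : ℂ => (s + 1 / 2 - z : ℂ)) z (h _ ?_) (by fun_prop)⟩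
    · simp; linarith [hz'.1]
    · simp; linarith [hz'.2]
  obtain ⟨a1, a2⟩ := key a ha
  obtain ⟨b1, b2⟩ := key b hb
  obtain ⟨c1, c2⟩ := key c hc
  unfold shiftFun
  fun_prop

theorem norm_sin_le (z : ℂ) : ‖Complex.sin z‖ ≤ Real.exp |z.im| := by
  rw [Complex.sin, norm_div, norm_mul, Complex.norm_I, mul_one, Complex.norm_ofNat]
  have h1 : ‖Complex.exp (-z * Complex.I)‖ ≤ Real.exp |z.im| := by
    rw [Complex.norm_exp]; simp [le_abs_self]
  have h2 : ‖Complex.exp (z * Complex.I)‖ ≤ Real.exp |z.im| := by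
    rw [Complex.norm_exp]; simp [neg_le_abs]
  have := norm_sub_le (Complex.exp (-z * Complex.I)) (Complex.exp (z * Complex.I))
  linarith

theorem norm_Gamma_mul_Gamma_le_exp {s : ℝ} (hs : 0 < s) : ∃ C : ℝ, 0 ≤ C ∧
    ∀ σ τ : ℝ, |σ| ≤ 1 / 2 →
      ‖Complex.Gamma (s + 1 / 2 + (σ + τ * Complex.I)) *
        Complex.Gamma (s + 1 / 2 - (σ + τ * Complex.I))‖ ≤ C * Real.exp (-3 * |τ|) := by
  obtain ⟨C, hC, h⟩ := norm_Gamma_sq_le_exp hs (s + 1) (ε := 14 / 100) (by norm_num)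
  refine ⟨C, hC, fun σ τ hσ => ?_⟩
  obtain ⟨h1, h2⟩ := abs_le.1 hσ
  have e1 : (s + 1 / 2 + (σ + τ * Complex.I) : ℂ) = ((s + 1 / 2 + σ : ℝ) : ℂ) + Complex.I * τ := by
    push_cast; ring
  have e2 : (s + 1 / 2 - (σ + τ * Complex.I) : ℂ) =
      ((s + 1 / 2 - σ : ℝ) : ℂ) + Complex.I * (-τ : ℝ) := by push_cast; ring
  rw [e1, e2, norm_mul, norm_Gamma_neg]
  have k1 := h (s + 1 / 2 + σ) ⟨by linarith, by linarith⟩ τ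
  have k2 := h (s + 1 / 2 - σ) ⟨by linarith, by linarith⟩ τ
  have k3 : C * Real.exp (-(Real.pi - 14 / 100) * |τ|) ≤ C * Real.exp (-3 * |τ|) := by
    gcongr
    linarith [Real.pi_gt_d2]
  nlinarith [sq_nonneg (‖Complex.Gamma ((s + 1 / 2 + σ : ℝ) + Complex.I * τ)‖ -
    ‖Complex.Gamma ((s + 1 / 2 - σ : ℝ) + Complex.I * τ)‖)]

theorem norm_shiftFun_le {a b c : ℝ} (ha : 0 < a) (hb : 0 < b) (hc : 0 < c) : ∃ C : ℝ,
    ∀ σ τ : ℝ, |σ| ≤ 1 / 2 → ‖shiftFun a b c (σ + τ * Complex.I)‖ ≤ C * Real.exp (-|τ|) := by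
  obtain ⟨A, hA, hA'⟩ := norm_Gamma_mul_Gamma_le_exp ha
  obtain ⟨B, hB, hB'⟩ := norm_Gamma_mul_Gamma_le_exp hb
  obtain ⟨D, hD, hD'⟩ := norm_Gamma_mul_Gamma_le_exp hc
  refine ⟨A * B * D, fun σ τ hσ => ?_⟩
  have hs : ‖Complex.sin (2 * Real.pi * (σ + τ * Complex.I))‖ ≤ Real.exp (8 * |τ|) := by
    refine (norm_sin_le _).trans (Real.exp_le_exp.2 ?_)
    have : (2 * Real.pi * (σ + τ * Complex.I) : ℂ).im = 2 * Real.pi * τ := by simp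
    rw [this, abs_mul, abs_of_pos (by positivity)]
    gcongr
    linarith [Real.pi_lt_four]
  rw [shiftFun, norm_mul, norm_mul, norm_mul]
  calc _ ≤ A * Real.exp (-3 * |τ|) * (B * Real.exp (-3 * |τ|)) * (D * Real.exp (-3 * |τ|)) *
        Real.exp (8 * |τ|) := by
        refine mul_le_mul (mul_le_mul (mul_le_mul ?_ ?_ (by positivity) (by positivity)) ?_
          (by positivity) (by positivity)) hs (by positivity) (by positivity)
        exacts [hA' σ τ hσ, hB' σ τ hσ, hD' σ τ hσ]
    _ = A * B * D * (Real.exp (-3 * |τ|) * Real.exp (-3 * |τ|) * Real.exp (-3 * |τ|) *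
        Real.exp (8 * |τ|)) := by ring
    _ = _ := by
        rw [← Real.exp_add, ← Real.exp_add, ← Real.exp_add]
        congr 2
        ring

theorem shiftFun_sub {a b c : ℝ} (ha : 0 < a) (hb : 0 < b) (hc : 0 < c) (x : ℝ) :
    shiftFun a b c ((1 / 2 : ℝ) + x * Complex.I) - shiftFun a b c (-(1 / 2 : ℝ) + x * Complex.I) =
      ((2 * (hahnKernel a b c x * (a * b + a * c + b * c - x ^ 2)) : ℝ) : ℂ) := by
  have key : ∀ s : ℝ, 0 < s →
      Complex.Gamma (s + 1 / 2 + ((1 / 2 : ℝ) + x * Complex.I)) *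
        Complex.Gamma (s + 1 / 2 - ((1 / 2 : ℝ) + x * Complex.I)) =
      (s + Complex.I * x) * ((‖Complex.Gamma (s + Complex.I * x)‖ ^ 2 : ℝ) : ℂ) ∧
      Complex.Gamma (s + 1 / 2 + (-(1 / 2 : ℝ) + x * Complex.I)) *
        Complex.Gamma (s + 1 / 2 - (-(1 / 2 : ℝ) + x * Complex.I)) =
      (s - Complex.I * x) * ((‖Complex.Gamma (s + Complex.I * x)‖ ^ 2 : ℝ) : ℂ) := by
    intro s hs
    have n1 : (s + Complex.I * x : ℂ) ≠ 0 := fun h => by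
      have := congrArg Complex.re h; simp at this; linarith
    have n2 : (s - Complex.I * x : ℂ) ≠ 0 := fun h => by
      have := congrArg Complex.re h; simp at this; linarith
    have e1 : (s + 1 / 2 + ((1 / 2 : ℝ) + x * Complex.I) : ℂ) = (s + Complex.I * x) + 1 := by
      push_cast; ring
    have e2 : (s + 1 / 2 - ((1 / 2 : ℝ) + x * Complex.I) : ℂ) = s - Complex.I * x := by
      push_cast; ring
    have e3 : (s + 1 / 2 + (-(1 / 2 : ℝ) + x * Complex.I) : ℂ) = s + Complex.I * x := by
      push_cast; ring
    have e4 : (s + 1 / 2 - (-(1 / 2 : ℝ) + x * Complex.I) : ℂ) = (s - Complex.I * x) + 1 := by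
      push_cast; ring
    rw [e1, e2, e3, e4, Complex.Gamma_add_one _ n1, Complex.Gamma_add_one _ n2,
      ← Gamma_mul_Gamma_conj]
    constructor <;> ring
  have s1 : Complex.sin (2 * Real.pi * ((1 / 2 : ℝ) + x * Complex.I)) =
      -((Real.sinh (2 * Real.pi * x) : ℝ) * Complex.I) := by
    have : (2 * Real.pi * ((1 / 2 : ℝ) + x * Complex.I) : ℂ) =
        (2 * Real.pi * x : ℝ) * Complex.I + Real.pi := by push_cast; ring
    rw [this, Complex.sin_add_pi, Complex.sin_mul_I, Complex.ofReal_sinh]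
  have s2 : Complex.sin (2 * Real.pi * (-(1 / 2 : ℝ) + x * Complex.I)) =
      -((Real.sinh (2 * Real.pi * x) : ℝ) * Complex.I) := by
    have : (2 * Real.pi * (-(1 / 2 : ℝ) + x * Complex.I) : ℂ) =
        (2 * Real.pi * x : ℝ) * Complex.I - Real.pi := by push_cast; ring
    rw [this, Complex.sin_sub_pi, Complex.sin_mul_I, Complex.ofReal_sinh]
  rw [shiftFun, shiftFun, (key a ha).1, (key a ha).2, (key b hb).1, (key b hb).2, (key c hc).1,
    (key c hc).2, s1, s2, hahnKernel]
  push_cast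
  linear_combination (-2 * (x : ℂ) * ‖Complex.Gamma (a + Complex.I * x)‖ ^ 2 *
    ‖Complex.Gamma (b + Complex.I * x)‖ ^ 2 * ‖Complex.Gamma (c + Complex.I * x)‖ ^ 2 *
    Complex.sinh (2 * Real.pi * x) * (a * b + a * c + b * c) - 2 * (x : ℂ) ^ 3 *
    ‖Complex.Gamma (a + Complex.I * x)‖ ^ 2 *
    ‖Complex.Gamma (b + Complex.I * x)‖ ^ 2 * ‖Complex.Gamma (c + Complex.I * x)‖ ^ 2 *
    Complex.sinh (2 * Real.pi * x) * (Complex.I ^ 2 - 1)) * Complex.I_sq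

/-- The integral of `|Γ(a+ix) Γ(b+ix) Γ(c+ix)|² x sinh(2πx)` over the positive half line. -/
noncomputable def hahnIntegral (a b c : ℝ) : ℝ := ∫ x in Set.Ioi 0, hahnKernel a b c x

theorem integrable_hahnKernel_mul_sq {a b c : ℝ} (ha : 0 < a) (hb : 0 < b) (hc : 0 < c) :
    Integrable fun x => hahnKernel a b c x * x ^ 2 := by
  have := (integrable_hahnKernel (a := a + 1) (by linarith) hb hc).sub
    ((integrable_hahnKernel ha hb hc).const_mul (a ^ 2))
  refine this.congr (ae_of_all _ fun x => ?_)
  simp only [Pi.sub_apply]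
  rw [hahnKernel_add_one x (Or.inl ha.ne')]
  ring

/-- The integral of `shiftFun` is the same along the lines `Re z = 1/2` and `Re z = -1/2`, so its
difference integrates to zero. -/
theorem hahnIntegral_add_one {a b c : ℝ} (ha : 0 < a) (hb : 0 < b) (hc : 0 < c) :
    hahnIntegral (a + 1) b c = (a + b) * (a + c) * hahnIntegral a b c := by
  have hi := integrable_hahnKernel ha hb hc
  have hi2 := integrable_hahnKernel_mul_sq ha hb hc
  obtain ⟨C, hC⟩ := norm_shiftFun_le ha hb hc
  have hv := integral_vertical_eq (f := shiftFun a b c) (r := 1 / 2) (by norm_num)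
    (fun z hz => differentiableAt_shiftFun ha hb hc hz) hC
  have hint : ∀ s : ℝ, |s| ≤ 1 / 2 →
      Integrable fun τ : ℝ => shiftFun a b c (s + τ * Complex.I) := by
    intro s hs
    have hcont : Continuous fun τ : ℝ => shiftFun a b c (s + τ * Complex.I) := by
      refine continuous_iff_continuousAt.2 fun τ => ?_
      have h1 : ContinuousAt (shiftFun a b c) (s + τ * Complex.I) :=
        (differentiableAt_shiftFun ha hb hc (by simpa using hs)).continuousAt
      exact ContinuousAt.comp (f := fun τ : ℝ => (s + τ * Complex.I : ℂ)) h1 (by fun_prop)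
    have h1 : Integrable fun x : ℝ => C * Real.exp (-|x|) := by
      simpa using (integrable_exp_neg_mul_abs one_pos).const_mul C
    exact h1.mono' hcont.aestronglyMeasurable (ae_of_all _ fun τ => hC s τ hs)
  have h0 : ∫ x : ℝ, hahnKernel a b c x * (a * b + a * c + b * c - x ^ 2) = 0 := by
    have h1 := integral_sub (hint (1 / 2) (by norm_num [abs_of_pos]))
      (hint (-(1 / 2)) (by norm_num [abs_of_pos]))
    rw [hv] at h1
    push_cast at h1
    rw [sub_self] at h1
    have h2 : ∀ x : ℝ, shiftFun a b c (1 / 2 + x * Complex.I) -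
        shiftFun a b c (-(1 / 2) + x * Complex.I) =
        ((2 * (hahnKernel a b c x * (a * b + a * c + b * c - x ^ 2)) : ℝ) : ℂ) := by
      intro x
      simpa using shiftFun_sub ha hb hc x
    simp only [h2] at h1
    rw [integral_complex_ofReal, integral_const_mul] at h1
    have h3 : 2 * ∫ x : ℝ, hahnKernel a b c x * (a * b + a * c + b * c - x ^ 2) = 0 := by
      exact_mod_cast h1
    linarith
  have h1 : ∫ x in Set.Ioi (0 : ℝ), hahnKernel a b c x * (a * b + a * c + b * c - x ^ 2) = 0 := by
    have := integral_comp_abs (f := fun x => hahnKernel a b c x * (a * b + a * c + b * c - x ^ 2))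
    simp only [hahnKernel_abs, sq_abs] at this
    linarith
  have e : ∀ x, hahnKernel (a + 1) b c x = (a + b) * (a + c) * hahnKernel a b c x -
      hahnKernel a b c x * (a * b + a * c + b * c - x ^ 2) := by
    intro x
    rw [hahnKernel_add_one x (Or.inl ha.ne')]
    ring
  have hi3 : Integrable fun x => hahnKernel a b c x * (a * b + a * c + b * c - x ^ 2) := by
    refine ((hi.mul_const (a * b + a * c + b * c)).sub hi2).congr (ae_of_all _ fun x => ?_)
    simp only [Pi.sub_apply]
    ring
  simp only [hahnIntegral, e]
  rw [integral_sub (hi.integrableOn.const_mul _) hi3.integrableOn, h1, sub_zero,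
    integral_const_mul]

theorem Gamma_sq_mul_hahnIntegral_le {a b c s : ℝ} (ha : 0 < a) (hb : 0 < b) (hc : 0 < c)
    (hs : 0 ≤ s) :
    Real.Gamma (a + s) ^ 2 * hahnIntegral a b c ≤ Real.Gamma a ^ 2 * hahnIntegral (a + s) b c := by
  rw [hahnIntegral, hahnIntegral, ← integral_const_mul, ← integral_const_mul]
  refine integral_mono ((integrable_hahnKernel ha hb hc).integrableOn.const_mul _)
    ((integrable_hahnKernel (by linarith) hb hc).integrableOn.const_mul _) fun x => ?_
  have h := norm_Gamma_mul_Gamma_le ha (le_add_of_nonneg_right hs) x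
  have h2 := pow_le_pow_left₀
    (mul_nonneg (norm_nonneg _) (Real.Gamma_pos_of_pos (by linarith)).le) h 2
  simp only [hahnKernel]
  calc _ = (‖Complex.Gamma (a + Complex.I * x)‖ * Real.Gamma (a + s)) ^ 2 *
        (‖Complex.Gamma (b + Complex.I * x)‖ ^ 2 * ‖Complex.Gamma (c + Complex.I * x)‖ ^ 2 *
          (x * Real.sinh (2 * Real.pi * x))) := by ring
    _ ≤ _ := mul_le_mul_of_nonneg_right h2 (mul_nonneg (by positivity) (mul_sinh_nonneg x))
    _ = _ := by ring

/-- For three equal parameters `1/2` the integrand is elementary, as `|Γ(1/2 + ix)|² = π / cosh(πx)`.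
-/
theorem hahnIntegral_half : hahnIntegral (1 / 2) (1 / 2) (1 / 2) = Real.pi ^ 2 := by
  have hp := Real.pi_pos
  have hk : ∀ x : ℝ, hahnKernel (1 / 2) (1 / 2) (1 / 2) x =
      Real.pi ^ 2 * (2 * Real.pi * x * Real.sinh (Real.pi * x) / Real.cosh (Real.pi * x) ^ 2) := by
    intro x
    have h2 : Real.sinh (2 * Real.pi * x) =
        2 * Real.sinh (Real.pi * x) * Real.cosh (Real.pi * x) := by
      rw [← Real.sinh_two_mul]; congr 1; ring
    have := (Real.cosh_pos (Real.pi * x)).ne'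
    simp only [hahnKernel]
    rw [norm_Gamma_half_sq, h2]
    field_simp
  simp only [hahnIntegral, hk]
  rw [integral_const_mul]
  -- an antiderivative of `2πx sinh(πx) / cosh(πx)²`
  set g : ℝ → ℝ := fun x =>
    -(2 * x) / Real.cosh (Real.pi * x) + 4 / Real.pi * Real.arctan (Real.exp (Real.pi * x)) with hg
  have hderiv : ∀ x ∈ Set.Ici (0 : ℝ), HasDerivAt g
      (2 * Real.pi * x * Real.sinh (Real.pi * x) / Real.cosh (Real.pi * x) ^ 2) x := by
    intro x _
    have hl : HasDerivAt (fun x : ℝ => Real.pi * x) Real.pi x := by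
      simpa using (hasDerivAt_id x).const_mul Real.pi
    have h0 : HasDerivAt (fun x : ℝ => -(2 * x)) (-2) x := by
      simpa using ((hasDerivAt_id x).const_mul (2 : ℝ)).fun_neg
    have h1 := h0.fun_div hl.cosh (Real.cosh_pos (Real.pi * x)).ne'
    have h2 := (hl.exp.arctan).const_mul (4 / Real.pi)
    refine (h1.add h2).congr_deriv ?_
    have hc : Real.cosh (Real.pi * x) =
        (1 + Real.exp (Real.pi * x) ^ 2) / (2 * Real.exp (Real.pi * x)) := by
      rw [Real.cosh_eq, Real.exp_neg]
      have := (Real.exp_pos (Real.pi * x)).ne'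
      field_simp
      ring
    have he := (Real.exp_pos (Real.pi * x)).ne'
    have he2 : 1 + Real.exp (Real.pi * x) ^ 2 ≠ 0 := by positivity
    have e2 : 4 / Real.pi * (1 / (1 + Real.exp (Real.pi * x) ^ 2) *
        (Real.exp (Real.pi * x) * Real.pi)) = 2 / Real.cosh (Real.pi * x) := by
      rw [hc]; field_simp; ring
    rw [e2]
    have := (Real.cosh_pos (Real.pi * x)).ne'
    field_simp
    ring
  have hlim : Tendsto g atTop (𝓝 2) := by
    have hl : Tendsto (fun x : ℝ => Real.pi * x) atTop atTop := tendsto_id.const_mul_atTop hp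
    have h1 : Tendsto (fun x : ℝ => Real.arctan (Real.exp (Real.pi * x))) atTop
        (𝓝 (Real.pi / 2)) :=
      (Real.tendsto_arctan_atTop.mono_right nhdsWithin_le_nhds).comp
        (Real.tendsto_exp_atTop.comp hl)
    have h2 : Tendsto (fun x : ℝ => -(2 * x) / Real.cosh (Real.pi * x)) atTop (𝓝 0) := by
      have h3 : Tendsto (fun x : ℝ => 4 / Real.pi * ((Real.pi * x) * Real.exp (-(Real.pi * x))))
          atTop (𝓝 0) := by
        have := (Real.tendsto_pow_mul_exp_neg_atTop_nhds_zero 1).comp hl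
        simpa using this.const_mul (4 / Real.pi)
      refine squeeze_zero_norm' ?_ h3
      filter_upwards [eventually_ge_atTop 0] with x hx
      rw [norm_div, norm_neg, Real.norm_of_nonneg (by positivity),
        Real.norm_of_nonneg (Real.cosh_pos _).le, div_le_iff₀ (Real.cosh_pos _), Real.cosh_eq,
        Real.exp_neg]
      have he := Real.exp_pos (Real.pi * x)
      field_simp
      nlinarith [mul_nonneg hx (inv_pos.2 he).le, mul_nonneg hx he.le]
    have := h2.add (h1.const_mul (4 / Real.pi))
    convert this using 2
    field_simp
    ring
  rw [integral_Ioi_of_hasDerivAt_of_nonneg' hderiv (fun x hx => ?_) hlim]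
  · simp only [hg, mul_zero, neg_zero, Real.cosh_zero, Real.exp_zero, Real.arctan_one]
    field_simp
    ring
  · have hx' : (0 : ℝ) < x := hx
    have : 0 ≤ Real.sinh (Real.pi * x) := Real.sinh_nonneg_iff.2 (by positivity)
    positivity

theorem tendsto_Gamma_add_nat {s : ℝ} (hs : 0 < s) :
    Tendsto (fun n : ℕ => Real.Gamma (s + (n + 1 : ℕ)) / ((n : ℝ) ^ s * n.factorial)) atTop
      (𝓝 1) := by
  have h := Real.GammaSeq_tendsto_Gamma s
  have hG := (Real.Gamma_pos_of_pos hs).ne'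
  have h2 := (tendsto_const_nhds (x := Real.Gamma s)).div h hG
  rw [div_self hG] at h2
  refine h2.congr' ?_
  filter_upwards [eventually_ne_atTop 0] with n hn
  have hprod : ∀ m : ℕ, Real.Gamma (s + m) = Real.Gamma s * ∏ j ∈ Finset.range m, (s + j) := by
    intro m
    induction m with
    | zero => simp
    | succ m ih =>
      rw [Finset.prod_range_succ, ← mul_assoc, ← ih, Nat.cast_succ, ← add_assoc,
        Real.Gamma_add_one (by positivity)]
      ring
  simp only [Pi.div_apply, Real.GammaSeq]
  rw [hprod, div_div_eq_mul_div]

/-- The integral divided by its expected value. -/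
noncomputable def hahnRatio (a b c : ℝ) : ℝ :=
  hahnIntegral a b c / (Real.Gamma (a + b) * Real.Gamma (a + c) * Real.Gamma (b + c))

theorem hahnRatio_add_nat {a b c : ℝ} (ha : 0 < a) (hb : 0 < b) (hc : 0 < c) (n : ℕ) :
    hahnRatio (a + n) b c = hahnRatio a b c := by
  induction n with
  | zero => simp
  | succ n ih =>
    have hA : 0 < a + n := by positivity
    rw [← ih, Nat.cast_succ, ← add_assoc, hahnRatio, hahnRatio, hahnIntegral_add_one hA hb hc]
    have e1 : a + n + 1 + b = (a + n + b) + 1 := by ring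
    have e2 : a + n + 1 + c = (a + n + c) + 1 := by ring
    rw [e1, e2, Real.Gamma_add_one (by positivity), Real.Gamma_add_one (by positivity)]
    have := (Real.Gamma_pos_of_pos (by positivity : 0 < a + n + b)).ne'
    have := (Real.Gamma_pos_of_pos (by positivity : 0 < a + n + c)).ne'
    have := (Real.Gamma_pos_of_pos (by positivity : 0 < b + c)).ne'
    have : a + n + b ≠ 0 := by positivity
    have : a + n + c ≠ 0 := by positivity
    field_simp

/-- The ratio is periodic in `a`, so this may be checked at `a + n` for large `n`, where it follows
from the monotonicity of `|Γ(a + ix)| / Γ(a)` in `a` and the asymptotics of the Gamma function. -/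
theorem hahnRatio_le_add {a b c s : ℝ} (ha : 0 < a) (hb : 0 < b) (hc : 0 < c) (hs : 0 ≤ s) :
    hahnRatio a b c ≤ hahnRatio (a + s) b c := by
  set G : ℝ → ℕ → ℝ := fun r n => Real.Gamma (r + (n + 1 : ℕ)) with hGdef
  have hGpos : ∀ r : ℝ, 0 < r → ∀ n, 0 < G r n := fun r hr n =>
    Real.Gamma_pos_of_pos (by positivity)
  -- the quotient of the Gamma factors, which tends to `1`
  have hlim : Tendsto (fun n : ℕ => (G (a + s) n / ((n : ℝ) ^ (a + s) * n.factorial)) ^ 2 *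
      (G (a + b) n / ((n : ℝ) ^ (a + b) * n.factorial)) *
      (G (a + c) n / ((n : ℝ) ^ (a + c) * n.factorial)) /
      ((G a n / ((n : ℝ) ^ a * n.factorial)) ^ 2 *
      (G (a + s + b) n / ((n : ℝ) ^ (a + s + b) * n.factorial)) *
      (G (a + s + c) n / ((n : ℝ) ^ (a + s + c) * n.factorial))) * hahnRatio a b c) atTop
      (𝓝 (hahnRatio a b c)) := by
    have t : ∀ r : ℝ, 0 < r → Tendsto (fun n : ℕ => G r n / ((n : ℝ) ^ r * n.factorial)) atTop
        (𝓝 1) := fun r hr => tendsto_Gamma_add_nat hr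
    have := (((((t (a + s) (by positivity)).pow 2).mul (t (a + b) (by positivity))).mul
      (t (a + c) (by positivity))).div ((((t a ha).pow 2).mul
      (t (a + s + b) (by positivity))).mul (t (a + s + c) (by positivity)))
      (by norm_num)).mul_const (hahnRatio a b c)
    simpa using this
  refine le_of_tendsto hlim ?_
  filter_upwards [eventually_ne_atTop 0] with n hn
  have hA : 0 < a + (n + 1 : ℕ) := by positivity
  have h := Gamma_sq_mul_hahnIntegral_le hA hb hc hs
  have r1 := hahnRatio_add_nat ha hb hc (n + 1)
  have r2 := hahnRatio_add_nat (by positivity : 0 < a + s) hb hc (n + 1)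
  have e0 : a + (n + 1 : ℕ) + s = a + s + (n + 1 : ℕ) := by ring
  rw [e0] at h
  rw [← r1, ← r2, hahnRatio, hahnRatio]
  have e1 : a + (n + 1 : ℕ) + b = a + b + (n + 1 : ℕ) := by ring
  have e2 : a + (n + 1 : ℕ) + c = a + c + (n + 1 : ℕ) := by ring
  have e3 : a + s + (n + 1 : ℕ) + b = a + s + b + (n + 1 : ℕ) := by ring
  have e4 : a + s + (n + 1 : ℕ) + c = a + s + c + (n + 1 : ℕ) := by ring
  rw [e1, e2, e3, e4]
  have hn' : (0 : ℝ) < n := by positivity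
  have p1 : (n : ℝ) ^ (a + s) = n ^ a * n ^ s := Real.rpow_add hn' _ _
  have p2 : (n : ℝ) ^ (a + b) = n ^ a * n ^ b := Real.rpow_add hn' _ _
  have p3 : (n : ℝ) ^ (a + c) = n ^ a * n ^ c := Real.rpow_add hn' _ _
  have p4 : (n : ℝ) ^ (a + s + b) = n ^ a * n ^ s * n ^ b := by
    rw [Real.rpow_add hn', Real.rpow_add hn']
  have p5 : (n : ℝ) ^ (a + s + c) = n ^ a * n ^ s * n ^ c := by
    rw [Real.rpow_add hn', Real.rpow_add hn']
  rw [p1, p2, p3, p4, p5]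
  change Real.Gamma (a + s + (n + 1 : ℕ)) ^ 2 * _ ≤ Real.Gamma (a + (n + 1 : ℕ)) ^ 2 * _ at h
  have g1 := hGpos (a + s) (by positivity) n
  have g2 := hGpos (a + b) (by positivity) n
  have g3 := hGpos (a + c) (by positivity) n
  have g4 := hGpos a ha n
  have g5 := hGpos (a + s + b) (by positivity) n
  have g6 := hGpos (a + s + c) (by positivity) n
  have g7 := Real.Gamma_pos_of_pos (by positivity : 0 < b + c)
  change G (a + s) n ^ 2 * hahnIntegral (a + (n + 1 : ℕ)) b c ≤
    G a n ^ 2 * hahnIntegral (a + s + (n + 1 : ℕ)) b c at h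
  change _ * (hahnIntegral (a + (n + 1 : ℕ)) b c / (G (a + b) n * G (a + c) n * _)) ≤
    hahnIntegral (a + s + (n + 1 : ℕ)) b c / (G (a + s + b) n * G (a + s + c) n * _)
  have hf : (0 : ℝ) < n.factorial := by positivity
  have q1 : (0 : ℝ) < n ^ a := by positivity
  have q2 : (0 : ℝ) < n ^ s := by positivity
  have q3 : (0 : ℝ) < n ^ b := by positivity
  have q4 : (0 : ℝ) < n ^ c := by positivity
  set I1 := hahnIntegral (a + (n + 1 : ℕ)) b c
  set I2 := hahnIntegral (a + s + (n + 1 : ℕ)) b c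
  have : (G (a + s) n / (n ^ a * n ^ s * n.factorial)) ^ 2 *
      (G (a + b) n / (n ^ a * n ^ b * n.factorial)) *
      (G (a + c) n / (n ^ a * n ^ c * n.factorial)) /
      ((G a n / (n ^ a * n.factorial)) ^ 2 *
      (G (a + s + b) n / (n ^ a * n ^ s * n ^ b * n.factorial)) *
      (G (a + s + c) n / (n ^ a * n ^ s * n ^ c * n.factorial))) *
      (I1 / (G (a + b) n * G (a + c) n * Real.Gamma (b + c))) =
      (G (a + s) n ^ 2 * I1) / (G a n ^ 2 * (G (a + s + b) n * G (a + s + c) n *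
        Real.Gamma (b + c))) := by
    field_simp
  rw [this, div_le_div_iff₀ (by positivity) (by positivity)]
  calc _ ≤ G a n ^ 2 * I2 * (G (a + s + b) n * G (a + s + c) n * Real.Gamma (b + c)) := by
        gcongr
    _ = _ := by ring

/-- In `a` the ratio is increasing and periodic, hence constant. -/
theorem hahnRatio_eq {a a' b c : ℝ} (ha : 0 < a) (ha' : 0 < a') (hb : 0 < b) (hc : 0 < c) :
    hahnRatio a b c = hahnRatio a' b c := by
  have key : ∀ {r r' : ℝ}, 0 < r → r ≤ r' → hahnRatio r b c = hahnRatio r' b c := by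
    intro r r' hr hrr
    refine le_antisymm ?_ ?_
    · simpa using hahnRatio_le_add hr hb hc (sub_nonneg.2 hrr)
    · obtain ⟨n, hn⟩ := exists_nat_gt (r' - r)
      rw [← hahnRatio_add_nat hr hb hc n]
      have := hahnRatio_le_add (hr.trans_le hrr) hb hc (s := r + n - r') (by linarith)
      simpa using this
  rcases le_total a a' with h | h
  · exact key ha h
  · exact (key ha' h).symm

theorem hahnRatio_swap (a b c : ℝ) : hahnRatio a b c = hahnRatio b a c := by
  simp only [hahnRatio, hahnIntegral, hahnKernel_swap a b c]
  rw [add_comm b a, mul_right_comm]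

theorem hahnRatio_swap' (a b c : ℝ) : hahnRatio a b c = hahnRatio a c b := by
  simp only [hahnRatio, hahnIntegral, hahnKernel_swap' a b c]
  rw [add_comm b c, mul_comm (Real.Gamma (a + b))]

/-- The integral of the weight for positive parameters. -/
theorem hahnIntegral_eq {a b c : ℝ} (ha : 0 < a) (hb : 0 < b) (hc : 0 < c) :
    hahnIntegral a b c =
      Real.pi ^ 2 * (Real.Gamma (a + b) * Real.Gamma (a + c) * Real.Gamma (b + c)) := by
  have hh : (0 : ℝ) < 1 / 2 := by norm_num
  have h : hahnRatio a b c = Real.pi ^ 2 := by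
    rw [hahnRatio_eq ha hh hb hc, hahnRatio_swap, hahnRatio_eq hb hh hh hc, hahnRatio_swap',
      hahnRatio_swap, hahnRatio_eq hc hh hh hh, hahnRatio, hahnIntegral_half]
    norm_num
  rw [hahnRatio, div_eq_iff] at h
  · exact h
  · have := Real.Gamma_pos_of_pos (add_pos ha hb)
    have := Real.Gamma_pos_of_pos (add_pos ha hc)
    have := Real.Gamma_pos_of_pos (add_pos hb hc)
    positivity

/-! ### Pochhammer symbols and the point masses -/

theorem poch_zero (a : ℝ) : poch a 0 = 1 := by simp [poch]

theorem poch_succ (a : ℝ) (n : ℕ) : poch a (n + 1) = poch a n * (a + n) := by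
  simp [poch, ascPochhammer_succ_right, Polynomial.eval_mul]

theorem poch_succ_left (a : ℝ) (n : ℕ) : poch a (n + 1) = a * poch (a + 1) n := by
  simp [poch, ascPochhammer_succ_left, Polynomial.eval_comp]

theorem poch_pos {a : ℝ} (ha : 0 < a) (n : ℕ) : 0 < poch a n := ascPochhammer_pos n a ha

theorem poch_ne_zero {a : ℝ} {n : ℕ} (h : ∀ j < n, a + j ≠ 0) : poch a n ≠ 0 := by
  induction n with
  | zero => simp [poch_zero]
  | succ n ih =>
    rw [poch_succ]
    exact mul_ne_zero (ih fun j hj => h j (hj.trans n.lt_succ_self)) (h n n.lt_succ_self)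

theorem poch_le_poch {s t : ℝ} (hs : 0 < s) (hst : s ≤ t) (n : ℕ) : poch s n ≤ poch t n := by
  induction n with
  | zero => simp [poch_zero]
  | succ n ih =>
    rw [poch_succ, poch_succ]
    have := poch_pos hs n
    exact mul_le_mul ih (by linarith) (by positivity) (this.le.trans ih)

/-- The point masses for `a` and `a + 1` sit at the same points, except for the one at `-a²`, and are
related like the weights. -/
theorem dualHahnMass_succ {a b c : ℝ} (hb : 0 < a + b) (hc : 0 < a + c) (hbc : 0 < b + c) {k : ℕ}
    (hk : a + 1 + k < 0) :
    dualHahnMass a b c (k + 1) * (-(a + (k + 1 : ℕ)) ^ 2 + a ^ 2) =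
      (a + b) * (a + c) * dualHahnMass (a + 1) b c k := by
  have hk0 : (0 : ℝ) ≤ k := k.cast_nonneg
  have e1 : Real.Gamma (b - a) = (b - (a + 1)) * Real.Gamma (b - (a + 1)) := by
    rw [← Real.Gamma_add_one (by linarith)]; congr 1; ring
  have e2 : Real.Gamma (c - a) = (c - (a + 1)) * Real.Gamma (c - (a + 1)) := by
    rw [← Real.Gamma_add_one (by linarith)]; congr 1; ring
  have e3 : Real.Gamma (-2 * a) = (-2 * a - 1) * ((-2 * (a + 1)) * Real.Gamma (-2 * (a + 1))) := by
    rw [← Real.Gamma_add_one (by linarith), ← sub_eq_zero]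
    have : -2 * a - 1 = -2 * (a + 1) + 1 := by ring
    rw [this, ← Real.Gamma_add_one (by linarith), sub_eq_zero]
    congr 1; ring
  have p1 : poch (2 * a) (k + 1) * (2 * a + k + 1) = 2 * a * ((2 * a + 1) * poch (2 * (a + 1)) k) := by
    have h1 : poch (2 * a) (k + 2) = poch (2 * a) (k + 1) * (2 * a + k + 1) := by
      rw [poch_succ (2 * a) (k + 1)]; push_cast; ring
    rw [← h1, poch_succ_left, poch_succ_left]
    congr 3; ring
  have p1' : poch (2 * a) (k + 1) = 2 * a * ((2 * a + 1) * poch (2 * (a + 1)) k) /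
      (2 * a + k + 1) := by
    rw [← p1, mul_div_cancel_right₀]
    intro h; linarith
  have p2 : poch (a + 1) (k + 1) = (a + 1) * poch (a + 1 + 1) k := poch_succ_left _ _
  have p3 : poch (a + b) (k + 1) = (a + b) * poch (a + 1 + b) k := by
    rw [poch_succ_left]; congr 2; ring
  have p4 : poch (a + c) (k + 1) = (a + c) * poch (a + 1 + c) k := by
    rw [poch_succ_left]; congr 2; ring
  have p5 : poch a (k + 1) = a * poch (a + 1) k := poch_succ_left _ _
  have p6 : poch (a - b + 1) (k + 1) = (a - b + 1) * poch (a + 1 - b + 1) k := by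
    rw [poch_succ_left]; congr 2; ring
  have p7 : poch (a - c + 1) (k + 1) = (a - c + 1) * poch (a + 1 - c + 1) k := by
    rw [poch_succ_left]; congr 2; ring
  have hjk : ∀ j : ℕ, j < k → (j : ℝ) < k := fun j hj => by exact_mod_cast hj
  have n1 : poch (a + 1) k ≠ 0 := poch_ne_zero fun j hj h => by linarith [hjk j hj]
  have n2 : poch (a + 1 - b + 1) k ≠ 0 := poch_ne_zero fun j hj h => by linarith [hjk j hj]
  have n3 : poch (a + 1 - c + 1) k ≠ 0 := poch_ne_zero fun j hj h => by linarith [hjk j hj]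
  have n4 := (Real.Gamma_pos_of_pos (by linarith : 0 < -2 * (a + 1))).ne'
  have n5 := (Real.Gamma_pos_of_pos hbc).ne'
  have n6 : a ≠ 0 := by intro h; linarith
  have n7 : a + 1 ≠ 0 := by intro h; linarith
  have n8 : a - b + 1 ≠ 0 := by intro h; linarith
  have n9 : a - c + 1 ≠ 0 := by intro h; linarith
  have n10 : 2 * a + k + 1 ≠ 0 := by intro h; linarith
  have n11 : -2 * a - 1 ≠ 0 := by intro h; linarith
  have n12 : (k.factorial : ℝ) ≠ 0 := by positivity
  have n13 : (k : ℝ) + 1 ≠ 0 := by positivity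
  simp only [dualHahnMass]
  rw [e1, e2, e3, p1', p2, p3, p4, p5, p6, p7, Nat.factorial_succ]
  push_cast
  rw [pow_succ]
  have n14 : -2 * (a + 1) ≠ 0 := by intro h; linarith
  generalize Real.Gamma (b - (a + 1)) = g1
  generalize Real.Gamma (c - (a + 1)) = g2
  generalize Real.Gamma (-2 * (a + 1)) = g3 at *
  generalize Real.Gamma (b + c) = g4 at *
  generalize poch (2 * (a + 1)) k = q1
  generalize poch (a + 1 + 1) k = q2
  generalize poch (a + 1 + b) k = q3
  generalize poch (a + 1 + c) k = q4
  generalize poch (a + 1) k = q5 at *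
  generalize poch (a + 1 - b + 1) k = q6 at *
  generalize poch (a + 1 - c + 1) k = q7 at *
  generalize (k.factorial : ℝ) = F at *
  generalize ((-1 : ℝ) ^ k) = s
  clear e1 e2 e3 p1 p1' p2 p3 p4 p5 p6 p7 hjk
  have e1 : b - (a + 1) = -(a - b + 1) := by ring
  have e2 : c - (a + 1) = -(a - c + 1) := by ring
  have e3 : -2 * a - 1 = -(2 * a + 1) := by ring
  have e4 : -(a + ((k : ℝ) + 1)) ^ 2 + a ^ 2 = -((k + 1) * (2 * a + k + 1)) := by ring
  have n15 : 2 * a + 1 ≠ 0 := by intro h; linarith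
  rw [e1, e2, e3, e4]
  generalize a - b + 1 = r1 at *
  generalize a - c + 1 = r2 at *
  generalize 2 * a + 1 = r3 at *
  generalize 2 * a + k + 1 = r4 at *
  generalize (k : ℝ) + 1 = r5 at *
  generalize a + b = r6 at *
  generalize a + c = r7 at *
  generalize a + 1 = r8 at *
  field_simp

theorem dualHahnMass_zero (a b c : ℝ) : dualHahnMass a b c 0 =
    Real.Gamma (b - a) * Real.Gamma (c - a) / (Real.Gamma (-2 * a) * Real.Gamma (b + c)) := by
  simp [dualHahnMass, poch_zero]

/-! ### The orthogonality measure -/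

theorem dualHahnWeight_eq (a b c x : ℝ) : dualHahnWeight a b c x = hahnKernel a b c x /
    (Real.pi ^ 2 * (Real.Gamma (a + b) * Real.Gamma (a + c) * Real.Gamma (b + c))) := by
  have hp := Real.pi_ne_zero
  have h : ‖Complex.Gamma (2 * Complex.I * x)‖ ^ 2 =
      Real.pi / (2 * x * Real.sinh (2 * Real.pi * x)) := by
    rcases eq_or_ne x 0 with rfl | hx
    · simp [Complex.Gamma_zero]
    · exact norm_Gamma_two_I_sq x hx
  rw [dualHahnWeight, norm_div, norm_mul, norm_mul, div_pow, h, hahnKernel, mul_pow, mul_pow]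
  field_simp

theorem aemeasurable_dualHahnWeight (a b c : ℝ) :
    AEMeasurable (fun x => ENNReal.ofReal (dualHahnWeight a b c x))
      (volume.restrict (Set.Ioi (0 : ℝ))) := by
  refine AEMeasurable.ennreal_ofReal ?_
  have : dualHahnWeight a b c = fun x => hahnKernel a b c x /
    (Real.pi ^ 2 * (Real.Gamma (a + b) * Real.Gamma (a + c) * Real.Gamma (b + c))) :=
    funext fun x => dualHahnWeight_eq a b c x
  rw [this]
  exact ((continuousOn_hahnKernel a b c).aemeasurable measurableSet_Ioi).div_const _

theorem dualHahnWeight_nonneg {a b c : ℝ} (hab : 0 < a + b) (hac : 0 < a + c) (hbc : 0 < b + c)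
    (x : ℝ) : 0 ≤ dualHahnWeight a b c x := by
  have := Real.Gamma_pos_of_pos hab
  have := Real.Gamma_pos_of_pos hac
  have := Real.Gamma_pos_of_pos hbc
  rw [dualHahnWeight_eq]
  exact div_nonneg (hahnKernel_nonneg a b c x) (by positivity)

theorem dualHahnWeight_add_one {a b c x : ℝ} (hab : 0 < a + b) (hac : 0 < a + c) (hx : x ≠ 0) :
    dualHahnWeight a b c x * (x ^ 2 + a ^ 2) =
      (a + b) * (a + c) * dualHahnWeight (a + 1) b c x := by
  have e1 : a + 1 + b = (a + b) + 1 := by ring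
  have e2 : a + 1 + c = (a + c) + 1 := by ring
  rw [dualHahnWeight_eq, dualHahnWeight_eq, hahnKernel_add_one x (Or.inr hx), e1, e2,
    Real.Gamma_add_one hab.ne', Real.Gamma_add_one hac.ne']
  have := hab.ne'
  have := hac.ne'
  field_simp
  ring

theorem lintegral_dualHahnMeasureAux (a b c : ℝ) {f : ℝ → ENNReal} (hf : Measurable f) :
    ∫⁻ y, f y ∂dualHahnMeasureAux a b c =
      (∫⁻ x in Set.Ioi (0 : ℝ), ENNReal.ofReal (dualHahnWeight a b c x) * f (x ^ 2)) +
      ∑ k ∈ Finset.range ⌈-a⌉₊, ENNReal.ofReal (dualHahnMass a b c k) * f (-(a + k) ^ 2) := by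
  rw [dualHahnMeasureAux, lintegral_add_measure, lintegral_map hf (by fun_prop),
    lintegral_withDensity_eq_lintegral_mul₀ (aemeasurable_dualHahnWeight a b c)
      (g := fun x => f (x ^ 2)) (hf.comp (by fun_prop)).aemeasurable, lintegral_finsetSum_measure]
  simp only [lintegral_smul_measure, lintegral_dirac' _ hf, smul_eq_mul, Pi.mul_apply]

theorem ceil_neg_of_neg {a : ℝ} (ha : a < 0) : ⌈-a⌉₊ = ⌈-(a + 1)⌉₊ + 1 := by
  rcases le_or_gt 0 (-(a + 1)) with h | h
  · rw [← Nat.ceil_add_one h]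
    congr 1
    ring
  · rw [Nat.ceil_eq_zero.2 h.le, zero_add, Nat.ceil_eq_iff one_ne_zero]
    constructor
    · simpa using ha
    · push_cast; linarith

theorem lintegral_dualHahnMeasureAux_mul {a b c : ℝ} (hab : 0 < a + b) (hac : 0 < a + c)
    (hbc : 0 < b + c) {f : ℝ → ENNReal} (hf : Measurable f) :
    ∫⁻ y, ENNReal.ofReal (y + a ^ 2) * f y ∂dualHahnMeasureAux a b c =
      ENNReal.ofReal ((a + b) * (a + c)) * ∫⁻ y, f y ∂dualHahnMeasureAux (a + 1) b c := by
  have hC : 0 ≤ (a + b) * (a + c) := by positivity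
  rw [lintegral_dualHahnMeasureAux _ _ _ (by fun_prop), lintegral_dualHahnMeasureAux _ _ _ hf,
    mul_add]
  congr 1
  · rw [← lintegral_const_mul''
      (f := fun x => ENNReal.ofReal (dualHahnWeight (a + 1) b c x) * f (x ^ 2)) _ (AEMeasurable.mul (g := fun x => f (x ^ 2))
      (aemeasurable_dualHahnWeight (a + 1) b c)
      (Measurable.aemeasurable (hf.comp (by fun_prop))))]
    refine setLIntegral_congr_fun measurableSet_Ioi fun x hx => ?_
    rw [← mul_assoc, ← mul_assoc, ← ENNReal.ofReal_mul (dualHahnWeight_nonneg hab hac hbc x),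
      dualHahnWeight_add_one hab hac (ne_of_gt hx), ENNReal.ofReal_mul hC]
  · rcases le_or_gt 0 a with ha | ha
    · rw [Nat.ceil_eq_zero.2 (by linarith), Nat.ceil_eq_zero.2 (by linarith)]
      simp
    · rw [ceil_neg_of_neg ha, Finset.sum_range_succ', Finset.mul_sum]
      have h0 : ENNReal.ofReal (-(a + (0 : ℕ)) ^ 2 + a ^ 2) = 0 := by simp
      rw [h0, zero_mul, mul_zero, add_zero]
      refine Finset.sum_congr rfl fun k hk => ?_
      have hk' := Nat.lt_ceil.1 (Finset.mem_range.1 hk)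
      have hq : 0 ≤ -(a + (k + 1 : ℕ)) ^ 2 + a ^ 2 := by
        push_cast
        nlinarith [k.cast_nonneg (α := ℝ)]
      rw [← mul_assoc, ← mul_assoc, ← ENNReal.ofReal_mul' hq,
        dualHahnMass_succ hab hac hbc (by linarith), ENNReal.ofReal_mul hC]
      congr 3
      push_cast
      ring

/-- Multiplication by `y + a²` raises the parameter `a` by one, and removes the point mass
at `-a²`. -/
theorem withDensity_dualHahnMeasureAux {a b c : ℝ} (hab : 0 < a + b) (hac : 0 < a + c)
    (hbc : 0 < b + c) :
    (dualHahnMeasureAux a b c).withDensity (fun y => ENNReal.ofReal (y + a ^ 2)) =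
      ENNReal.ofReal ((a + b) * (a + c)) • dualHahnMeasureAux (a + 1) b c := by
  ext s hs
  have h := lintegral_dualHahnMeasureAux_mul hab hac hbc
    (f := s.indicator 1) (measurable_one.indicator hs)
  rw [lintegral_indicator_one hs] at h
  rw [withDensity_apply _ hs, Measure.smul_apply, smul_eq_mul, ← h, ← lintegral_indicator hs]
  congr 1
  ext y
  by_cases hy : y ∈ s <;> simp [hy]

theorem ae_dualHahnMeasureAux {a b c : ℝ} {P : ℝ → Prop} (hP : MeasurableSet {y | P y})
    (h1 : ∀ x : ℝ, 0 < x → P (x ^ 2)) (h2 : ∀ k : ℕ, a + k < 0 → P (-(a + k) ^ 2)) :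
    ∀ᵐ y ∂dualHahnMeasureAux a b c, P y := by
  have hm : Measurable ({y | P y}ᶜ.indicator (1 : ℝ → ENNReal)) :=
    measurable_one.indicator hP.compl
  have h := lintegral_dualHahnMeasureAux a b c hm
  rw [lintegral_indicator_one hP.compl, setLIntegral_congr_fun (g := fun _ => 0) measurableSet_Ioi
    (fun x hx => by simp [h1 x hx]), Finset.sum_eq_zero] at h
  · simpa [ae_iff, Set.compl_def] using h
  · intro k hk
    have hk' := Nat.lt_ceil.1 (Finset.mem_range.1 hk)
    simp [h2 k (by linarith)]

theorem ae_nonneg_add_sq (a b c : ℝ) : ∀ᵐ y ∂dualHahnMeasureAux a b c, 0 ≤ y + a ^ 2 := by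
  refine ae_dualHahnMeasureAux (measurableSet_le measurable_const (by fun_prop))
    (fun x _ => by positivity) fun k hk => ?_
  have := k.cast_nonneg (α := ℝ)
  nlinarith

theorem integral_dualHahnMeasureAux_mul {a b c : ℝ} (hab : 0 < a + b) (hac : 0 < a + c)
    (hbc : 0 < b + c) (f : ℝ → ℝ) :
    ∫ y, (y + a ^ 2) * f y ∂dualHahnMeasureAux a b c =
      (a + b) * (a + c) * ∫ y, f y ∂dualHahnMeasureAux (a + 1) b c := by
  have h := integral_withDensity_eq_integral_toReal_smul
    (μ := dualHahnMeasureAux a b c) (f := fun y => ENNReal.ofReal (y + a ^ 2)) (by fun_prop)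
    (ae_of_all _ fun _ => ENNReal.ofReal_lt_top) f
  rw [withDensity_dualHahnMeasureAux hab hac hbc, integral_smul_measure,
    ENNReal.toReal_ofReal (by positivity), smul_eq_mul] at h
  rw [h]
  refine integral_congr_ae ?_
  filter_upwards [ae_nonneg_add_sq a b c] with y hy
  rw [ENNReal.toReal_ofReal hy, smul_eq_mul]

theorem ae_of_ae_add_one {a b c : ℝ} (hab : 0 < a + b) (hac : 0 < a + c)
    (hbc : 0 < b + c) {P : ℝ → Prop} (h : ∀ᵐ y ∂dualHahnMeasureAux (a + 1) b c, P y) :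
    ∀ᵐ y ∂dualHahnMeasureAux a b c, y ≠ -a ^ 2 → P y := by
  have h1 : ∀ᵐ y ∂(dualHahnMeasureAux a b c).withDensity (fun y => ENNReal.ofReal (y + a ^ 2)),
      P y := by
    rw [withDensity_dualHahnMeasureAux hab hac hbc]
    exact Measure.ae_smul_measure h _
  rw [ae_withDensity_iff (by fun_prop)] at h1
  filter_upwards [h1, ae_nonneg_add_sq a b c] with y hy hy0 hne
  refine hy ?_
  rw [Ne, ENNReal.ofReal_eq_zero, not_le]
  exact lt_of_le_of_ne hy0 fun h => hne (by linarith)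

theorem dualHahnMeasureAux_singleton {a b c : ℝ} (ha : a < 0) :
    dualHahnMeasureAux a b c {-a ^ 2} = ENNReal.ofReal (dualHahnMass a b c 0) := by
  have hm : Measurable (({-a ^ 2} : Set ℝ).indicator (1 : ℝ → ENNReal)) :=
    measurable_one.indicator (measurableSet_singleton _)
  have h := lintegral_dualHahnMeasureAux a b c hm
  rw [lintegral_indicator_one (measurableSet_singleton _),
    setLIntegral_congr_fun (g := fun _ => 0) measurableSet_Ioi, ceil_neg_of_neg ha,
    Finset.sum_range_succ', Finset.sum_eq_zero] at h
  · simpa using h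
  · intro k hk
    have hk' := Nat.lt_ceil.1 (Finset.mem_range.1 hk)
    have : -(a + (k + 1 : ℕ)) ^ 2 ≠ -a ^ 2 := by
      push_cast
      have := k.cast_nonneg (α := ℝ)
      nlinarith
    rw [Set.indicator_of_notMem (show -(a + (k + 1 : ℕ)) ^ 2 ∉ ({-a ^ 2} : Set ℝ) from this),
      mul_zero]
  · intro x hx
    have : x ^ 2 ≠ -a ^ 2 := by
      have : 0 < x ^ 2 := pow_pos hx 2
      nlinarith [sq_nonneg a]
    simp only
    rw [Set.indicator_of_notMem (show x ^ 2 ∉ ({-a ^ 2} : Set ℝ) from this), mul_zero]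

/-- The orthogonality measure has exponential moments in `√|y|`. -/
theorem integrable_exp_dualHahnMeasureAux (a : ℝ) {b c : ℝ} (hb : 0 < b) (hc : 0 < c) :
    Integrable (fun y => Real.exp (5 / 2 * √|y|)) (dualHahnMeasureAux a b c) := by
  rw [dualHahnMeasureAux]
  refine Integrable.add_measure ?_ ?_
  · rw [integrable_map_measure (by fun_prop) (by fun_prop),
      integrable_withDensity_iff_integrable_smul₀' (aemeasurable_dualHahnWeight a b c)
        (ae_of_all _ fun _ => ENNReal.ofReal_lt_top)]
    obtain ⟨C, hC, h⟩ := hahnKernel_le_exp a hb hc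
    set Z := Real.pi ^ 2 * (Real.Gamma (a + b) * Real.Gamma (a + c) * Real.Gamma (b + c)) with hZ
    have hi : IntegrableOn (fun x : ℝ => C / |Z| * Real.exp (-(1 / 2) * |x|)) (Set.Ioi 0) :=
      ((integrable_exp_neg_mul_abs (by norm_num)).const_mul _).integrableOn
    refine hi.mono' ?_ ?_
    · exact (AEMeasurable.mul (g := fun x : ℝ => Real.exp (5 / 2 * √|x ^ 2|))
        (aemeasurable_dualHahnWeight a b c).ennreal_toReal
        (Measurable.aemeasurable (by fun_prop))).aestronglyMeasurable
    · refine (ae_restrict_iff' measurableSet_Ioi).2 (ae_of_all _ fun x hx => ?_)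
      have hx' : (0 : ℝ) < x := hx
      have e : √|x ^ 2| = |x| := by rw [abs_of_nonneg (sq_nonneg x), Real.sqrt_sq_eq_abs]
      simp only [Function.comp_apply, smul_eq_mul, e]
      rw [norm_mul, Real.norm_of_nonneg ENNReal.toReal_nonneg,
        Real.norm_of_nonneg (Real.exp_pos _).le]
      have h1 : (ENNReal.ofReal (dualHahnWeight a b c x)).toReal ≤
          C * Real.exp (-3 * |x|) / |Z| := by
        rw [ENNReal.toReal_ofReal']
        refine max_le ?_ (by positivity)
        refine (le_abs_self _).trans ?_
        rw [dualHahnWeight_eq, abs_div, abs_of_nonneg (hahnKernel_nonneg a b c x)]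
        gcongr
        exact h x
      calc _ ≤ C * Real.exp (-3 * |x|) / |Z| * Real.exp (5 / 2 * |x|) := by gcongr
        _ = C / |Z| * (Real.exp (-3 * |x|) * Real.exp (5 / 2 * |x|)) := by ring
        _ = _ := by rw [← Real.exp_add]; congr 2; ring
  · refine integrable_finsetSum_measure.2 fun k _ => ?_
    exact (integrable_dirac (by simp)).smul_measure ENNReal.ofReal_ne_top

theorem isFiniteMeasure_dualHahnMeasureAux (a : ℝ) {b c : ℝ} (hb : 0 < b) (hc : 0 < c) :
    IsFiniteMeasure (dualHahnMeasureAux a b c) := by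
  have h : Integrable (fun _ => (1 : ℝ)) (dualHahnMeasureAux a b c) := by
    refine (integrable_exp_dualHahnMeasureAux a hb hc).mono' aestronglyMeasurable_const
      (ae_of_all _ fun y => ?_)
    rw [norm_one]
    exact Real.one_le_exp (by positivity)
  exact (integrable_const_iff_isFiniteMeasure one_ne_zero).1 h

/-! ### Moment problems with exponentially decaying solutions -/

theorem integrable_exp_mul_sqrt {ν : Measure ℝ} {δ : ℝ}
    (hi : Integrable (fun y => Real.exp (δ * √|y|)) ν) {t : ℝ} (ht : |t| ≤ δ) :
    Integrable (fun y => Real.exp (t * √y)) ν := by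
  refine hi.mono' (Measurable.aestronglyMeasurable (by fun_prop)) (ae_of_all _ fun y => ?_)
  rw [Real.norm_of_nonneg (Real.exp_pos _).le]
  gcongr
  · exact (abs_nonneg t).trans ht
  · exact (le_abs_self t).trans ht
  · exact le_abs_self y

/-- The symmetric measure on the line whose image under squaring is twice the given one. -/
noncomputable def sqrtSymm (ν : Measure ℝ) : Measure ℝ :=
  ν.map (fun y => √y) + ν.map (fun y => -√y)

theorem integrable_exp_sqrtSymm {ν : Measure ℝ} {δ : ℝ}
    (hi : Integrable (fun y => Real.exp (δ * √|y|)) ν) {t : ℝ} (ht : |t| ≤ δ) :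
    Integrable (fun x => Real.exp (t * x)) (sqrtSymm ν) := by
  refine Integrable.add_measure ?_ ?_
  · rw [integrable_map_measure (by fun_prop) (by fun_prop)]
    exact integrable_exp_mul_sqrt hi ht
  · rw [integrable_map_measure (by fun_prop) (by fun_prop)]
    refine (integrable_exp_mul_sqrt hi (t := -t) (by rwa [abs_neg])).congr (ae_of_all _ fun y => ?_)
    simp

theorem mem_interior_integrableExpSet_sqrtSymm {ν : Measure ℝ} {δ : ℝ}
    (hi : Integrable (fun y => Real.exp (δ * √|y|)) ν) {t : ℝ} (ht : |t| < δ) :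
    t ∈ interior (integrableExpSet id (sqrtSymm ν)) := by
  rw [mem_interior]
  refine ⟨Set.Ioo (-δ) δ, fun s hs => ?_, isOpen_Ioo, abs_lt.1 ht⟩
  exact integrable_exp_sqrtSymm hi (abs_le.2 ⟨hs.1.le, hs.2.le⟩)

theorem hasSum_complexMGF_sqrtSymm {ν : Measure ℝ} [IsFiniteMeasure ν] (h0 : ∀ᵐ y ∂ν, 0 ≤ y)
    {δ : ℝ} (hi : Integrable (fun y => Real.exp (δ * √|y|)) ν) {z : ℂ} (hz : ‖z‖ ≤ δ) :
    HasSum (fun n : ℕ => 2 * (z ^ (2 * n) / (2 * n).factorial * ((∫ y, y ^ n ∂ν : ℝ) : ℂ)))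
      (complexMGF id (sqrtSymm ν) z) := by
  have hre : |z.re| ≤ δ := (Complex.abs_re_le_norm z).trans hz
  have hint : ∀ s : ℝ, (s = 1 ∨ s = -1) →
      Integrable (fun y : ℝ => Complex.exp (z * ((s * √y : ℝ) : ℂ))) ν := by
    intro s hs
    have hs' : |z.re * s| ≤ δ := by rcases hs with rfl | rfl <;> simpa using hre
    refine (integrable_exp_mul_sqrt hi hs').mono' (Measurable.aestronglyMeasurable (by fun_prop))
      (ae_of_all _ fun y => ?_)
    rw [Complex.norm_exp, Complex.re_mul_ofReal, mul_assoc]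
  have e : complexMGF id (sqrtSymm ν) z = ∫ y, 2 * Complex.cosh (z * ((√y : ℝ) : ℂ)) ∂ν := by
    have i1 : Integrable (fun x : ℝ => Complex.exp (z * (x : ℂ))) (ν.map fun y => √y) := by
      rw [integrable_map_measure (by fun_prop) (by fun_prop)]
      simpa [Function.comp_def] using hint 1 (Or.inl rfl)
    have i2 : Integrable (fun x : ℝ => Complex.exp (z * (x : ℂ))) (ν.map fun y => -√y) := by
      rw [integrable_map_measure (by fun_prop) (by fun_prop)]
      simpa [Function.comp_def] using hint (-1) (Or.inr rfl)
    have j1 := hint 1 (Or.inl rfl)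
    have j2 := hint (-1) (Or.inr rfl)
    simp only [one_mul, neg_mul] at j1 j2
    simp only [complexMGF, id]
    rw [sqrtSymm, integral_add_measure i1 i2, integral_map (by fun_prop) (by fun_prop),
      integral_map (by fun_prop) (by fun_prop), ← integral_add j1 j2]
    refine integral_congr_ae (ae_of_all _ fun y => ?_)
    simp only [Complex.cosh, Complex.ofReal_neg, mul_neg]
    ring
  rw [e, integral_const_mul]
  refine HasSum.mul_left 2 ?_
  have hb : ∀ y : ℝ, HasSum (fun n : ℕ => (‖z‖ * √|y|) ^ (2 * n) / (2 * n).factorial)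
      (Real.cosh (‖z‖ * √|y|)) := fun y => Real.hasSum_cosh _
  have key := hasSum_integral_of_dominated_convergence (μ := ν)
    (F := fun (n : ℕ) y => z ^ (2 * n) / (2 * n).factorial * (y : ℂ) ^ n)
    (f := fun y => Complex.cosh (z * ((√y : ℝ) : ℂ)))
    (fun n y => (‖z‖ * √|y|) ^ (2 * n) / (2 * n).factorial)
    (fun n => Measurable.aestronglyMeasurable (by fun_prop))
    (fun n => ae_of_all _ fun y => by
      simp only [norm_mul, norm_div, norm_pow, Complex.norm_natCast, Complex.norm_real,
        Real.norm_eq_abs]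
      rw [mul_pow, pow_mul (√|y|), Real.sq_sqrt (abs_nonneg y)]
      exact le_of_eq (by ring))
    (ae_of_all _ fun y => (hb y).summable)
    (by
      simp only [fun y => (hb y).tsum_eq]
      refine hi.mono' (Continuous.aestronglyMeasurable (by fun_prop)) (ae_of_all _ fun y => ?_)
      rw [Real.norm_of_nonneg (Real.cosh_pos _).le, Real.cosh_eq]
      have h1 : Real.exp (‖z‖ * √|y|) ≤ Real.exp (δ * √|y|) := by gcongr
      have h2 : Real.exp (-(‖z‖ * √|y|)) ≤ Real.exp (δ * √|y|) := by
        refine Real.exp_le_exp.2 (le_trans ?_ (mul_le_mul_of_nonneg_right hz (Real.sqrt_nonneg _)))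
        have : 0 ≤ ‖z‖ * √|y| := by positivity
        linarith
      linarith)
    (by
      filter_upwards [h0] with y hy
      refine (Complex.hasSum_cosh (z * ((√y : ℝ) : ℂ))).congr_fun fun n => ?_
      rw [mul_pow, pow_mul ((√y : ℝ) : ℂ), ← Complex.ofReal_pow (√y), Real.sq_sqrt hy]
      ring)
  refine key.congr_fun fun n => ?_
  rw [integral_const_mul, ← integral_complex_ofReal]
  simp

instance (ν : Measure ℝ) [IsFiniteMeasure ν] : IsFiniteMeasure (sqrtSymm ν) := by
  unfold sqrtSymm; infer_instance

theorem map_sq_sqrtSymm {ν : Measure ℝ} (h0 : ∀ᵐ y ∂ν, 0 ≤ y) :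
    (sqrtSymm ν).map (fun x => x ^ 2) = (2 : ENNReal) • ν := by
  have h : (fun y : ℝ => √y ^ 2) =ᵐ[ν] id := by
    filter_upwards [h0] with y hy
    simp [Real.sq_sqrt hy]
  rw [sqrtSymm, Measure.map_add _ _ (by fun_prop), Measure.map_map (by fun_prop) (by fun_prop),
    Measure.map_map (by fun_prop) (by fun_prop)]
  simp only [Function.comp_def, neg_sq]
  rw [Measure.map_congr h, Measure.map_id, two_smul]

/-- A measure on the half line with an exponential moment in `√y` is determined by its moments: the
complex moment generating function of its symmetric square root is determined by them near the
origin, hence on a strip containing the imaginary axis. -/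
theorem measure_ext_of_moments {ν₁ ν₂ : Measure ℝ} [IsFiniteMeasure ν₁] [IsFiniteMeasure ν₂]
    (h₁ : ∀ᵐ y ∂ν₁, 0 ≤ y) (h₂ : ∀ᵐ y ∂ν₂, 0 ≤ y) {δ : ℝ} (hδ : 0 < δ)
    (i₁ : Integrable (fun y => Real.exp (δ * √|y|)) ν₁)
    (i₂ : Integrable (fun y => Real.exp (δ * √|y|)) ν₂)
    (hm : ∀ n : ℕ, ∫ y, y ^ n ∂ν₁ = ∫ y, y ^ n ∂ν₂) : ν₁ = ν₂ := by
  set U : Set ℂ := {z | |z.re| < δ} with hU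
  have a₁ : AnalyticOnNhd ℂ (complexMGF id (sqrtSymm ν₁)) U := fun z hz =>
    analyticAt_complexMGF (mem_interior_integrableExpSet_sqrtSymm i₁ hz)
  have a₂ : AnalyticOnNhd ℂ (complexMGF id (sqrtSymm ν₂)) U := fun z hz =>
    analyticAt_complexMGF (mem_interior_integrableExpSet_sqrtSymm i₂ hz)
  have hconv : Convex ℝ U := by
    have : U = Complex.reLm ⁻¹' Set.Ioo (-δ) δ := by
      ext z; simp [hU, abs_lt]
    rw [this]
    exact (convex_Ioo (-δ) δ).linear_preimage _
  have hev : complexMGF id (sqrtSymm ν₁) =ᶠ[𝓝 0] complexMGF id (sqrtSymm ν₂) := by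
    filter_upwards [Metric.ball_mem_nhds (0 : ℂ) hδ] with z hz
    have hz' : ‖z‖ ≤ δ := by simpa using (Metric.mem_ball.1 hz).le
    have s₁ := hasSum_complexMGF_sqrtSymm h₁ i₁ hz'
    simp only [hm] at s₁
    exact s₁.unique (hasSum_complexMGF_sqrtSymm h₂ i₂ hz')
  have heq := a₁.eqOn_of_preconnected_of_eventuallyEq a₂ hconv.isPreconnected
    (show (0 : ℂ) ∈ U by simpa [hU] using hδ) hev
  have hρ : sqrtSymm ν₁ = sqrtSymm ν₂ := by
    refine Measure.ext_of_charFun (funext fun t => ?_)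
    rw [← complexMGF_id_mul_I, ← complexMGF_id_mul_I]
    exact heq (by simpa [hU] using hδ)
  have h2 : (2 : ENNReal) • ν₁ = (2 : ENNReal) • ν₂ := by
    rw [← map_sq_sqrtSymm h₁, ← map_sq_sqrtSymm h₂, hρ]
  ext s hs
  have := congrArg (fun m => m s) h2
  simp only [Measure.smul_apply, smul_eq_mul] at this
  exact (ENNReal.mul_right_inj (by norm_num) (by norm_num)).1 this

/-- A function all of whose moments vanish is zero almost everywhere, provided that it decays like
`exp(-δ √|y|)` on average for some `δ > 0`. -/
def MomentDeterminate (μ : Measure ℝ) : Prop :=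
  ∀ (h : ℝ → ℝ) (δ : ℝ), 0 < δ → Integrable (fun y => Real.exp (δ * √|y|) * h y) μ →
    (∀ n : ℕ, ∫ y, y ^ n * h y ∂μ = 0) → h =ᵐ[μ] 0

theorem aestronglyMeasurable_of_exp_mul {μ : Measure ℝ} {h : ℝ → ℝ} {δ : ℝ}
    (hi : Integrable (fun y => Real.exp (δ * √|y|) * h y) μ) : AEStronglyMeasurable h μ := by
  have hc : AEStronglyMeasurable (fun y : ℝ => Real.exp (-(δ * √|y|))) μ :=
    Continuous.aestronglyMeasurable (by fun_prop)
  refine (hc.mul hi.aestronglyMeasurable).congr (ae_of_all _ fun y => ?_)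
  simp only [Pi.mul_apply]
  rw [← mul_assoc, ← Real.exp_add, neg_add_cancel, Real.exp_zero, one_mul]

theorem one_add_abs_pow_le_exp (n : ℕ) {ε : ℝ} (hε : 0 < ε) : ∃ K : ℝ, 0 ≤ K ∧
    ∀ y : ℝ, (1 + |y|) ^ n ≤ K * Real.exp (ε * √|y|) := by
  obtain ⟨K, hK, h⟩ := one_add_sq_pow_le_exp n hε
  refine ⟨K, hK, fun y => ?_⟩
  have := h (√|y|)
  rwa [Real.sq_sqrt (abs_nonneg y), abs_of_nonneg (Real.sqrt_nonneg _)] at this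

theorem integrable_mul_of_exp_mul {μ : Measure ℝ} {h g : ℝ → ℝ} {δ K : ℝ}
    (hi : Integrable (fun y => Real.exp (δ * √|y|) * h y) μ) (hg : Continuous g)
    (hb : ∀ y, |g y| ≤ K * Real.exp (δ * √|y|)) : Integrable (fun y => g y * h y) μ := by
  refine (hi.norm.const_mul K).mono'
    (hg.aestronglyMeasurable.mul (aestronglyMeasurable_of_exp_mul hi)) (ae_of_all _ fun y => ?_)
  rw [norm_mul, norm_mul, Real.norm_of_nonneg (Real.exp_pos _).le, ← mul_assoc]
  exact mul_le_mul_of_nonneg_right (hb y) (norm_nonneg _)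

theorem integrable_pow_mul_of_exp_mul {μ : Measure ℝ} {h : ℝ → ℝ} {δ : ℝ} (hδ : 0 < δ)
    (hi : Integrable (fun y => Real.exp (δ * √|y|) * h y) μ) (n : ℕ) :
    Integrable (fun y => y ^ n * h y) μ := by
  obtain ⟨K, hK, hb⟩ := one_add_abs_pow_le_exp n hδ
  refine integrable_mul_of_exp_mul (K := K) hi (by fun_prop) fun y => le_trans ?_ (hb y)
  rw [abs_pow]
  gcongr
  linarith

/-- The positive and the negative part of a function whose moments vanish are the densities of two
measures with the same moments. -/
theorem momentDeterminate_of_nonneg {μ : Measure ℝ} (h0 : ∀ᵐ y ∂μ, 0 ≤ y) :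
    MomentDeterminate μ := by
  intro h δ hδ hi hm
  have hmeas := aestronglyMeasurable_of_exp_mul hi
  have hint : Integrable h μ := by
    simpa using integrable_pow_mul_of_exp_mul hδ hi 0
  have facts : ∀ g : ℝ → ℝ, AEStronglyMeasurable g μ → (∀ y, ‖g y‖ = ‖h y‖) →
      IsFiniteMeasure (μ.withDensity fun y => ENNReal.ofReal (g y)) ∧
      Integrable (fun y => Real.exp (δ * √|y|)) (μ.withDensity fun y => ENNReal.ofReal (g y)) ∧
      (∀ᵐ y ∂(μ.withDensity fun y => ENNReal.ofReal (g y)), 0 ≤ y) ∧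
      ∀ n : ℕ, ∫ y, y ^ n ∂(μ.withDensity fun y => ENNReal.ofReal (g y)) =
        ∫ y, max (g y) 0 * y ^ n ∂μ := by
    intro g hg hgh
    have hgi : Integrable g μ := hint.congr' hg (ae_of_all _ fun y => (hgh y).symm)
    refine ⟨isFiniteMeasure_withDensity_ofReal hgi.2, ?_, ?_, fun n => ?_⟩
    · rw [integrable_withDensity_iff_integrable_smul₀' hg.aemeasurable.ennreal_ofReal
        (ae_of_all _ fun _ => ENNReal.ofReal_lt_top)]
      refine hi.norm.mono' ?_ (ae_of_all _ fun y => ?_)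
      · exact (AEMeasurable.mul (g := fun y : ℝ => Real.exp (δ * √|y|))
          hg.aemeasurable.ennreal_ofReal.ennreal_toReal
          (Measurable.aemeasurable (by fun_prop))).aestronglyMeasurable
      · rw [smul_eq_mul, norm_mul, norm_mul, mul_comm]
        refine mul_le_mul_of_nonneg_left ?_ (norm_nonneg _)
        rw [ENNReal.toReal_ofReal', ← hgh y, Real.norm_of_nonneg (le_max_right _ _)]
        exact max_le (le_abs_self _) (norm_nonneg _)
    · exact (withDensity_absolutelyContinuous μ _) h0
    · rw [integral_withDensity_eq_integral_toReal_smul₀ hg.aemeasurable.ennreal_ofReal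
        (ae_of_all _ fun _ => ENNReal.ofReal_lt_top)]
      simp only [ENNReal.toReal_ofReal', smul_eq_mul]
  obtain ⟨f₁, i₁, n₁, m₁⟩ := facts h hmeas fun _ => rfl
  obtain ⟨f₂, i₂, n₂, m₂⟩ := facts (fun y => -h y) hmeas.neg fun _ => norm_neg _
  have heq := measure_ext_of_moments n₁ n₂ hδ i₁ i₂ fun n => by
    have hp := integrable_pow_mul_of_exp_mul hδ hi n
    have hi' : ∀ g : ℝ → ℝ, AEStronglyMeasurable g μ → (∀ y, ‖g y‖ = ‖h y‖) →
        Integrable (fun y => max (g y) 0 * y ^ n) μ := by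
      intro g hg hgh
      refine hp.norm.mono' ?_ (ae_of_all _ fun y => ?_)
      · exact ((hg.aemeasurable.max aemeasurable_const).mul
          (Measurable.aemeasurable (by fun_prop))).aestronglyMeasurable
      · rw [norm_mul, norm_mul, mul_comm]
        refine mul_le_mul_of_nonneg_left ?_ (norm_nonneg _)
        rw [← hgh y, Real.norm_of_nonneg (le_max_right _ _)]
        exact max_le (le_abs_self _) (norm_nonneg _)
    rw [m₁, m₂, ← sub_eq_zero, ← integral_sub (hi' h hmeas fun _ => rfl)
      (hi' (fun y => -h y) hmeas.neg fun _ => norm_neg _)]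
    refine Eq.trans (integral_congr_ae (ae_of_all _ fun y => ?_)) (hm n)
    simp only
    rcases le_total 0 (h y) with hy | hy
    · rw [max_eq_left hy, max_eq_right (by linarith)]; ring
    · rw [max_eq_right hy, max_eq_left (by linarith)]; ring
  have hneg : AEMeasurable (fun y => -h y) μ := hmeas.aemeasurable.neg
  rw [withDensity_eq_iff hmeas.aemeasurable.ennreal_ofReal hneg.ennreal_ofReal
    hint.lintegral_lt_top.ne] at heq
  filter_upwards [heq] with y hy
  rcases le_total 0 (h y) with h1 | h1
  · rw [ENNReal.ofReal_of_nonpos (by linarith : -h y ≤ 0), ENNReal.ofReal_eq_zero] at hy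
    exact le_antisymm hy h1
  · rw [ENNReal.ofReal_of_nonpos h1, eq_comm, ENNReal.ofReal_eq_zero] at hy
    exact le_antisymm h1 (neg_nonpos.1 hy)

theorem dualHahnMass_zero_pos {a b c : ℝ} (ha : a < 0) (hab : 0 < a + b) (hac : 0 < a + c) :
    0 < dualHahnMass a b c 0 := by
  have g1 := Real.Gamma_pos_of_pos (by linarith : 0 < b - a)
  have g2 := Real.Gamma_pos_of_pos (by linarith : 0 < c - a)
  have g3 := Real.Gamma_pos_of_pos (by linarith : 0 < -2 * a)
  have g4 := Real.Gamma_pos_of_pos (by linarith : 0 < b + c)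
  rw [dualHahnMass_zero]
  positivity

/-- If the moments of `h` vanish for the parameter `a` then those of `h` vanish for `a + 1`, as the
measure for `a + 1` has the density `y + a²`. So `h` lives on the point `-a²` alone, where its
integral forces it to vanish. -/
theorem momentDeterminate_of_add_one {a b c : ℝ} (ha : a < 0) (hab : 0 < a + b) (hac : 0 < a + c)
    (hd : MomentDeterminate (dualHahnMeasureAux (a + 1) b c)) :
    MomentDeterminate (dualHahnMeasureAux a b c) := by
  intro h δ hδ hi hm
  have hb : 0 < b := by linarith
  have hc : 0 < c := by linarith
  have hbc : 0 < b + c := by linarith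
  have hC : 0 < (a + b) * (a + c) := by positivity
  have hfin := isFiniteMeasure_dualHahnMeasureAux a hb hc
  have hmom : ∀ n : ℕ, ∫ y, y ^ n * h y ∂dualHahnMeasureAux (a + 1) b c = 0 := by
    intro n
    have h1 := integral_dualHahnMeasureAux_mul hab hac hbc fun y => y ^ n * h y
    have h2 : ∫ y, (y + a ^ 2) * (y ^ n * h y) ∂dualHahnMeasureAux a b c = 0 := by
      have e : ∀ y, (y + a ^ 2) * (y ^ n * h y) = y ^ (n + 1) * h y + a ^ 2 * (y ^ n * h y) :=
        fun y => by ring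
      simp only [e]
      rw [integral_add (integrable_pow_mul_of_exp_mul hδ hi _)
        ((integrable_pow_mul_of_exp_mul hδ hi _).const_mul _), integral_const_mul, hm, hm]
      simp
    rw [h2] at h1
    exact (mul_eq_zero.1 h1.symm).resolve_left hC.ne'
  have hint : Integrable (fun y => Real.exp (δ / 2 * √|y|) * h y)
      (dualHahnMeasureAux (a + 1) b c) := by
    have h1 : Integrable (fun y => Real.exp (δ / 2 * √|y|) * h y)
        (ENNReal.ofReal ((a + b) * (a + c)) • dualHahnMeasureAux (a + 1) b c) := by
      rw [← withDensity_dualHahnMeasureAux hab hac hbc,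
        integrable_withDensity_iff_integrable_smul' (by fun_prop)
          (ae_of_all _ fun _ => ENNReal.ofReal_lt_top)]
      obtain ⟨K, hK, hK'⟩ := one_add_abs_pow_le_exp 1 (half_pos hδ)
      have h2 := integrable_mul_of_exp_mul (g := fun y => (y + a ^ 2) * Real.exp (δ / 2 * √|y|))
        (K := (1 + a ^ 2) * K) hi (by fun_prop) fun y => by
          have h3 := hK' y
          rw [pow_one] at h3
          have h4 : |y + a ^ 2| ≤ (1 + a ^ 2) * (1 + |y|) := by
            refine (abs_add_le _ _).trans ?_
            rw [abs_of_nonneg (sq_nonneg a)]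
            nlinarith [abs_nonneg y, mul_nonneg (sq_nonneg a) (abs_nonneg y)]
          rw [abs_mul, abs_of_pos (Real.exp_pos _)]
          calc _ ≤ (1 + a ^ 2) * (K * Real.exp (δ / 2 * √|y|)) * Real.exp (δ / 2 * √|y|) := by
                gcongr
                exact h4.trans (by gcongr)
            _ = (1 + a ^ 2) * K * (Real.exp (δ / 2 * √|y|) * Real.exp (δ / 2 * √|y|)) := by ring
            _ = _ := by rw [← Real.exp_add]; congr 2; ring
      refine h2.congr ?_
      filter_upwards [ae_nonneg_add_sq a b c] with y hy
      rw [ENNReal.toReal_ofReal hy, smul_eq_mul, mul_assoc]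
    rwa [integrable_smul_measure (by simpa using hC) ENNReal.ofReal_ne_top] at h1
  have hz := ae_of_ae_add_one hab hac hbc (hd h (δ / 2) (half_pos hδ) hint hmom)
  have h0 := hm 0
  simp only [pow_zero, one_mul] at h0
  have hsing : h =ᵐ[dualHahnMeasureAux a b c] ({-a ^ 2} : Set ℝ).indicator h := by
    filter_upwards [hz] with y hy
    by_cases hy' : y = -a ^ 2
    · simp [Set.indicator_of_mem (show y ∈ ({-a ^ 2} : Set ℝ) from hy')]
    · rw [Set.indicator_of_notMem (show y ∉ ({-a ^ 2} : Set ℝ) from hy')]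
      exact hy hy'
  rw [integral_congr_ae hsing, integral_indicator (measurableSet_singleton _),
    integral_singleton, smul_eq_mul, Measure.real, dualHahnMeasureAux_singleton ha,
    ENNReal.toReal_ofReal (dualHahnMass_zero_pos ha hab hac).le] at h0
  have h1 : h (-a ^ 2) = 0 :=
    (mul_eq_zero.1 h0).resolve_left (dualHahnMass_zero_pos ha hab hac).ne'
  filter_upwards [hz] with y hy
  by_cases hy' : y = -a ^ 2
  · rw [hy']; exact h1
  · exact hy hy'

theorem momentDeterminate_dualHahnMeasureAux {a b c : ℝ}
    (hab : 0 < a + b) (hac : 0 < a + c) : MomentDeterminate (dualHahnMeasureAux a b c) := by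
  obtain ⟨n, hn⟩ := exists_nat_gt (-a)
  induction n generalizing a with
  | zero =>
    refine momentDeterminate_of_nonneg (ae_dualHahnMeasureAux measurableSet_Ici
      (fun x _ => sq_nonneg x) fun k hk => ?_)
    have := k.cast_nonneg (α := ℝ)
    simp only [Nat.cast_zero] at hn
    linarith
  | succ n ih =>
    rcases le_or_gt 0 a with ha | ha
    · refine momentDeterminate_of_nonneg (ae_dualHahnMeasureAux measurableSet_Ici
        (fun x _ => sq_nonneg x) fun k hk => ?_)
      have := k.cast_nonneg (α := ℝ)
      linarith
    · refine momentDeterminate_of_add_one ha hab hac (ih (by linarith) (by linarith) ?_)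
      push_cast at hn
      linarith

/-! ### Recurrence relation and symmetry of the continuous dual Hahn polynomials -/

/-- The term `(-ν)_j ∏_{l < j} ((a + l)² + y) / ((a+b)_j (a+c)_j j!)` of the hypergeometric series,
for real `ν`. -/
noncomputable def hahnTerm (a b c ν y : ℝ) (j : ℕ) : ℝ :=
  poch (-ν) j * (∏ l ∈ Finset.range j, ((a + l) ^ 2 + y)) /
    (poch (a + b) j * poch (a + c) j * (j.factorial : ℝ))

theorem poch_neg_nat_eq_zero {n j : ℕ} (h : n < j) : poch (-(n : ℝ)) j = 0 := by
  induction j, h using Nat.le_induction with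
  | base => rw [poch_succ]; simp
  | succ k _ ih => rw [poch_succ, ih, zero_mul]

theorem dualHahn_eq_sum (a b c : ℝ) {n N : ℕ} (h : n < N) (y : ℝ) :
    dualHahn a b c n y = poch (a + b) n * poch (a + c) n *
      ∑ j ∈ Finset.range N, hahnTerm a b c n y j := by
  rw [dualHahn]
  congr 1
  refine Finset.sum_subset (Finset.range_subset_range.2 h) fun j _ hj => ?_
  rw [poch_neg_nat_eq_zero (by simpa using hj)]
  simp

/-- The partial sums of the recurrence relation telescope, since
`(y + a²) ∏_{l < j} ((a + l)² + y)` is the next such product minus `j (2a + j)` times this one. -/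
theorem sum_hahnTerm_recurrence {a b c : ℝ} (hab : 0 < a + b) (hac : 0 < a + c) (ν y : ℝ) (N : ℕ) :
    ∑ j ∈ Finset.range (N + 1), ((ν + (a + b)) * (ν + (a + c)) * hahnTerm a b c (ν + 1) y j -
        ((ν + (a + b)) * (ν + (a + c)) + ν * (ν + (b + c) - 1)) * hahnTerm a b c ν y j +
        ν * (ν + (b + c) - 1) * hahnTerm a b c (ν - 1) y j +
        (a ^ 2 + y) * hahnTerm a b c ν y j) =
      hahnTerm a b c ν y N * ((a + N) ^ 2 + y) := by
  induction N with
  | zero => simp [hahnTerm, poch_zero]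
  | succ N ih =>
    rw [Finset.sum_range_succ, ih]
    have p1 : poch (-(ν + 1)) (N + 1) = -(ν + 1) * poch (-ν) N := by
      rw [poch_succ_left]; congr 2; ring
    have p2 : poch (-ν) (N + 1) = poch (-ν) N * (-ν + N) := poch_succ _ _
    have p3 : ν * poch (-(ν - 1)) (N + 1) = -(poch (-ν) N * (-ν + N) * (-ν + (N + 1))) := by
      have h1 : poch (-ν) (N + 2) = -ν * poch (-(ν - 1)) (N + 1) := by
        rw [poch_succ_left]; congr 2; ring
      have h2 : poch (-ν) (N + 2) = poch (-ν) N * (-ν + N) * (-ν + (N + 1)) := by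
        rw [poch_succ, poch_succ]; push_cast; ring
      rw [← h2, h1]; ring
    have q1 := (poch_pos hab N).ne'
    have q2 := (poch_pos hac N).ne'
    have q3 : (a + b + N) ≠ 0 := by positivity
    have q4 : (a + c + N) ≠ 0 := by positivity
    have q5 : (N.factorial : ℝ) ≠ 0 := by positivity
    have q6 : ((N : ℝ) + 1) ≠ 0 := by positivity
    have e3 : ν * hahnTerm a b c (ν - 1) y (N + 1) =
        -(poch (-ν) N * (-ν + N) * (-ν + (N + 1))) *
          (∏ l ∈ Finset.range (N + 1), ((a + l) ^ 2 + y)) /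
        (poch (a + b) (N + 1) * poch (a + c) (N + 1) * ((N + 1).factorial : ℝ)) := by
      rw [hahnTerm, ← p3]; ring
    have e3' : ν * (ν + (b + c) - 1) * hahnTerm a b c (ν - 1) y (N + 1) =
        (ν + (b + c) - 1) * (ν * hahnTerm a b c (ν - 1) y (N + 1)) := by ring
    rw [e3', e3]
    simp only [hahnTerm]
    rw [p1, p2, poch_succ (a + b), poch_succ (a + c), Nat.factorial_succ, Finset.prod_range_succ]
    push_cast
    generalize poch (a + b) N = u1 at *
    generalize poch (a + c) N = u2 at *
    generalize poch (-ν) N = u3 at *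
    generalize (N.factorial : ℝ) = u4 at *
    generalize (∏ l ∈ Finset.range N, ((a + (l : ℝ)) ^ 2 + y)) = u5 at *
    clear e3 e3' ih p1 p2 p3
    field_simp
    ring

/-- The diagonal coefficient of the recurrence relation. It is symmetric in the parameters. -/
def hahnDiag (a b c : ℝ) (n : ℕ) : ℝ :=
  (n + (a + b)) * (n + (a + c)) + n * (n + (b + c) - 1) - a ^ 2

/-- The square of the off-diagonal coefficient of the recurrence relation for the orthonormal
polynomials. -/
def hahnOffSq (a b c : ℝ) (n : ℕ) : ℝ :=
  (n + 1) * (n + (a + b)) * (n + (a + c)) * (n + (b + c))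

theorem dualHahn_zero (a b c y : ℝ) : dualHahn a b c 0 y = 1 := by
  simp [dualHahn, poch_zero]

theorem dualHahn_recurrence {a b c : ℝ} (hab : 0 < a + b) (hac : 0 < a + c) (n : ℕ) (y : ℝ) :
    dualHahn a b c (n + 2) y = (hahnDiag a b c (n + 1) - y) * dualHahn a b c (n + 1) y -
      hahnOffSq a b c n * dualHahn a b c n y := by
  have h := sum_hahnTerm_recurrence hab hac ((n + 1 : ℕ) : ℝ) y (n + 2)
  have h0 : hahnTerm a b c ((n + 1 : ℕ) : ℝ) y (n + 2) = 0 := by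
    rw [hahnTerm, poch_neg_nat_eq_zero (by omega)]; simp
  rw [h0, zero_mul, Finset.sum_add_distrib, Finset.sum_add_distrib, Finset.sum_sub_distrib,
    ← Finset.mul_sum, ← Finset.mul_sum, ← Finset.mul_sum, ← Finset.mul_sum] at h
  have c1 : ((n + 1 : ℕ) : ℝ) + 1 = ((n + 2 : ℕ) : ℝ) := by push_cast; ring
  have c2 : ((n + 1 : ℕ) : ℝ) - 1 = (n : ℝ) := by push_cast; ring
  rw [c1, c2] at h
  rw [dualHahn_eq_sum a b c (show n + 2 < n + 2 + 1 by omega),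
    dualHahn_eq_sum a b c (show n + 1 < n + 2 + 1 by omega),
    dualHahn_eq_sum a b c (show n < n + 2 + 1 by omega), poch_succ (a + b) (n + 1),
    poch_succ (a + c) (n + 1), poch_succ (a + b) n, poch_succ (a + c) n, hahnDiag, hahnOffSq]
  push_cast at h ⊢
  linear_combination (poch (a + b) n * (a + b + n)) * (poch (a + c) n * (a + c + n)) * h

theorem dualHahn_one {a b c : ℝ} (hab : 0 < a + b) (hac : 0 < a + c) (y : ℝ) :
    dualHahn a b c 1 y = hahnDiag a b c 0 - y := by
  have p1 : ∀ s : ℝ, poch s 1 = s := fun s => by simp [poch_succ, poch_zero]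
  simp only [dualHahn, Finset.sum_range_succ, Finset.sum_range_zero, p1, poch_zero, hahnDiag,
    Finset.prod_range_succ, Finset.prod_range_zero]
  have := hab.ne'
  have := hac.ne'
  simp
  field_simp
  ring

theorem dualHahn_eq_of_coeff_eq {a b c a' b' c' : ℝ} (hab : 0 < a + b) (hac : 0 < a + c)
    (hab' : 0 < a' + b') (hac' : 0 < a' + c') (hd : hahnDiag a b c = hahnDiag a' b' c')
    (ho : hahnOffSq a b c = hahnOffSq a' b' c') (n : ℕ) (y : ℝ) :
    dualHahn a b c n y = dualHahn a' b' c' n y := by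
  induction n using Nat.twoStepInduction with
  | zero => rw [dualHahn_zero, dualHahn_zero]
  | one => rw [dualHahn_one hab hac, dualHahn_one hab' hac', hd]
  | more n h0 h1 => rw [dualHahn_recurrence hab hac, dualHahn_recurrence hab' hac', hd, ho, h0, h1]

theorem dualHahnON_swap {a b c : ℝ} (hab : 0 < a + b) (hac : 0 < a + c) (hbc : 0 < b + c) (n : ℕ)
    (y : ℝ) : dualHahnON a b c n y = dualHahnON b a c n y := by
  rw [dualHahnON, dualHahnON, dualHahn_eq_of_coeff_eq (a' := b) (b' := a) (c' := c) hab hac (by linarith) hbc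
    (by ext n; simp only [hahnDiag]; ring) (by ext n; simp only [hahnOffSq]; ring), add_comm b a,
    mul_right_comm _ (poch (a + c) n)]

theorem dualHahnON_swap' {a b c : ℝ} (hab : 0 < a + b) (hac : 0 < a + c) (n : ℕ)
    (y : ℝ) : dualHahnON a b c n y = dualHahnON a c b n y := by
  rw [dualHahnON, dualHahnON, dualHahn_eq_of_coeff_eq (a' := a) (b' := c) (c' := b) hab hac hac hab
    (by ext n; simp only [hahnDiag]; ring) (by ext n; simp only [hahnOffSq]; ring), add_comm c b,
    mul_right_comm _ (poch (a + b) n)]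

/-! ### Orthonormal polynomials -/

/-- The squared norm `n! (a+b)_n (a+c)_n (b+c)_n` of the continuous dual Hahn polynomial. -/
noncomputable def hahnNormSq (a b c : ℝ) (n : ℕ) : ℝ :=
  (n.factorial : ℝ) * poch (a + b) n * poch (a + c) n * poch (b + c) n

theorem hahnNormSq_pos {a b c : ℝ} (hab : 0 < a + b) (hac : 0 < a + c) (hbc : 0 < b + c) (n : ℕ) :
    0 < hahnNormSq a b c n := by
  have := poch_pos hab n
  have := poch_pos hac n
  have := poch_pos hbc n
  unfold hahnNormSq
  positivity

theorem hahnOffSq_pos {a b c : ℝ} (hab : 0 < a + b) (hac : 0 < a + c) (hbc : 0 < b + c) (n : ℕ) :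
    0 < hahnOffSq a b c n := by
  unfold hahnOffSq
  positivity

theorem hahnNormSq_succ (a b c : ℝ) (n : ℕ) :
    hahnNormSq a b c (n + 1) = hahnNormSq a b c n * hahnOffSq a b c n := by
  simp only [hahnNormSq, hahnOffSq, poch_succ, Nat.factorial_succ]
  push_cast
  ring

theorem dualHahnON_eq (a b c : ℝ) (n : ℕ) (y : ℝ) :
    dualHahnON a b c n y = (-1) ^ n * dualHahn a b c n y / √(hahnNormSq a b c n) := rfl

theorem dualHahnON_zero (a b c y : ℝ) : dualHahnON a b c 0 y = 1 := by
  simp [dualHahnON, dualHahn_zero, poch_zero]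

/-- The coefficient of the preceding polynomial in the recurrence relation, which is absent
for `n = 0`. -/
noncomputable def hahnLower (a b c : ℝ) : ℕ → ℝ
  | 0 => 0
  | n + 1 => √(hahnOffSq a b c n)

theorem mul_dualHahnON {a b c : ℝ} (hab : 0 < a + b) (hac : 0 < a + c) (hbc : 0 < b + c) (n : ℕ)
    (y : ℝ) : y * dualHahnON a b c n y = √(hahnOffSq a b c n) * dualHahnON a b c (n + 1) y +
      hahnDiag a b c n * dualHahnON a b c n y +
      hahnLower a b c n * dualHahnON a b c (n - 1) y := by
  have sq : ∀ m, √(hahnNormSq a b c (m + 1)) = √(hahnNormSq a b c m) * √(hahnOffSq a b c m) := by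
    intro m
    rw [hahnNormSq_succ, Real.sqrt_mul (hahnNormSq_pos hab hac hbc m).le]
  have n1 : ∀ m, √(hahnNormSq a b c m) ≠ 0 := fun m =>
    (Real.sqrt_pos.2 (hahnNormSq_pos hab hac hbc m)).ne'
  have n2 : ∀ m, √(hahnOffSq a b c m) ≠ 0 := fun m =>
    (Real.sqrt_pos.2 (hahnOffSq_pos hab hac hbc m)).ne'
  cases n with
  | zero =>
    have e := sq 0
    have h0 := n1 0
    have h2 := n2 0
    simp only [hahnLower, dualHahnON_eq, dualHahn_zero, zero_add, dualHahn_one hab hac] at e ⊢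
    rw [e]
    field_simp
    ring
  | succ n =>
    have s2 : √(hahnOffSq a b c n) ^ 2 = hahnOffSq a b c n :=
      Real.sq_sqrt (hahnOffSq_pos hab hac hbc n).le
    simp only [hahnLower, dualHahnON_eq, Nat.add_sub_cancel]
    have hrec := dualHahn_recurrence hab hac n y
    rw [← s2] at hrec
    rw [hrec, sq (n + 1), sq n]
    have h0 := n1 n
    have h2 := n2 n
    have h3 := n2 (n + 1)
    rw [pow_succ (-1 : ℝ) (n + 1), pow_succ (-1 : ℝ) n]
    field_simp
    ring

/-- The orthonormal continuous dual Hahn polynomial as an element of `ℝ[X]`. -/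
noncomputable def hahnPoly (a b c : ℝ) (n : ℕ) : ℝ[X] :=
  C ((-1) ^ n / √(hahnNormSq a b c n) * (poch (a + b) n * poch (a + c) n)) *
    ∑ j ∈ Finset.range (n + 1), C (poch (-(n : ℝ)) j /
      (poch (a + b) j * poch (a + c) j * (j.factorial : ℝ))) *
      ∏ l ∈ Finset.range j, (C ((a + l) ^ 2) + X)

theorem eval_hahnPoly (a b c : ℝ) (n : ℕ) (y : ℝ) :
    (hahnPoly a b c n).eval y = dualHahnON a b c n y := by
  simp only [hahnPoly, eval_mul, eval_C, eval_finsetSum, eval_prod, eval_add, eval_X,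
    dualHahnON_eq, dualHahn]
  rw [← mul_assoc ((-1 : ℝ) ^ n), div_mul_eq_mul_div, div_mul_eq_mul_div]
  congr 2
  refine Finset.sum_congr rfl fun j _ => ?_
  ring

theorem hahnPoly_zero (a b c : ℝ) : hahnPoly a b c 0 = 1 := by
  refine Polynomial.funext fun y => ?_
  rw [eval_hahnPoly, dualHahnON_zero, eval_one]

theorem X_mul_hahnPoly {a b c : ℝ} (hab : 0 < a + b) (hac : 0 < a + c) (hbc : 0 < b + c) (n : ℕ) :
    X * hahnPoly a b c n = √(hahnOffSq a b c n) • hahnPoly a b c (n + 1) +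
      hahnDiag a b c n • hahnPoly a b c n + hahnLower a b c n • hahnPoly a b c (n - 1) := by
  refine Polynomial.funext fun y => ?_
  simp only [eval_mul, eval_X, eval_add, eval_smul, eval_hahnPoly, smul_eq_mul]
  exact mul_dualHahnON hab hac hbc n y

/-- A linear functional that vanishes on all members but the first of a sequence of polynomials with
a symmetric three-term recurrence relation makes this sequence orthonormal. -/
theorem functional_mul_eq {P : ℕ → ℝ[X]} {u d e : ℕ → ℝ} (hP0 : P 0 = 1) (hu : ∀ n, u n ≠ 0)
    (he0 : e 0 = 0) (he : ∀ n, e (n + 1) = u n)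
    (hP : ∀ n, X * P n = u n • P (n + 1) + d n • P n + e n • P (n - 1))
    (L : ℝ[X] →ₗ[ℝ] ℝ) (hL : ∀ n, L (P n) = if n = 0 then 1 else 0) (m n : ℕ) :
    L (P n * P m) = if n = m then 1 else 0 := by
  induction m using Nat.strong_induction_on generalizing n with
  | _ m ih =>
    cases m with
    | zero => rw [hP0, mul_one, hL]
    | succ m =>
      have h1 : L (P n * (X * P m)) = L ((X * P n) * P m) := by congr 1; ring
      rw [hP, hP] at h1
      simp only [mul_add, add_mul, mul_smul_comm, smul_mul_assoc, map_add, map_smul,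
        smul_eq_mul] at h1
      rw [ih m (Nat.lt_succ_self m) n, ih m (Nat.lt_succ_self m) (n + 1),
        ih m (Nat.lt_succ_self m) (n - 1), ih (m - 1) (by omega) n] at h1
      refine mul_left_cancel₀ (hu m) ?_
      have key : u m * (if n = m + 1 then (1 : ℝ) else 0) =
          u n * (if n + 1 = m then 1 else 0) + d n * (if n = m then 1 else 0) +
          e n * (if n - 1 = m then 1 else 0) - d m * (if n = m then 1 else 0) -
          e m * (if n = m - 1 then 1 else 0) := by
        rcases lt_trichotomy n m with h | h | h
        · obtain ⟨k, rfl⟩ : ∃ k, m = k + 1 := ⟨m - 1, by omega⟩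
          rw [if_neg (by omega : ¬ n = k + 1 + 1), if_neg (by omega : ¬ n = k + 1),
            if_neg (by omega : ¬ n - 1 = k + 1), he]
          by_cases hk : n = k
          · subst hk; simp
          · rw [if_neg (by omega : ¬ n + 1 = k + 1), if_neg (by omega : ¬ n = k + 1 - 1)]; simp
        · subst h
          cases n with
          | zero => simp [he0]
          | succ k => simp
        · obtain ⟨k, rfl⟩ : ∃ k, n = k + 1 := ⟨n - 1, by omega⟩
          rw [if_neg (by omega : ¬ k + 1 + 1 = m), if_neg (by omega : ¬ k + 1 = m),
            if_neg (by omega : ¬ k + 1 = m - 1), he]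
          by_cases hk : k = m
          · subst hk; simp
          · rw [if_neg (by omega : ¬ k + 1 = m + 1), if_neg (by omega : ¬ k + 1 - 1 = m)]; simp
      rw [key]
      linarith

/-! ### Gauss's summation formula -/

/-- The term `(A)_n (B)_n / ((C)_n n!)` of the hypergeometric series at `1`. -/
noncomputable def gaussTerm (A B C : ℝ) (n : ℕ) : ℝ :=
  poch A n * poch B n / (poch C n * (n.factorial : ℝ))

theorem gaussTerm_zero (A B C : ℝ) : gaussTerm A B C 0 = 1 := by
  simp [gaussTerm, poch_zero]

theorem gaussTerm_pos {A B C : ℝ} (hA : 0 < A) (hB : 0 < B) (hC : 0 < C) (n : ℕ) :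
    0 < gaussTerm A B C n := by
  have := poch_pos hA n
  have := poch_pos hB n
  have := poch_pos hC n
  unfold gaussTerm
  positivity

theorem gaussTerm_add_one_right {A B C : ℝ} (hC : 0 < C) (n : ℕ) :
    gaussTerm A B (C + 1) n * (C + n) = C * gaussTerm A B C n := by
  have h1 := poch_succ_left C n
  rw [poch_succ] at h1
  have p1 := (poch_pos hC n).ne'
  have p2 := (poch_pos (show 0 < C + 1 by linarith) n).ne'
  have p3 : (n.factorial : ℝ) ≠ 0 := by positivity
  rw [gaussTerm, gaussTerm]
  field_simp
  linear_combination poch A n * poch B n * h1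

/-- A contiguous relation for the partial sums: the sequence `n t_n` of the terms `t_n` has the
increments `-(C - A - B) t_n + (C - A) (C - B) t_n / (C + n)`. -/
theorem sum_gaussTerm {A B C : ℝ} (hC : 0 < C) (N : ℕ) :
    C * (C - A - B) * ∑ n ∈ Finset.range N, gaussTerm A B C n =
      (C - A) * (C - B) * ∑ n ∈ Finset.range N, gaussTerm A B (C + 1) n -
        C * (N * gaussTerm A B C N) := by
  induction N with
  | zero => simp
  | succ N ih =>
    rw [Finset.sum_range_succ, Finset.sum_range_succ, mul_add, mul_add, ih]
    have h1 := gaussTerm_add_one_right (A := A) (B := B) hC N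
    have h2 : gaussTerm A B C (N + 1) * ((C + N) * (N + 1)) =
        (A + N) * (B + N) * gaussTerm A B C N := by
      have p1 := (poch_pos hC N).ne'
      have p3 : (N.factorial : ℝ) ≠ 0 := by positivity
      have p4 : C + N ≠ 0 := by positivity
      have p5 : (N : ℝ) + 1 ≠ 0 := by positivity
      simp only [gaussTerm, poch_succ, Nat.factorial_succ]
      push_cast
      field_simp
    have h4 : C + N ≠ 0 := by positivity
    refine mul_left_cancel₀ h4 ?_
    push_cast
    linear_combination -(C - A) * (C - B) * h1 + C * h2

theorem summable_gaussTerm {A B C : ℝ} (hA : 0 < A) (hB : 0 < B) (hABC : A + B < C) :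
    Summable (gaussTerm A B C) := by
  have hC : 0 < C := by linarith
  set s := C - A - B with hs
  have hs0 : 0 < s := by simp only [hs]; linarith
  -- the increment of `n t_n` is at most `-(s / 2) t_n` from some `n` on
  obtain ⟨M, hM⟩ := exists_nat_gt (2 * ((C - A) * (C - B)) / s)
  have step : ∀ n : ℕ, M ≤ n → s / 2 * gaussTerm A B C n ≤
      n * gaussTerm A B C n - (n + 1 : ℕ) * gaussTerm A B C (n + 1) := by
    intro n hn
    have e1 := sum_gaussTerm (A := A) (B := B) hC n
    have e2 := sum_gaussTerm (A := A) (B := B) hC (n + 1)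
    rw [Finset.sum_range_succ, Finset.sum_range_succ] at e2
    have h1 := gaussTerm_add_one_right (A := A) (B := B) hC n
    have ht := gaussTerm_pos hA hB hC n
    have ht' := gaussTerm_pos hA hB (show 0 < C + 1 by linarith) n
    have hn' : (M : ℝ) ≤ n := by exact_mod_cast hn
    have h2 : 2 * ((C - A) * (C - B)) ≤ s * (C + n) := by
      rw [div_lt_iff₀ hs0] at hM
      nlinarith
    have h3 : (C - A) * (C - B) * gaussTerm A B (C + 1) n ≤ s / 2 * (C * gaussTerm A B C n) := by
      rw [← h1]
      nlinarith
    have h5 : C * (s / 2 * gaussTerm A B C n) ≤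
        C * (n * gaussTerm A B C n - (n + 1 : ℕ) * gaussTerm A B C (n + 1)) := by
      push_cast at e2 ⊢
      nlinarith
    exact le_of_mul_le_mul_left h5 hC
  rw [← summable_nat_add_iff M]
  refine summable_of_sum_range_le (c := M * gaussTerm A B C M / (s / 2))
    (fun n => (gaussTerm_pos hA hB hC _).le) fun N => ?_
  rw [le_div_iff₀ (by positivity)]
  have : ∀ N : ℕ, (∑ i ∈ Finset.range N, gaussTerm A B C (i + M)) * (s / 2) ≤
      M * gaussTerm A B C M - (N + M : ℕ) * gaussTerm A B C (N + M) := by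
    intro N
    induction N with
    | zero => simp
    | succ N ih =>
      have := step (N + M) (by omega)
      rw [Finset.sum_range_succ, add_mul, show N + 1 + M = N + M + 1 by ring]
      linarith
  have h0 := (gaussTerm_pos hA hB hC (N + M)).le
  have h1 := this N
  have h2 : 0 ≤ ((N + M : ℕ) : ℝ) * gaussTerm A B C (N + M) := by positivity
  linarith

theorem tendsto_mul_gaussTerm {A B C : ℝ} (hA : 0 < A) (hB : 0 < B) (hABC : A + B < C) :
    Tendsto (fun n : ℕ => n * gaussTerm A B C n) atTop (𝓝 0) := by
  have hC : 0 < C := by linarith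
  have s1 := summable_gaussTerm hA hB hABC
  have s2 := summable_gaussTerm hA hB (show A + B < C + 1 by linarith)
  -- the limit exists by the telescoped identity, and a positive limit contradicts summability
  obtain ⟨l, hl⟩ : ∃ l, Tendsto (fun n : ℕ => n * gaussTerm A B C n) atTop (𝓝 l) := by
    refine ⟨_, ((((s2.hasSum.tendsto_sum_nat).const_mul ((C - A) * (C - B))).sub
      ((s1.hasSum.tendsto_sum_nat).const_mul (C * (C - A - B)))).div_const C).congr fun N => ?_⟩
    rw [sum_gaussTerm hC N]
    field_simp
    ring
  have hl0 : 0 ≤ l := ge_of_tendsto' hl fun n =>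
    mul_nonneg n.cast_nonneg (gaussTerm_pos hA hB hC n).le
  rcases hl0.eq_or_lt with h | h
  · rwa [← h] at hl
  · exfalso
    have h1 : ∀ᶠ n : ℕ in atTop, l / 2 ≤ n * gaussTerm A B C n :=
      (hl.eventually (lt_mem_nhds (half_lt_self h))).mono fun n hn => hn.le
    refine Real.not_summable_one_div_natCast ?_
    refine Summable.of_norm_bounded_eventually_nat (s1.mul_left (2 / l)) ?_
    filter_upwards [h1, eventually_gt_atTop 0] with n hn hn0
    have hn0' : (0 : ℝ) < n := by exact_mod_cast hn0
    rw [Real.norm_of_nonneg (by positivity), div_le_iff₀ hn0']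
    calc (1 : ℝ) = 2 / l * (l / 2) := by field_simp
      _ ≤ 2 / l * (n * gaussTerm A B C n) := by gcongr
      _ = _ := by ring

theorem tsum_gaussTerm_add_one {A B C : ℝ} (hA : 0 < A) (hB : 0 < B) (hABC : A + B < C) :
    C * (C - A - B) * ∑' n, gaussTerm A B C n =
      (C - A) * (C - B) * ∑' n, gaussTerm A B (C + 1) n := by
  have hC : 0 < C := by linarith
  have s1 := summable_gaussTerm hA hB hABC
  have s2 := summable_gaussTerm hA hB (show A + B < C + 1 by linarith)
  have l1 := (s1.hasSum.tendsto_sum_nat).const_mul (C * (C - A - B))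
  have l2 := ((s2.hasSum.tendsto_sum_nat).const_mul ((C - A) * (C - B))).sub
    ((tendsto_mul_gaussTerm hA hB hABC).const_mul C)
  rw [mul_zero, sub_zero] at l2
  exact tendsto_nhds_unique (l1.congr fun N => sum_gaussTerm hC N) l2

theorem tsum_gaussTerm_add_nat {A B C : ℝ} (hA : 0 < A) (hB : 0 < B) (hABC : A + B < C) (N : ℕ) :
    poch C N * poch (C - A - B) N * ∑' n, gaussTerm A B C n =
      poch (C - A) N * poch (C - B) N * ∑' n, gaussTerm A B (C + N) n := by
  induction N with
  | zero => simp [poch_zero]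
  | succ N ih =>
    have h := tsum_gaussTerm_add_one hA hB
      (show A + B < C + N by have := N.cast_nonneg (α := ℝ); linarith)
    have e : C + (N + 1 : ℕ) = C + N + 1 := by push_cast; ring
    rw [e]
    simp only [poch_succ]
    linear_combination ((C + N) * (C - A - B + N)) * ih + poch (C - A) N * poch (C - B) N * h

theorem tendsto_tsum_gaussTerm {A B C : ℝ} (hA : 0 < A) (hB : 0 < B) (hABC : A + B < C) :
    Tendsto (fun N : ℕ => ∑' n, gaussTerm A B (C + N) n) atTop (𝓝 1) := by
  have hC : 0 < C := by linarith
  have s1 := summable_gaussTerm hA hB hABC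
  set S := ∑' n, gaussTerm A B C (n + 1) with hS
  have hle : ∀ N : ℕ, ∀ n, gaussTerm A B (C + N) (n + 1) ≤ C / (C + N) * gaussTerm A B C (n + 1) := by
    intro N n
    have hCN : 0 < C + N := by positivity
    have h1 : C / (C + N) * gaussTerm A B C (n + 1) = poch A (n + 1) * poch B (n + 1) /
        ((C + N) * poch (C + 1) n * ((n + 1).factorial : ℝ)) := by
      have := (poch_pos (show 0 < C + 1 by linarith) n).ne'
      rw [gaussTerm, poch_succ_left C]
      field_simp
    have q : poch (C + 1) n ≤ poch (C + N + 1) n :=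
      poch_le_poch (by linarith) (by linarith [N.cast_nonneg (α := ℝ)]) n
    rw [h1, gaussTerm, poch_succ_left (C + N)]
    have a1 := poch_pos hA (n + 1)
    have a2 := poch_pos hB (n + 1)
    have a3 := poch_pos (show 0 < C + 1 by linarith) n
    gcongr
  have hup : ∀ N : ℕ, ∑' n, gaussTerm A B (C + N) n ≤ 1 + C / (C + N) * S := by
    intro N
    have s2 := summable_gaussTerm hA hB
      (show A + B < C + N by have := N.cast_nonneg (α := ℝ); linarith)
    rw [s2.tsum_eq_zero_add, gaussTerm_zero, hS, ← tsum_mul_left]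
    gcongr
    · exact (summable_nat_add_iff 1).2 s2
    · exact ((summable_nat_add_iff 1).2 s1).mul_left _
    · exact hle N _
  have hlow : ∀ N : ℕ, 1 ≤ ∑' n, gaussTerm A B (C + N) n := by
    intro N
    have s2 := summable_gaussTerm hA hB
      (show A + B < C + N by have := N.cast_nonneg (α := ℝ); linarith)
    have := s2.le_tsum 0 fun n _ => (gaussTerm_pos hA hB (by positivity) n).le
    rwa [gaussTerm_zero] at this
  refine tendsto_of_tendsto_of_tendsto_of_le_of_le tendsto_const_nhds ?_ hlow hup
  have h1 : Tendsto (fun N : ℕ => C / (C + N)) atTop (𝓝 0) :=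
    tendsto_const_nhds.div_atTop (tendsto_atTop_add_const_left _ _ tendsto_natCast_atTop_atTop)
  simpa using (h1.mul_const S).const_add 1

theorem GammaSeq_eq_poch (s : ℝ) (n : ℕ) :
    Real.GammaSeq s n = (n : ℝ) ^ s * n.factorial / poch s (n + 1) := by
  have : ∀ m, poch s m = ∏ j ∈ Finset.range m, (s + j) := by
    intro m
    induction m with
    | zero => simp [poch_zero]
    | succ m ih => rw [poch_succ, ih, Finset.prod_range_succ]
  rw [Real.GammaSeq, this]

/-- Gauss's formula for the hypergeometric series at `1`, from the contiguous relation and the limit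
`C → ∞` along `C + ℕ`. -/
theorem tsum_gaussTerm {A B C : ℝ} (hA : 0 < A) (hB : 0 < B) (hABC : A + B < C) :
    ∑' n, gaussTerm A B C n =
      Real.Gamma C * Real.Gamma (C - A - B) / (Real.Gamma (C - A) * Real.Gamma (C - B)) := by
  have g1 : 0 < C := by linarith
  have g2 : 0 < C - A - B := by linarith
  have g3 : 0 < C - A := by linarith
  have g4 : 0 < C - B := by linarith
  have l := (((Real.GammaSeq_tendsto_Gamma C).mul (Real.GammaSeq_tendsto_Gamma (C - A - B))).div
    ((Real.GammaSeq_tendsto_Gamma (C - A)).mul (Real.GammaSeq_tendsto_Gamma (C - B)))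
    (mul_pos (Real.Gamma_pos_of_pos g3) (Real.Gamma_pos_of_pos g4)).ne').mul
    ((tendsto_tsum_gaussTerm hA hB hABC).comp (tendsto_add_atTop_nat 1))
  rw [mul_one] at l
  refine tendsto_nhds_unique (tendsto_const_nhds.congr' ?_) l
  filter_upwards [eventually_gt_atTop 0] with n hn
  have hn' : (0 : ℝ) < n := by exact_mod_cast hn
  have h := tsum_gaussTerm_add_nat hA hB hABC (n + 1)
  have p1 := (poch_pos g1 (n + 1)).ne'
  have p2 := (poch_pos g2 (n + 1)).ne'
  have p3 := (poch_pos g3 (n + 1)).ne'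
  have p4 := (poch_pos g4 (n + 1)).ne'
  simp only [Pi.div_apply, GammaSeq_eq_poch, Function.comp_apply]
  have e : (n : ℝ) ^ C * (n : ℝ) ^ (C - A - B) = (n : ℝ) ^ (C - A) * (n : ℝ) ^ (C - B) := by
    rw [← Real.rpow_add hn', ← Real.rpow_add hn']
    congr 1
    ring
  have q1 := (Real.rpow_pos_of_pos hn' C).ne'
  have q2 := (Real.rpow_pos_of_pos hn' (C - A - B)).ne'
  have q3 := (Real.rpow_pos_of_pos hn' (C - A)).ne'
  have q4 := (Real.rpow_pos_of_pos hn' (C - B)).ne'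
  have q5 : (n.factorial : ℝ) ≠ 0 := by positivity
  generalize (n : ℝ) ^ C = r1 at *
  generalize (n : ℝ) ^ (C - A - B) = r2 at *
  generalize (n : ℝ) ^ (C - A) = r3 at *
  generalize (n : ℝ) ^ (C - B) = r4 at *
  generalize ∑' k, gaussTerm A B C k = t1 at *
  generalize ∑' k, gaussTerm A B (C + (n + 1 : ℕ)) k = t2 at *
  have : t1 = poch (C - A) (n + 1) * poch (C - B) (n + 1) * t2 /
      (poch C (n + 1) * poch (C - A - B) (n + 1)) := by
    field_simp
    linear_combination h
  rw [this]
  field_simp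
  linear_combination -t2 * e

/-! ### Polynomials in weighted spaces of square-integrable functions -/

/-- The measure has an exponential moment in `√|y|`; in particular all of its moments are finite. -/
def HasExpMoment (μ : Measure ℝ) : Prop :=
  Integrable (fun y => Real.exp (5 / 2 * √|y|)) μ

theorem HasExpMoment.integrable_exp {μ : Measure ℝ} (hμ : HasExpMoment μ) {δ : ℝ}
    (hδ : δ ≤ 5 / 2) : Integrable (fun y => Real.exp (δ * √|y|)) μ := by
  refine hμ.mono' (Continuous.aestronglyMeasurable (by fun_prop)) (ae_of_all _ fun y => ?_)
  rw [Real.norm_of_nonneg (Real.exp_pos _).le]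
  gcongr

theorem HasExpMoment.integrable_eval {μ : Measure ℝ} (hμ : HasExpMoment μ) (q : ℝ[X]) :
    Integrable (fun y => q.eval y) μ := by
  have h : ∀ n : ℕ, Integrable (fun y : ℝ => y ^ n) μ := fun n => by
    have := integrable_pow_mul_of_exp_mul (μ := μ) (h := fun _ => 1) (δ := 5 / 2) (by norm_num)
      (by simpa using (show Integrable (fun y => Real.exp (5 / 2 * √|y|)) μ from hμ)) n
    simpa using this
  simp only [eval_eq_sum_range]
  exact integrable_finsetSum _ fun i _ => (h i).const_mul _

theorem HasExpMoment.memLp_eval {μ : Measure ℝ} (hμ : HasExpMoment μ) (q : ℝ[X]) :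
    MemLp (fun y => q.eval y) 2 μ := by
  rw [memLp_two_iff_integrable_sq q.continuous.aestronglyMeasurable]
  refine (hμ.integrable_eval (q ^ 2)).congr (ae_of_all _ fun y => ?_)
  simp

theorem abs_eval_le (q : ℝ[X]) (y : ℝ) :
    |q.eval y| ≤ (∑ i ∈ Finset.range (q.natDegree + 1), |q.coeff i|) * (1 + |y|) ^ q.natDegree := by
  rw [eval_eq_sum_range, Finset.sum_mul]
  refine (Finset.abs_sum_le_sum_abs _ _).trans (Finset.sum_le_sum fun i hi => ?_)
  rw [abs_mul, abs_pow]
  gcongr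
  calc |y| ^ i ≤ (1 + |y|) ^ i := by gcongr; linarith
    _ ≤ _ := pow_le_pow_right₀ (by linarith [abs_nonneg y])
      (Nat.lt_succ_iff.1 (Finset.mem_range.1 hi))

theorem HasExpMoment.memLp_exp_mul_eval {μ : Measure ℝ} (hμ : HasExpMoment μ) (q : ℝ[X]) :
    MemLp (fun y => Real.exp (1 / 4 * √|y|) * q.eval y) 2 μ := by
  obtain ⟨M, hM, hM'⟩ := one_add_abs_pow_le_exp q.natDegree (show (0 : ℝ) < 1 / 4 by norm_num)
  set S := ∑ i ∈ Finset.range (q.natDegree + 1), |q.coeff i|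
  have hS : 0 ≤ S := Finset.sum_nonneg fun i _ => abs_nonneg _
  have h : MemLp (fun y => S * M * Real.exp (1 / 2 * √|y|)) 2 μ := by
    refine MemLp.const_mul ?_ (S * M)
    rw [memLp_two_iff_integrable_sq (Continuous.aestronglyMeasurable (by fun_prop))]
    refine (hμ.integrable_exp (δ := 1) (by norm_num)).congr (ae_of_all _ fun y => ?_)
    simp only [← Real.exp_nat_mul]
    congr 1
    push_cast
    ring
  refine h.of_le (Continuous.aestronglyMeasurable (by fun_prop)) (ae_of_all _ fun y => ?_)
  rw [norm_mul, Real.norm_of_nonneg (Real.exp_pos _).le, Real.norm_eq_abs (q.eval y),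
    Real.norm_of_nonneg (mul_nonneg (mul_nonneg hS hM) (Real.exp_pos _).le)]
  have e : Real.exp (1 / 2 * √|y|) = Real.exp (1 / 4 * √|y|) * Real.exp (1 / 4 * √|y|) := by
    rw [← Real.exp_add]
    congr 1
    ring
  calc _ ≤ Real.exp (1 / 4 * √|y|) * (S * (M * Real.exp (1 / 4 * √|y|))) := by
        gcongr
        exact (abs_eval_le q y).trans (mul_le_mul_of_nonneg_left (hM' y) hS)
    _ = _ := by rw [e]; ring

/-- A square-integrable function is zero if its product with a zero-free function of moderate
growth is orthogonal to all polynomials. -/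
theorem MomentDeterminate.eq_zero_of_orthogonal {𝕜 : Type*} [RCLike 𝕜] {μ : Measure ℝ}
    (hd : MomentDeterminate μ) (hμ : HasExpMoment μ) {w : ℝ → 𝕜} (hw : Continuous w)
    (hw0 : ∀ y, w y ≠ 0) {K : ℝ} (hwb : ∀ y, ‖w y‖ ≤ K * Real.exp (1 / 4 * √|y|)) {g : ℝ → 𝕜}
    (hg : MemLp g 2 μ) (h : ∀ n : ℕ, ∫ y, (y ^ n : ℝ) • (w y * g y) ∂μ = 0) : g =ᵐ[μ] 0 := by
  have h34 : MemLp (fun y => Real.exp (3 / 4 * √|y|)) 2 μ := by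
    rw [memLp_two_iff_integrable_sq (Continuous.aestronglyMeasurable (by fun_prop))]
    refine (hμ.integrable_exp (δ := 3 / 2) (by norm_num)).congr (ae_of_all _ fun y => ?_)
    simp only [← Real.exp_nat_mul]
    congr 1
    push_cast
    ring
  have hbig : Integrable (fun y => K * (Real.exp (3 / 4 * √|y|) * ‖g y‖)) μ :=
    (h34.integrable_mul hg.norm).const_mul K
  have hmeas : AEStronglyMeasurable (fun y => w y * g y) μ :=
    hw.aestronglyMeasurable.mul hg.aestronglyMeasurable
  have hbound : ∀ y, Real.exp (1 / 2 * √|y|) * ‖w y * g y‖ ≤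
      K * (Real.exp (3 / 4 * √|y|) * ‖g y‖) := by
    intro y
    have e : Real.exp (3 / 4 * √|y|) = Real.exp (1 / 2 * √|y|) * Real.exp (1 / 4 * √|y|) := by
      rw [← Real.exp_add]
      congr 1
      ring
    rw [norm_mul, e]
    calc _ ≤ Real.exp (1 / 2 * √|y|) * (K * Real.exp (1 / 4 * √|y|) * ‖g y‖) := by
          gcongr
          exact hwb y
      _ = _ := by ring
  have hre : ∀ f : 𝕜 →L[ℝ] ℝ, (∀ z, |f z| ≤ ‖z‖) → (fun y => f (w y * g y)) =ᵐ[μ] 0 := by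
    intro f hf
    have hi : Integrable (fun y => Real.exp (1 / 2 * √|y|) * f (w y * g y)) μ := by
      refine hbig.mono' ((Continuous.aestronglyMeasurable (by fun_prop)).mul
        (f.continuous.comp_aestronglyMeasurable hmeas)) (ae_of_all _ fun y => ?_)
      rw [norm_mul, Real.norm_of_nonneg (Real.exp_pos _).le]
      refine le_trans ?_ (hbound y)
      gcongr
      exact hf _
    refine hd _ (1 / 2) (by norm_num) hi fun n => ?_
    have hin : Integrable (fun y => (y ^ n : ℝ) • (w y * g y)) μ := by
      have hi' : Integrable (fun y => Real.exp (1 / 2 * √|y|) * ‖w y * g y‖) μ := by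
        refine hbig.mono' ((Continuous.aestronglyMeasurable (by fun_prop)).mul hmeas.norm)
          (ae_of_all _ fun y => ?_)
        rw [Real.norm_of_nonneg (by positivity)]
        exact hbound y
      refine (integrable_pow_mul_of_exp_mul (by norm_num) hi' n).mono
        ((Continuous.aestronglyMeasurable (by fun_prop)).smul hmeas) (ae_of_all _ fun y => ?_)
      simp [norm_smul]
    have := f.integral_comp_comm hin
    rw [h n, map_zero] at this
    rw [← this]
    refine integral_congr_ae (ae_of_all _ fun y => ?_)
    simp
  filter_upwards [hre RCLike.reCLM fun z => RCLike.abs_re_le_norm z,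
    hre RCLike.imCLM fun z => RCLike.abs_im_le_norm z] with y h1 h2
  have : w y * g y = 0 := RCLike.ext (by simpa using h1) (by simpa using h2)
  exact (mul_eq_zero.1 this).resolve_left (hw0 y)

/-- Polynomials that span `ℝ[X]`, multiplied by a zero-free function of moderate growth, span a dense
subspace. -/
theorem MomentDeterminate.orthogonal_span_eq_bot {𝕜 : Type*} [RCLike 𝕜] {μ : Measure ℝ}
    (hd : MomentDeterminate μ) (hμ : HasExpMoment μ) {w : ℝ → 𝕜} (hw : Continuous w)
    (hw0 : ∀ y, w y ≠ 0) {K : ℝ} (hwb : ∀ y, ‖w y‖ ≤ K * Real.exp (1 / 4 * √|y|)) {P : ℕ → ℝ[X]}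
    (hP : Submodule.span ℝ (Set.range P) = ⊤) {e : ℕ → Lp 𝕜 2 μ}
    (he : ∀ n, e n =ᵐ[μ] fun y => (P n).eval y • w y) : (Submodule.span 𝕜 (Set.range e))ᗮ = ⊥ := by
  refine eq_bot_iff.2 fun g hg => ?_
  set w' : ℝ → 𝕜 := fun y => (starRingEnd 𝕜) (w y)
  have hw' : Continuous w' := RCLike.continuous_conj.comp hw
  have hwb' : ∀ y, ‖w' y‖ ≤ K * Real.exp (1 / 4 * √|y|) := fun y => by
    simpa [w'] using hwb y
  have hgi : ∀ q : ℝ[X], Integrable (fun y => q.eval y • (w' y * g y)) μ := by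
    intro q
    have h1 : MemLp (fun y => q.eval y • w' y) 2 μ := by
      refine ((hμ.memLp_exp_mul_eval q).const_mul K).of_le
        (Continuous.aestronglyMeasurable (by fun_prop)) (ae_of_all _ fun y => ?_)
      have hK := (norm_nonneg _).trans (hwb' y)
      rw [norm_smul, ← mul_assoc, norm_mul, Real.norm_of_nonneg hK, mul_comm]
      exact mul_le_mul_of_nonneg_right (hwb' y) (norm_nonneg _)
    refine (h1.integrable_mul (Lp.memLp g)).congr (ae_of_all _ fun y => ?_)
    simp
  have hg0 : ∀ q : ℝ[X], ∫ y, q.eval y • (w' y * g y) ∂μ = 0 := by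
    intro q
    have hq : q ∈ Submodule.span ℝ (Set.range P) := by
      rw [hP]; trivial
    induction hq using Submodule.span_induction with
    | mem q hq =>
      obtain ⟨n, rfl⟩ := hq
      have := (Submodule.mem_orthogonal _ _).1 hg _ (Submodule.subset_span ⟨n, rfl⟩)
      rw [L2.inner_def] at this
      rw [← this]
      refine integral_congr_ae ?_
      filter_upwards [he n] with y h1
      rw [h1, RCLike.inner_apply, RCLike.real_smul_eq_coe_mul, RCLike.real_smul_eq_coe_mul, map_mul,
        RCLike.conj_ofReal]
      ring
    | zero => simp
    | add p q _ _ hp hq =>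
      simp only [eval_add, add_smul]
      rw [integral_add (hgi p) (hgi q), hp, hq, add_zero]
    | smul t q _ hq =>
      simp only [eval_smul, smul_assoc]
      rw [integral_smul, hq, smul_zero]
  have := hd.eq_zero_of_orthogonal hμ hw' (fun y => by simpa [w'] using hw0 y) hwb' (Lp.memLp g)
    fun n => by simpa using hg0 (X ^ n)
  exact (Submodule.mem_bot 𝕜).2 ((Lp.eq_zero_iff_ae_eq_zero).2 this)

/-! ### Orthogonality from a linear functional -/

theorem sum_poch_div_factorial (x : ℝ) (N : ℕ) :
    ∑ j ∈ Finset.range (N + 1), poch x j / (j.factorial : ℝ) =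
      poch (x + 1) N / (N.factorial : ℝ) := by
  induction N with
  | zero => simp [poch_zero]
  | succ N ih =>
    rw [Finset.sum_range_succ, ih, poch_succ_left x, poch_succ, Nat.factorial_succ]
    have p3 : (N.factorial : ℝ) ≠ 0 := by positivity
    have p5 : (N : ℝ) + 1 ≠ 0 := by positivity
    push_cast
    field_simp
    ring

/-- The products `∏_{l < j} ((a + l)² + y)` are the basis in which the polynomials are given, so the
value of the functional is the terminating series `∑ (-n)_j / j!`. -/
theorem map_hahnPoly {a b c : ℝ} (hab : 0 < a + b) (hac : 0 < a + c) (L : ℝ[X] →ₗ[ℝ] ℝ)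
    (hL : ∀ j : ℕ, L (∏ l ∈ Finset.range j, (C ((a + l) ^ 2) + X)) = poch (a + b) j * poch (a + c) j)
    (n : ℕ) : L (hahnPoly a b c n) = if n = 0 then 1 else 0 := by
  have key : L (hahnPoly a b c n) =
      (-1) ^ n / √(hahnNormSq a b c n) * (poch (a + b) n * poch (a + c) n) *
        (poch (-(n : ℝ) + 1) n / (n.factorial : ℝ)) := by
    rw [hahnPoly, ← smul_eq_C_mul, map_smul, smul_eq_mul, map_sum, ← sum_poch_div_factorial]
    congr 1
    refine Finset.sum_congr rfl fun j _ => ?_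
    rw [← smul_eq_C_mul, map_smul, smul_eq_mul, hL]
    have p1 := (poch_pos hab j).ne'
    have p2 := (poch_pos hac j).ne'
    field_simp
  rw [key]
  cases n with
  | zero => simp [poch_zero, hahnNormSq]
  | succ n =>
    have : poch (-((n + 1 : ℕ) : ℝ) + 1) (n + 1) = 0 := by
      have e : -((n + 1 : ℕ) : ℝ) + 1 = -(n : ℝ) := by push_cast; ring
      rw [e]
      exact poch_neg_nat_eq_zero (Nat.lt_succ_self n)
    rw [this]
    simp

theorem map_hahnPoly_mul {a b c : ℝ} (hab : 0 < a + b) (hac : 0 < a + c) (hbc : 0 < b + c)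
    (L : ℝ[X] →ₗ[ℝ] ℝ)
    (hL : ∀ j : ℕ, L (∏ l ∈ Finset.range j, (C ((a + l) ^ 2) + X)) = poch (a + b) j * poch (a + c) j)
    (n m : ℕ) : L (hahnPoly a b c n * hahnPoly a b c m) = if n = m then 1 else 0 :=
  functional_mul_eq (hahnPoly_zero a b c)
    (fun n => (Real.sqrt_pos.2 (hahnOffSq_pos hab hac hbc n)).ne') rfl (fun _ => rfl)
    (X_mul_hahnPoly hab hac hbc) L (map_hahnPoly hab hac L hL) m n

theorem span_hahnPoly {a b c : ℝ} (hab : 0 < a + b) (hac : 0 < a + c) (hbc : 0 < b + c) :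
    Submodule.span ℝ (Set.range (hahnPoly a b c)) = ⊤ := by
  set S := Submodule.span ℝ (Set.range (hahnPoly a b c)) with hS
  have hmem : ∀ n, hahnPoly a b c n ∈ S := fun n => Submodule.subset_span ⟨n, rfl⟩
  have hX : ∀ q ∈ S, X * q ∈ S := by
    intro q hq
    induction hq using Submodule.span_induction with
    | mem q hq =>
      obtain ⟨n, rfl⟩ := hq
      rw [X_mul_hahnPoly hab hac hbc]
      exact add_mem (add_mem (S.smul_mem _ (hmem _)) (S.smul_mem _ (hmem _)))
        (S.smul_mem _ (hmem _))
    | zero => simp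
    | add q r _ _ h1 h2 => rw [mul_add]; exact add_mem h1 h2
    | smul t q _ h => rw [mul_smul_comm]; exact S.smul_mem _ h
  have hXn : ∀ n : ℕ, (X ^ n : ℝ[X]) ∈ S := by
    intro n
    induction n with
    | zero => rw [pow_zero, ← hahnPoly_zero a b c]; exact hmem 0
    | succ n ih => rw [pow_succ']; exact hX _ ih
  refine eq_top_iff.2 fun q _ => ?_
  induction q using Polynomial.induction_on' with
  | add p q hp hq => exact add_mem (hp trivial) (hq trivial)
  | monomial n t =>
    rw [← C_mul_X_pow_eq_monomial, ← smul_eq_C_mul]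
    exact S.smul_mem _ (hXn n)

/-! ### A rank-one perturbation of an orthonormal system -/

/-- Let the Gram matrix of a total system be `1 + r v vᵀ`, where `v` are the inner products with a
vector `e` divided by `‖e‖²`, and let `‖v‖² ‖e‖² = 1`. Then the system is orthonormal. -/
theorem perturbation_eq_zero {H : Type*} [NormedAddCommGroup H] [InnerProductSpace ℝ H]
    {P : ℕ → H} {e : H} {v : ℕ → ℝ} {m r : ℝ} (hm : 0 < m)
    (hP : ∀ n k, inner ℝ (P n) (P k) = (if n = k then 1 else 0) + r * (v n * v k))
    (he : ∀ n, inner ℝ e (P n) = m * v n) (hee : inner ℝ e e = m)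
    (hv : HasSum (fun n => v n ^ 2) (1 / m))
    (hdense : e ∈ closure (Submodule.span ℝ (Set.range P) : Set H)) : r = 0 := by
  have gram : ∀ (s : Finset ℕ) (x : ℕ → ℝ), inner ℝ (∑ n ∈ s, x n • P n) (∑ n ∈ s, x n • P n) =
      ∑ n ∈ s, x n ^ 2 + r * (∑ n ∈ s, x n * v n) ^ 2 := by
    intro s x
    simp only [sum_inner, inner_sum, inner_smul_left, inner_smul_right, hP]
    simp only [mul_add, Finset.sum_add_distrib]
    congr 1
    · refine Finset.sum_congr rfl fun n hn => ?_
      simp [hn, sq]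
    · rw [sq (∑ n ∈ s, x n * v n), Finset.sum_mul_sum, Finset.mul_sum]
      refine Finset.sum_congr rfl fun n _ => ?_
      simp only [Finset.mul_sum]
      refine Finset.sum_congr rfl fun k _ => ?_
      simp
      ring
  have heval : ∀ (s : Finset ℕ) (x : ℕ → ℝ), inner ℝ e (∑ n ∈ s, x n • P n) =
      m * ∑ n ∈ s, x n * v n := by
    intro s x
    simp only [inner_sum, inner_smul_right, he, Finset.mul_sum]
    exact Finset.sum_congr rfl fun n _ => by ring
  refine le_antisymm ?_ ?_
  · have hcl : IsClosed {f : H | (m + r) * (inner ℝ e f) ^ 2 ≤ m ^ 2 * inner ℝ f f} :=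
      isClosed_le (by fun_prop) (by fun_prop)
    have hsub : (Submodule.span ℝ (Set.range P) : Set H) ⊆
        {f : H | (m + r) * (inner ℝ e f) ^ 2 ≤ m ^ 2 * inner ℝ f f} := by
      intro f hf
      obtain ⟨x, rfl⟩ := Finsupp.mem_span_range_iff_exists_finsupp.1 hf
      have hf' : (x.sum fun i t => t • P i) = ∑ n ∈ x.support, x n • P n := rfl
      rw [Set.mem_ofPred_eq, hf', gram, heval]
      have h1 := Finset.sum_mul_sq_le_sq_mul_sq x.support x v
      have h2 : ∑ n ∈ x.support, v n ^ 2 ≤ 1 / m :=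
        sum_le_hasSum _ (fun n _ => sq_nonneg _) hv
      have h3 : 0 ≤ ∑ n ∈ x.support, x n ^ 2 := Finset.sum_nonneg fun n _ => sq_nonneg _
      have h4 : m * (∑ n ∈ x.support, x n * v n) ^ 2 ≤ ∑ n ∈ x.support, x n ^ 2 := by
        have h5 := mul_le_mul_of_nonneg_left h2 h3
        have h6 := mul_le_mul_of_nonneg_left (h1.trans h5) hm.le
        calc _ ≤ _ := h6
          _ = _ := by field_simp
      have h7 := mul_le_mul_of_nonneg_left h4 (sq_nonneg m)
      nlinarith
    have := closure_minimal hsub hcl hdense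
    simp only [Set.mem_ofPred_eq, hee] at this
    have h8 : r * m ^ 2 ≤ 0 := by nlinarith
    by_contra hr
    have : 0 < r * m ^ 2 := mul_pos (not_le.1 hr) (by positivity)
    linarith
  · set s : ℕ → ℝ := fun N => ∑ n ∈ Finset.range N, v n ^ 2
    have hs : Tendsto s atTop (𝓝 (1 / m)) := hv.tendsto_sum_nat
    have hle : ∀ N, m * s N ^ 2 ≤ s N + r * s N ^ 2 := by
      intro N
      have h1 := real_inner_mul_inner_self_le e (∑ n ∈ Finset.range N, v n • P n)
      rw [gram, heval, hee] at h1
      have e1 : ∑ n ∈ Finset.range N, v n * v n = s N :=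
        Finset.sum_congr rfl fun n _ => (sq _).symm
      rw [e1] at h1
      refine le_of_mul_le_mul_left ?_ hm
      calc _ = m * s N * (m * s N) := by ring
        _ ≤ _ := h1
    have hlim := le_of_tendsto_of_tendsto' ((hs.pow 2).const_mul m)
      (hs.add ((hs.pow 2).const_mul r)) hle
    have e2 : m * (1 / m) ^ 2 = 1 / m := by field_simp
    rw [e2] at hlim
    have h9 : 0 ≤ r * (1 / m) ^ 2 := by linarith
    by_contra hr
    have : r * (1 / m) ^ 2 < 0 := mul_neg_of_neg_of_pos (not_le.1 hr) (by positivity)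
    linarith

/-! ### Total mass of the orthogonality measure -/

theorem hasExpMoment_dualHahnMeasureAux (a : ℝ) {b c : ℝ} (hb : 0 < b) (hc : 0 < c) :
    HasExpMoment (dualHahnMeasureAux a b c) := integrable_exp_dualHahnMeasureAux a hb hc

/-- Integration of polynomials against the orthogonality measure. -/
noncomputable def integralFunctional {μ : Measure ℝ} (hμ : HasExpMoment μ) : ℝ[X] →ₗ[ℝ] ℝ where
  toFun q := ∫ y, q.eval y ∂μ
  map_add' p q := by
    simp only [eval_add]
    exact integral_add (hμ.integrable_eval p) (hμ.integrable_eval q)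
  map_smul' t q := by
    simp only [eval_smul, smul_eq_mul, RingHom.id_apply]
    exact integral_const_mul t _

theorem integral_prod_dualHahnMeasureAux {a b c : ℝ} (hab : 0 < a + b) (hac : 0 < a + c)
    (hbc : 0 < b + c) (j : ℕ) :
    ∫ y, ∏ l ∈ Finset.range j, ((a + l) ^ 2 + y) ∂dualHahnMeasureAux a b c =
      poch (a + b) j * poch (a + c) j * (dualHahnMeasureAux (a + j) b c).real Set.univ := by
  induction j generalizing a with
  | zero => simp [poch_zero]
  | succ j ih =>
    have h := integral_dualHahnMeasureAux_mul hab hac hbc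
      (fun y => ∏ l ∈ Finset.range j, ((a + 1 + l) ^ 2 + y))
    rw [ih (a := a + 1) (by linarith) (by linarith)] at h
    have e : ∀ y : ℝ, ∏ l ∈ Finset.range (j + 1), ((a + l) ^ 2 + y) =
        (y + a ^ 2) * ∏ l ∈ Finset.range j, ((a + 1 + l) ^ 2 + y) := by
      intro y
      rw [Finset.prod_range_succ', mul_comm]
      congr 1
      · push_cast; ring
      · refine Finset.prod_congr rfl fun l _ => ?_
        push_cast; ring
    simp only [e]
    rw [h, poch_succ_left, poch_succ_left, show a + b + 1 = a + 1 + b by ring,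
      show a + c + 1 = a + 1 + c by ring, show a + (j + 1 : ℕ) = a + 1 + j by push_cast; ring]
    ring

theorem tendsto_norm_Gamma {x : ℝ} (hx : x ≠ 0) :
    Tendsto (fun t : ℝ => ‖Complex.Gamma (t + Complex.I * x)‖) (𝓝 0)
      (𝓝 ‖Complex.Gamma ((0 : ℝ) + Complex.I * x)‖) := by
  have hd : DifferentiableAt ℂ Complex.Gamma ((0 : ℝ) + Complex.I * x) := by
    refine Complex.differentiableAt_Gamma _ fun m h => hx ?_
    have := congrArg Complex.im h
    simpa using this
  have hc : Continuous fun t : ℝ => (t : ℂ) + Complex.I * x := by fun_prop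
  exact (Tendsto.comp (f := fun t : ℝ => (t : ℂ) + Complex.I * x) hd.continuousAt
    (hc.tendsto 0)).norm

/-- The kernels with first parameter in `(0, 1]` are dominated by one with first parameter `0`. -/
theorem hahnKernel_le_hahnKernel_zero {a : ℝ} (ha : 0 < a) (ha1 : a ≤ 1) (b c : ℝ) {x : ℝ}
    (hx : x ≠ 0) : hahnKernel a b c x ≤ (1 + x ^ 2) * hahnKernel 0 b c x := by
  have h1 := norm_Gamma_mul_Gamma_le (show 0 < a + 1 by linarith) (show a + 1 ≤ 2 by linarith) x
  have hG : Real.Gamma (a + 1) ≤ 1 := by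
    have hc := Real.convexOn_Gamma.2 (show (1 : ℝ) ∈ Set.Ioi 0 by simp)
      (show (2 : ℝ) ∈ Set.Ioi 0 by simp) (show 0 ≤ 1 - a by linarith) ha.le (by ring)
    rw [Real.Gamma_one, Real.Gamma_two] at hc
    simp only [smul_eq_mul] at hc
    rw [show (1 - a) * 1 + a * 2 = a + 1 by ring] at hc
    linarith
  rw [Real.Gamma_two, mul_one] at h1
  have h2 : ‖Complex.Gamma ((a + 1 : ℝ) + Complex.I * x)‖ ≤
      ‖Complex.Gamma ((2 : ℝ) + Complex.I * x)‖ := by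
    refine h1.trans ?_
    exact mul_le_of_le_one_right (norm_nonneg _) hG
  have h3 := pow_le_pow_left₀ (norm_nonneg _) h2 2
  have e1 := norm_Gamma_add_one_sq a x (Or.inr hx)
  have e2 := norm_Gamma_add_one_sq 1 x (Or.inr hx)
  have e3 := norm_Gamma_add_one_sq 0 x (Or.inr hx)
  rw [show (1 + 1 : ℝ) = 2 by norm_num] at e2
  rw [zero_add] at e3
  rw [e1, e2, e3] at h3
  have hx2 : 0 < x ^ 2 := by positivity
  have h4 : ‖Complex.Gamma (a + Complex.I * x)‖ ^ 2 ≤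
      (1 + x ^ 2) * ‖Complex.Gamma ((0 : ℝ) + Complex.I * x)‖ ^ 2 := by
    have h5 : 0 ≤ a ^ 2 * ‖Complex.Gamma (a + Complex.I * x)‖ ^ 2 := by positivity
    refine le_of_mul_le_mul_left ?_ hx2
    nlinarith
  unfold hahnKernel
  have h6 := mul_sinh_nonneg x
  have := mul_le_mul_of_nonneg_right h4 (show 0 ≤ ‖Complex.Gamma (b + Complex.I * x)‖ ^ 2 *
    ‖Complex.Gamma (c + Complex.I * x)‖ ^ 2 * (x * Real.sinh (2 * Real.pi * x)) by positivity)
  calc _ = _ := by ring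
    _ ≤ _ := this
    _ = _ := by ring

theorem hahnIntegral_zero_eq {b c : ℝ} (hb : 0 < b) (hc : 0 < c) :
    hahnIntegral 0 b c =
      Real.pi ^ 2 * (Real.Gamma (0 + b) * Real.Gamma (0 + c) * Real.Gamma (b + c)) := by
  have hpos : ∀ n : ℕ, (0 : ℝ) < 1 / (n + 1) := fun n => by positivity
  have hle1 : ∀ n : ℕ, 1 / ((n : ℝ) + 1) ≤ 1 := fun n => by
    rw [div_le_one (by positivity)]
    linarith [n.cast_nonneg (α := ℝ)]
  have hlim : Tendsto (fun n : ℕ => 1 / ((n : ℝ) + 1)) atTop (𝓝 0) :=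
    tendsto_one_div_add_atTop_nhds_zero_nat
  have hΓ : ∀ t : ℝ, 0 < t → Tendsto (fun n : ℕ => Real.Gamma (1 / ((n : ℝ) + 1) + t)) atTop
      (𝓝 (Real.Gamma (0 + t))) := by
    intro t ht
    have hd : ContinuousAt Real.Gamma (0 + t) :=
      (Real.differentiableAt_Gamma fun m => by
        have := m.cast_nonneg (α := ℝ); linarith).continuousAt
    exact hd.tendsto.comp (hlim.add_const t)
  have l1 : Tendsto (fun n : ℕ => hahnIntegral (1 / ((n : ℝ) + 1)) b c) atTop
      (𝓝 (Real.pi ^ 2 * (Real.Gamma (0 + b) * Real.Gamma (0 + c) * Real.Gamma (b + c)))) := by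
    refine ((((hΓ b hb).mul (hΓ c hc)).mul_const _).const_mul _).congr fun n => ?_
    rw [hahnIntegral_eq (hpos n) hb hc]
  refine tendsto_nhds_unique ?_ l1
  obtain ⟨K, hK, hK'⟩ := hahnKernel_le_exp 0 hb hc
  obtain ⟨M, hM, hM'⟩ := one_add_sq_pow_le_exp 1 (show (0 : ℝ) < 1 by norm_num)
  refine tendsto_integral_of_dominated_convergence (fun x => M * K * Real.exp (-2 * |x|))
    (fun n => (continuous_hahnKernel (hpos n) hb hc).aestronglyMeasurable)
    ((integrable_exp_neg_mul_abs two_pos).const_mul _).integrableOn ?_ ?_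
  · intro n
    refine (ae_restrict_iff' measurableSet_Ioi).2 (ae_of_all _ fun x hx => ?_)
    rw [Real.norm_of_nonneg (hahnKernel_nonneg _ _ _ _)]
    refine (hahnKernel_le_hahnKernel_zero (hpos n) (hle1 n) b c (ne_of_gt hx)).trans ?_
    have h1 := hM' x
    rw [pow_one] at h1
    calc _ ≤ (M * Real.exp (1 * |x|)) * (K * Real.exp (-3 * |x|)) :=
          mul_le_mul h1 (hK' x) (hahnKernel_nonneg _ _ _ _) (by positivity)
      _ = M * K * (Real.exp (1 * |x|) * Real.exp (-3 * |x|)) := by ring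
      _ = _ := by
          rw [← Real.exp_add]
          congr 2
          ring
  · refine (ae_restrict_iff' measurableSet_Ioi).2 (ae_of_all _ fun x hx => ?_)
    have := (tendsto_norm_Gamma (ne_of_gt hx : x ≠ 0)).comp hlim
    exact (((this.pow 2).mul_const _).mul_const _).mul_const _

/-- For `a ≥ 0` there are no point masses, and the case `a = 0` is a limit of the case `a > 0`. -/
theorem dualHahnMeasureAux_univ_of_nonneg {a b c : ℝ} (ha : 0 ≤ a) (hb : 0 < b) (hc : 0 < c) :
    dualHahnMeasureAux a b c Set.univ = 1 := by
  have h := lintegral_dualHahnMeasureAux a b c (f := 1) measurable_one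
  have g1 := Real.Gamma_pos_of_pos (add_pos_of_nonneg_of_pos ha hb)
  have g2 := Real.Gamma_pos_of_pos (add_pos_of_nonneg_of_pos ha hc)
  have g3 := Real.Gamma_pos_of_pos (add_pos hb hc)
  have hI : hahnIntegral a b c =
      Real.pi ^ 2 * (Real.Gamma (a + b) * Real.Gamma (a + c) * Real.Gamma (b + c)) := by
    rcases ha.eq_or_lt with rfl | ha
    · exact hahnIntegral_zero_eq hb hc
    · exact hahnIntegral_eq ha hb hc
  have hi : IntegrableOn (hahnKernel a b c) (Set.Ioi 0) := by
    obtain ⟨K, hK, hK'⟩ := hahnKernel_le_exp a hb hc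
    refine ((integrable_exp_neg_mul_abs three_pos).const_mul K).integrableOn.mono'
      ((continuousOn_hahnKernel a b c).aestronglyMeasurable measurableSet_Ioi)
      (ae_of_all _ fun x => ?_)
    rw [Real.norm_of_nonneg (hahnKernel_nonneg a b c x)]
    exact hK' x
  rw [Nat.ceil_eq_zero.2 (by linarith)] at h
  simp only [Pi.one_apply, lintegral_one, mul_one, Finset.range_zero, Finset.sum_empty,
    add_zero] at h
  rw [h, ← ofReal_integral_eq_lintegral_ofReal]
  · have : ∫ x in Set.Ioi 0, dualHahnWeight a b c x = 1 := by
      simp only [dualHahnWeight_eq]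
      rw [integral_div]
      change hahnIntegral a b c / _ = 1
      rw [hI, div_self]
      positivity
    simp [this]
  · have : dualHahnWeight a b c = fun x => hahnKernel a b c x /
        (Real.pi ^ 2 * (Real.Gamma (a + b) * Real.Gamma (a + c) * Real.Gamma (b + c))) :=
      funext fun x => dualHahnWeight_eq a b c x
    rw [this]
    exact hi.div_const _
  · exact ae_of_all _ fun x => dualHahnWeight_nonneg (by linarith) (by linarith) (by linarith) x

theorem dualHahn_neg_sq (a b c : ℝ) (n : ℕ) :
    dualHahn a b c n (-a ^ 2) = poch (a + b) n * poch (a + c) n := by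
  rw [dualHahn, Finset.sum_eq_single 0]
  · simp [poch_zero]
  · intro j _ hj
    rw [Finset.prod_eq_zero (i := 0) (by simpa using Nat.pos_of_ne_zero hj) (by simp)]
    simp
  · simp

theorem dualHahnON_neg_sq_sq {a b c : ℝ} (hab : 0 < a + b) (hac : 0 < a + c) (hbc : 0 < b + c)
    (n : ℕ) : dualHahnON a b c n (-a ^ 2) ^ 2 = gaussTerm (a + b) (a + c) (b + c) n := by
  have h := hahnNormSq_pos hab hac hbc n
  rw [dualHahnON_eq, dualHahn_neg_sq, div_pow, Real.sq_sqrt h.le, mul_pow, ← pow_mul,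
    mul_comm n 2, pow_mul]
  simp only [even_two, Even.neg_pow, one_pow, one_mul, gaussTerm, hahnNormSq]
  have p1 := (poch_pos hab n).ne'
  have p2 := (poch_pos hac n).ne'
  have p3 := (poch_pos hbc n).ne'
  have p4 : (n.factorial : ℝ) ≠ 0 := by positivity
  field_simp

theorem hasSum_dualHahnON_neg_sq_sq {a b c : ℝ} (ha : a < 0) (hab : 0 < a + b) (hac : 0 < a + c) :
    HasSum (fun n => dualHahnON a b c n (-a ^ 2) ^ 2) (1 / dualHahnMass a b c 0) := by
  have hbc : 0 < b + c := by linarith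
  simp only [dualHahnON_neg_sq_sq hab hac hbc]
  have h := (summable_gaussTerm hab hac (show a + b + (a + c) < b + c by linarith)).hasSum
  rw [tsum_gaussTerm hab hac (by linarith)] at h
  convert h using 1
  rw [dualHahnMass_zero, one_div_div]
  congr 1
  · rw [mul_comm]
    congr 2
    ring
  · rw [mul_comm]
    congr 2 <;> ring

/-- The total mass does not follow from the relation between the parameters `a` and `a + 1`, as this
leaves the mass at `-a²` undetermined. For `a < 0` this mass is the reciprocal of the sum of
the squares of the orthonormal polynomials at `-a²`, which Gauss's formula evaluates. -/
theorem dualHahnMeasureAux_univ_of_add_nat {a b c : ℝ} (ha : a < 0) (hab : 0 < a + b)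
    (hac : 0 < a + c) (h : ∀ j : ℕ, dualHahnMeasureAux (a + (j + 1 : ℕ)) b c Set.univ = 1) :
    dualHahnMeasureAux a b c Set.univ = 1 := by
  have hb : 0 < b := by linarith
  have hc : 0 < c := by linarith
  have hbc : 0 < b + c := by linarith
  set μ := dualHahnMeasureAux a b c with hμdef
  have hμ : HasExpMoment μ := hasExpMoment_dualHahnMeasureAux a hb hc
  have hfin : IsFiniteMeasure μ := isFiniteMeasure_dualHahnMeasureAux a hb hc
  have hd : MomentDeterminate μ := momentDeterminate_dualHahnMeasureAux hab hac
  set r := μ.real Set.univ - 1 with hr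
  set m := dualHahnMass a b c 0 with hmdef
  have hm : 0 < m := dualHahnMass_zero_pos ha hab hac
  have hsing : μ.real {-a ^ 2} = m := by
    rw [Measure.real, hμdef, dualHahnMeasureAux_singleton ha, ENNReal.toReal_ofReal hm.le]
  -- moving the excess mass `r` away from `-a²` gives the expected moments
  let L : ℝ[X] →ₗ[ℝ] ℝ := integralFunctional hμ - r • (Polynomial.leval (-a ^ 2))
  have hLapp : ∀ q : ℝ[X], L q = ∫ y, q.eval y ∂μ - r * q.eval (-a ^ 2) := fun q => rfl
  have hL : ∀ j : ℕ, L (∏ l ∈ Finset.range j, (C ((a + l) ^ 2) + X)) =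
      poch (a + b) j * poch (a + c) j := by
    intro j
    rw [hLapp]
    simp only [eval_prod, eval_add, eval_C, eval_X]
    rw [integral_prod_dualHahnMeasureAux hab hac hbc]
    cases j with
    | zero => simp [poch_zero, hr, hμdef]
    | succ j =>
      rw [Measure.real, h j, Finset.prod_eq_zero (i := 0) (by simp) (by simp)]
      simp
  have hint : ∀ n k, ∫ y, dualHahnON a b c n y * dualHahnON a b c k y ∂μ =
      (if n = k then 1 else 0) +
        r * (dualHahnON a b c n (-a ^ 2) * dualHahnON a b c k (-a ^ 2)) := by
    intro n k
    have := map_hahnPoly_mul hab hac hbc L hL n k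
    rw [hLapp] at this
    simp only [eval_mul, eval_hahnPoly] at this
    linarith
  have hmem : ∀ n, MemLp (dualHahnON a b c n) 2 μ := fun n => by
    have := hμ.memLp_eval (hahnPoly a b c n)
    simpa only [eval_hahnPoly] using this
  have hr0 : r = 0 := by
    refine perturbation_eq_zero (P := fun n => (hmem n).toLp)
      (e := indicatorConstLp 2 (measurableSet_singleton (-a ^ 2)) (measure_ne_top μ _) (1 : ℝ))
      (v := fun n => dualHahnON a b c n (-a ^ 2)) hm ?_ ?_ ?_
      (hasSum_dualHahnON_neg_sq_sq ha hab hac) ?_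
    · intro n k
      rw [← hint, L2.inner_def]
      refine integral_congr_ae ?_
      filter_upwards [(hmem n).coeFn_toLp, (hmem k).coeFn_toLp] with y h1 h2
      rw [h1, h2]
      simp [mul_comm]
    · intro n
      rw [L2.inner_indicatorConstLp_one,
        integral_congr_ae (ae_restrict_of_ae (hmem n).coeFn_toLp), integral_singleton, hsing,
        smul_eq_mul]
    · rw [L2.inner_indicatorConstLp_one, integral_congr_ae
        (ae_restrict_of_ae indicatorConstLp_coeFn), integral_singleton, hsing]
      simp
    · have htop : (Submodule.span ℝ (Set.range fun n => (hmem n).toLp)).topologicalClosure = ⊤ := by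
        rw [Submodule.topologicalClosure_eq_top_iff]
        refine hd.orthogonal_span_eq_bot hμ (w := fun _ => (1 : ℝ)) continuous_const (by simp)
          (K := 1) (fun y => by simp) (span_hahnPoly hab hac hbc) fun n => ?_
        filter_upwards [(hmem n).coeFn_toLp] with y hy
        rw [hy, eval_hahnPoly, smul_eq_mul, mul_one]
      have := congrArg (fun S : Submodule ℝ (Lp ℝ 2 μ) => (S : Set (Lp ℝ 2 μ))) htop
      simp only [Submodule.topologicalClosure_coe, Submodule.top_coe] at this
      rw [this]
      trivial
  have h1 : μ.real Set.univ = 1 := by linarith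
  rw [← ENNReal.toReal_eq_one_iff]
  exact h1

/-- The orthogonality measure is a probability measure. -/
theorem dualHahnMeasureAux_univ {a b c : ℝ} (hb : 0 < b) (hc : 0 < c) (hab : 0 < a + b)
    (hac : 0 < a + c) : dualHahnMeasureAux a b c Set.univ = 1 := by
  obtain ⟨n, hn⟩ := exists_nat_gt (-a)
  induction n generalizing a with
  | zero => exact dualHahnMeasureAux_univ_of_nonneg (by simp at hn; linarith) hb hc
  | succ n ih =>
    rcases le_or_gt 0 a with ha | ha
    · exact dualHahnMeasureAux_univ_of_nonneg ha hb hc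
    · refine dualHahnMeasureAux_univ_of_add_nat ha hab hac fun j => ?_
      have := j.cast_nonneg (α := ℝ)
      push_cast at hn ⊢
      exact ih (by linarith) (by linarith) (by linarith)

theorem integral_dualHahnON_mul_aux {a b c : ℝ} (hb : 0 < b) (hc : 0 < c) (hab : 0 < a + b)
    (hac : 0 < a + c) (n m : ℕ) :
    ∫ y, dualHahnON a b c n y * dualHahnON a b c m y ∂dualHahnMeasureAux a b c =
      if n = m then 1 else 0 := by
  have hbc : 0 < b + c := add_pos hb hc
  have h := map_hahnPoly_mul hab hac hbc
    (integralFunctional (hasExpMoment_dualHahnMeasureAux a hb hc)) (fun j => by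
      change ∫ y, _ ∂_ = _
      simp only [eval_prod, eval_add, eval_C, eval_X]
      have := j.cast_nonneg (α := ℝ)
      rw [integral_prod_dualHahnMeasureAux hab hac hbc, Measure.real,
        dualHahnMeasureAux_univ hb hc (by linarith) (by linarith)]
      simp) n m
  rw [← h]
  change _ = ∫ y, _ ∂_
  simp only [eval_mul, eval_hahnPoly]

/-- The measure with the smallest parameter in front has the same orthonormal polynomials, as these
are symmetric in the parameters. -/
theorem dualHahnMeasure_cases {a b c : ℝ} (hab : 0 < a + b) (hac : 0 < a + c) (hbc : 0 < b + c) :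
    ∃ a' b' c' : ℝ, 0 < b' ∧ 0 < c' ∧ 0 < a' + b' ∧ 0 < a' + c' ∧
      dualHahnMeasure a b c = dualHahnMeasureAux a' b' c' ∧
      ∀ n y, dualHahnON a b c n y = dualHahnON a' b' c' n y := by
  unfold dualHahnMeasure
  split_ifs with h1 h2
  · exact ⟨a, b, c, by linarith [h1.1], by linarith [h1.2], hab, hac, rfl, fun _ _ => rfl⟩
  · have h3 : b < a := by
      by_contra h
      exact h1 ⟨by linarith, by linarith⟩
    exact ⟨b, a, c, by linarith, by linarith, by linarith, hbc, rfl,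
      fun n y => dualHahnON_swap hab hac hbc n y⟩
  · have h3 : c < a := by
      by_contra h
      exact h1 ⟨by linarith, by linarith⟩
    refine ⟨c, a, b, by linarith, by linarith, by linarith, by linarith, rfl, fun n y => ?_⟩
    rw [dualHahnON_swap' hab hac, dualHahnON_swap hac hab (by linarith)]

theorem hasExpMoment_dualHahnMeasure {a b c : ℝ} (hab : 0 < a + b) (hac : 0 < a + c)
    (hbc : 0 < b + c) : HasExpMoment (dualHahnMeasure a b c) := by
  obtain ⟨a', b', c', h1, h2, h3, h4, h5, -⟩ := dualHahnMeasure_cases hab hac hbc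
  rw [h5]
  exact hasExpMoment_dualHahnMeasureAux a' h1 h2

theorem momentDeterminate_dualHahnMeasure {a b c : ℝ} (hab : 0 < a + b) (hac : 0 < a + c)
    (hbc : 0 < b + c) : MomentDeterminate (dualHahnMeasure a b c) := by
  obtain ⟨a', b', c', h1, h2, h3, h4, h5, -⟩ := dualHahnMeasure_cases hab hac hbc
  rw [h5]
  exact momentDeterminate_dualHahnMeasureAux h3 h4

theorem integral_dualHahnON_mul {a b c : ℝ} (hab : 0 < a + b) (hac : 0 < a + c)
    (hbc : 0 < b + c) (n m : ℕ) :
    ∫ y, dualHahnON a b c n y * dualHahnON a b c m y ∂dualHahnMeasure a b c =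
      if n = m then 1 else 0 := by
  obtain ⟨a', b', c', h1, h2, h3, h4, h5, h6⟩ := dualHahnMeasure_cases hab hac hbc
  simp only [h5, h6]
  exact integral_dualHahnON_mul_aux h1 h2 h3 h4 n m

/-! ### The Casimir operator as a Jacobi operator -/

theorem tensorCasimir_tmul {k₁ k₂ : ℝ} (hk₁ : 0 < k₁) (hk₂ : 0 < k₂) (i j : ℕ) :
    tensorCasimir k₁ k₂ (Finsupp.single i 1 ⊗ₜ[ℂ] Finsupp.single j 1) =
      (((i + 1) * (2 * k₁ + i) + j * (2 * k₂ + j - 1) - (k₁ + i - k₂ - j) ^ 2 -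
          (k₁ + i - k₂ - j) : ℝ) : ℂ) • (Finsupp.single i 1 ⊗ₜ[ℂ] Finsupp.single j 1) -
        ((√((i + 1) * (2 * k₁ + i)) * √((j + 1) * (2 * k₂ + j)) : ℝ) : ℂ) •
          (Finsupp.single (i + 1) 1 ⊗ₜ[ℂ] Finsupp.single (j + 1) 1) -
        ((√(i * (2 * k₁ + i - 1)) * √(j * (2 * k₂ + j - 1)) : ℝ) : ℂ) •
          (Finsupp.single (i - 1) 1 ⊗ₜ[ℂ] Finsupp.single (j - 1) 1) := by
  obtain ⟨E, hE⟩ : ∃ E : ℕ → ℕ → Fin0 ⊗[ℂ] Fin0, ∀ (i j : ℕ) (x y : ℂ),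
      (Finsupp.single i x ⊗ₜ[ℂ] Finsupp.single j y : Fin0 ⊗[ℂ] Fin0) = (x * y) • E i j := by
    refine ⟨fun i j => Finsupp.single i 1 ⊗ₜ[ℂ] Finsupp.single j 1, fun i j x y => ?_⟩
    have h1 : (Finsupp.single i x : Fin0) = x • Finsupp.single i 1 := by simp
    have h2 : (Finsupp.single j y : Fin0) = y • Finsupp.single j 1 := by simp
    rw [h1, h2, TensorProduct.smul_tmul_smul]
  have s1 : ((√((i + 1) * (2 * k₁ + i)) : ℝ) : ℂ) * ((√((i + 1) * (2 * k₁ + i)) : ℝ) : ℂ) =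
      (((i + 1) * (2 * k₁ + i) : ℝ) : ℂ) := by
    rw [← Complex.ofReal_mul, Real.mul_self_sqrt (by positivity)]
  have s2 : ((√(j * (2 * k₂ + j - 1)) : ℝ) : ℂ) * ((√(j * (2 * k₂ + j - 1)) : ℝ) : ℂ) =
      ((j * (2 * k₂ + j - 1) : ℝ) : ℂ) := by
    rw [← Complex.ofReal_mul, Real.mul_self_sqrt]
    cases j with
    | zero => simp
    | succ j =>
      push_cast
      have : 2 * k₂ + ((j : ℝ) + 1) - 1 = 2 * k₂ + j := by ring
      rw [this]
      positivity
  have hα : (((i + 1) * (2 * k₁ + i) + j * (2 * k₂ + j - 1) - (k₁ + i - k₂ - j) ^ 2 -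
      (k₁ + i - k₂ - j) : ℝ) : ℂ) =
      ((√((i + 1) * (2 * k₁ + i)) : ℝ) : ℂ) * ((√((i + 1) * (2 * k₁ + i)) : ℝ) : ℂ) +
      ((√(j * (2 * k₂ + j - 1)) : ℝ) : ℂ) * ((√(j * (2 * k₂ + j - 1)) : ℝ) : ℂ) -
      ((k₁ : ℂ) + i - k₂ - j) ^ 2 - ((k₁ : ℂ) + i - k₂ - j) := by
    rw [s1, s2]
    push_cast
    ring
  rw [hα]
  clear hα s1 s2
  simp only [tensorCasimir, casimir, comul, posH, posB, posC, negH, negB, negC,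
    LinearMap.smul_apply, LinearMap.add_apply, Module.End.mul_apply, TensorProduct.map_tmul,
    LinearMap.id_apply, Finsupp.linearCombination_single, one_smul, map_add, Finsupp.smul_single,
    smul_eq_mul]
  simp only [hE, Nat.add_sub_cancel]
  cases j with
  | zero =>
    push_cast
    simp only [zero_mul, Real.sqrt_zero, Complex.ofReal_zero, neg_zero, mul_zero, zero_add,
      zero_smul, add_zero, mul_one, one_mul, sub_zero,
      show 2 * k₁ + ((i : ℝ) + 1) - 1 = 2 * k₁ + i by ring]
    module
  | succ j =>
    simp only [Nat.add_sub_cancel]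
    push_cast
    simp only [show 2 * k₁ + ((i : ℝ) + 1) - 1 = 2 * k₁ + i by ring,
      show 2 * k₂ + ((j : ℝ) + 1) - 1 = 2 * k₂ + j by ring]
    module

/-- The relation between `k₁`, `k₂`, `p` and the parameters of the orthogonal polynomials. -/
def IsHahnParam (k₁ k₂ : ℝ) (p : ℤ) (a b c : ℝ) : Prop :=
  b = k₁ + k₂ - 1 / 2 ∧ ((p ≤ 0 ∧ a = k₁ - k₂ + 1 / 2 ∧ c = k₂ - k₁ - p + 1 / 2) ∨
    (0 ≤ p ∧ a = k₂ - k₁ + 1 / 2 ∧ c = k₁ - k₂ + p + 1 / 2))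

theorem IsHahnParam.pos {k₁ k₂ : ℝ} (hk₁ : 0 < k₁) (hk₂ : 0 < k₂) {p : ℤ} {a b c : ℝ}
    (h : IsHahnParam k₁ k₂ p a b c) : 0 < a + b ∧ 0 < a + c ∧ 0 < b + c := by
  obtain ⟨rfl, ⟨hp, rfl, rfl⟩ | ⟨hp, rfl, rfl⟩⟩ := h
  · have : (p : ℝ) ≤ 0 := by exact_mod_cast hp
    refine ⟨?_, ?_, ?_⟩ <;> linarith
  · have : (0 : ℝ) ≤ p := by exact_mod_cast hp
    refine ⟨?_, ?_, ?_⟩ <;> linarith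

theorem IsHahnParam.cast_toNat {k₁ k₂ : ℝ} {p : ℤ} {a b c : ℝ} (h : IsHahnParam k₁ k₂ p a b c) :
    (a = k₁ - k₂ + 1 / 2 ∧ c = k₂ - k₁ - p + 1 / 2 ∧
      (p.toNat : ℝ) = 0 ∧ ((-p).toNat : ℝ) = -p) ∨
    (a = k₂ - k₁ + 1 / 2 ∧ c = k₁ - k₂ + p + 1 / 2 ∧
      (p.toNat : ℝ) = p ∧ ((-p).toNat : ℝ) = 0) := by
  have cast : ∀ q : ℤ, 0 ≤ q → (q.toNat : ℝ) = q := fun q hq => by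
    exact_mod_cast congrArg (Int.cast : ℤ → ℝ) (Int.toNat_of_nonneg hq)
  obtain ⟨-, ⟨hp, ha, hc⟩ | ⟨hp, ha, hc⟩⟩ := h
  · refine Or.inl ⟨ha, hc, by simp [Int.toNat_of_nonpos hp], ?_⟩
    rw [cast _ (neg_nonneg.2 hp), Int.cast_neg]
  · exact Or.inr ⟨ha, hc, cast p hp, by simp [Int.toNat_of_nonpos (neg_nonpos.2 hp)]⟩

theorem IsHahnParam.offSq {k₁ k₂ : ℝ} {p : ℤ} {a b c : ℝ} (h : IsHahnParam k₁ k₂ p a b c) (n : ℕ) :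
    hahnOffSq a b c n = ((n + p.toNat : ℕ) + 1) * (2 * k₁ + (n + p.toNat : ℕ)) *
      (((n + (-p).toNat : ℕ) + 1) * (2 * k₂ + (n + (-p).toNat : ℕ))) := by
  have hb := h.1
  push_cast
  rcases h.cast_toNat with ⟨rfl, rfl, h1, h2⟩ | ⟨rfl, rfl, h1, h2⟩ <;>
  · rw [h1, h2, hb, hahnOffSq]
    ring

theorem IsHahnParam.diag {k₁ k₂ : ℝ} {p : ℤ} {a b c : ℝ} (h : IsHahnParam k₁ k₂ p a b c) (n : ℕ) :
    hahnDiag a b c n + 1 / 4 = ((n + p.toNat : ℕ) + 1) * (2 * k₁ + (n + p.toNat : ℕ)) +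
      (n + (-p).toNat : ℕ) * (2 * k₂ + (n + (-p).toNat : ℕ) - 1) -
      (k₁ + (n + p.toNat : ℕ) - k₂ - (n + (-p).toNat : ℕ)) ^ 2 -
      (k₁ + (n + p.toNat : ℕ) - k₂ - (n + (-p).toNat : ℕ)) := by
  have hb := h.1
  push_cast
  rcases h.cast_toNat with ⟨rfl, rfl, h1, h2⟩ | ⟨rfl, rfl, h1, h2⟩ <;>
  · rw [h1, h2, hb, hahnDiag]
    ring

/-- On the vectors `f_n^p` the Casimir operator acts by the recurrence coefficients of the
orthonormal continuous dual Hahn polynomials, the diagonal ones being shifted by `1/4`. -/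
theorem tensorCasimir_fAlg {k₁ k₂ : ℝ} (hk₁ : 0 < k₁) (hk₂ : 0 < k₂) {p : ℤ} {a b c : ℝ}
    (h : IsHahnParam k₁ k₂ p a b c) (n : ℕ) :
    tensorCasimir k₁ k₂ (fAlg p n) = ((√(hahnOffSq a b c n) : ℝ) : ℂ) • fAlg p (n + 1) +
      ((hahnDiag a b c n + 1 / 4 : ℝ) : ℂ) • fAlg p n +
      ((hahnLower a b c n : ℝ) : ℂ) • fAlg p (n - 1) := by
  rw [h.diag, h.offSq, Real.sqrt_mul (by positivity)]
  simp only [fAlg, map_smul]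
  rw [tensorCasimir_tmul hk₁ hk₂, show n + 1 + p.toNat = n + p.toNat + 1 by ring,
    show n + 1 + (-p).toNat = n + (-p).toNat + 1 by ring]
  cases n with
  | zero =>
    have h0 : √(((0 + p.toNat : ℕ) : ℝ) * (2 * k₁ + (0 + p.toNat : ℕ) - 1)) *
        √(((0 + (-p).toNat : ℕ) : ℝ) * (2 * k₂ + (0 + (-p).toNat : ℕ) - 1)) = 0 := by
      rcases le_total p 0 with hp | hp
      · rw [Int.toNat_of_nonpos hp]; simp
      · rw [Int.toNat_of_nonpos (neg_nonpos.2 hp)]; simp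
    rw [h0]
    simp only [hahnLower, Complex.ofReal_zero, zero_smul, pow_succ]
    module
  | succ n =>
    have e1 : n + 1 + p.toNat - 1 = n + p.toNat := by omega
    have e2 : n + 1 + (-p).toNat - 1 = n + (-p).toNat := by omega
    have h0 : √(((n + 1 + p.toNat : ℕ) : ℝ) * (2 * k₁ + (n + 1 + p.toNat : ℕ) - 1)) *
        √(((n + 1 + (-p).toNat : ℕ) : ℝ) * (2 * k₂ + (n + 1 + (-p).toNat : ℕ) - 1)) =
        hahnLower a b c (n + 1) := by
      rw [hahnLower, h.offSq, ← Real.sqrt_mul]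
      · congr 1
        push_cast
        ring
      · have : (0 : ℝ) ≤ 2 * k₁ + (n + p.toNat) := by positivity
        push_cast
        exact mul_nonneg (by positivity) (by linarith)
    rw [h0, e1, e2]
    simp only [Nat.add_sub_cancel, pow_succ]
    module

/-! ### The orthonormal basis of `H_p` -/

theorem inner_incl_single (i j : ℕ) :
    inner ℂ (incl (Finsupp.single i 1)) (incl (Finsupp.single j 1)) = if i = j then (1 : ℂ) else 0 := by
  have h : ∀ n, incl (Finsupp.single n 1) = lp.single (E := fun _ : ℕ => ℂ) 2 n (1 : ℂ) := fun n => by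
    simp [incl]
  rw [h, h, lp.inner_single_left]
  simp [lp.single_apply, Pi.single_apply]

theorem inner_fVec (p : ℤ) (n m : ℕ) :
    inner ℂ (fVec p n) (fVec p m) = if n = m then (1 : ℂ) else 0 := by
  have h : ∀ n, fVec p n = ((-1 : ℂ) ^ n) • ((incl (Finsupp.single (n + p.toNat) 1) ⊗ₜ[ℂ]
      incl (Finsupp.single (n + (-p).toNat) 1) : Ell2 ⊗[ℂ] Ell2) : TensorEll2) := by
    intro n
    rw [fVec, fAlg, map_smul, tensorIncl]
    simp
  rw [h, h, inner_smul_left, inner_smul_right, UniformSpace.Completion.inner_coe,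
    TensorProduct.inner_tmul, inner_incl_single, inner_incl_single]
  by_cases hnm : n = m
  · subst hnm
    simp [← mul_pow]
  · simp [hnm]

instance (p : ℤ) : CompleteSpace (Hp p) :=
  (Submodule.isClosed_topologicalClosure _).completeSpace_coe

theorem orthonormal_fHp (p : ℤ) : Orthonormal ℂ (fHp p) := by
  rw [orthonormal_iff_ite]
  exact fun n m => inner_fVec p n m

theorem orthogonal_span_fHp (p : ℤ) : (Submodule.span ℂ (Set.range (fHp p)))ᗮ = ⊥ := by
  refine eq_bot_iff.2 fun x hx => ?_
  have h1 : (x : TensorEll2) ∈ (Submodule.span ℂ (Set.range (fVec p)))ᗮ := by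
    rw [Submodule.mem_orthogonal]
    intro u hu
    induction hu using Submodule.span_induction with
    | mem u hu =>
      obtain ⟨n, rfl⟩ := hu
      exact (Submodule.mem_orthogonal _ _).1 hx _ (Submodule.subset_span ⟨n, rfl⟩)
    | zero => simp
    | add u v _ _ hu hv => rw [inner_add_left, hu, hv, add_zero]
    | smul t u _ hu => rw [inner_smul_left, hu, mul_zero]
  rw [← Submodule.orthogonal_closure] at h1
  have h2 := (Submodule.mem_orthogonal _ _).1 h1 x x.2
  rw [inner_self_eq_zero] at h2
  exact (Submodule.mem_bot ℂ).2 (Subtype.ext h2)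

/-- The orthonormal basis of `H_p` formed by the vectors `f_n^p`. -/
noncomputable def basisHp (p : ℤ) : HilbertBasis ℕ ℂ (Hp p) :=
  HilbertBasis.mkOfOrthogonalEqBot (orthonormal_fHp p) (orthogonal_span_fHp p)

theorem basisHp_apply (p : ℤ) (n : ℕ) : basisHp p n = fHp p n := by
  rw [basisHp, HilbertBasis.coe_mkOfOrthogonalEqBot]

theorem fHp_mem_domain (k₁ k₂ : ℝ) (p : ℤ) (n : ℕ) : fHp p n ∈ (casimirHp k₁ k₂ p).domain :=
  Submodule.subset_span (s := Set.range (fVec p)) ⟨n, rfl⟩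

theorem casimirHp_fHp {k₁ k₂ : ℝ} (hk₁ : 0 < k₁) (hk₂ : 0 < k₂) {p : ℤ} {a b c : ℝ}
    (h : IsHahnParam k₁ k₂ p a b c) (n : ℕ) :
    casimirHp k₁ k₂ p ⟨fHp p n, fHp_mem_domain k₁ k₂ p n⟩ =
      ((√(hahnOffSq a b c n) : ℝ) : ℂ) • fHp p (n + 1) +
      ((hahnDiag a b c n + 1 / 4 : ℝ) : ℂ) • fHp p n +
      ((hahnLower a b c n : ℝ) : ℂ) • fHp p (n - 1) := by
  refine Subtype.ext ?_
  have e := casimirOp_apply k₁ k₂ (fAlg p n) (LinearMap.mem_range_self tensorIncl _)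
  rw [tensorCasimir_fAlg hk₁ hk₂ h, map_add, map_add, map_smul, map_smul, map_smul] at e
  refine Eq.trans ?_ e
  rfl

/-! ### The orthonormal basis of the weighted `L²` space -/

section

variable {a b c : ℝ}

theorem memLp_dualHahnON (hab : 0 < a + b) (hac : 0 < a + c) (hbc : 0 < b + c) (n : ℕ) :
    MemLp (fun y => ((dualHahnON a b c n y : ℝ) : ℂ)) 2 (dualHahnMeasure a b c) := by
  have := (hasExpMoment_dualHahnMeasure hab hac hbc).memLp_eval (hahnPoly a b c n)
  simp only [eval_hahnPoly] at this
  exact this.ofReal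

theorem orthonormal_dualHahnON (hab : 0 < a + b) (hac : 0 < a + c) (hbc : 0 < b + c) :
    Orthonormal ℂ fun n => (memLp_dualHahnON hab hac hbc n).toLp := by
  rw [orthonormal_iff_ite]
  intro n m
  have h := integral_dualHahnON_mul hab hac hbc n m
  rw [L2.inner_def]
  have : ∫ y, ((dualHahnON a b c n y * dualHahnON a b c m y : ℝ) : ℂ) ∂dualHahnMeasure a b c =
      if n = m then 1 else 0 := by
    rw [integral_complex_ofReal, h]
    split_ifs <;> simp
  rw [← this]
  refine integral_congr_ae ?_
  filter_upwards [(memLp_dualHahnON hab hac hbc n).coeFn_toLp,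
    (memLp_dualHahnON hab hac hbc m).coeFn_toLp] with y h1 h2
  rw [h1, h2]
  simp [mul_comm]

/-- The orthonormal basis of the weighted `L²` space formed by the orthonormal polynomials. -/
noncomputable def basisL2 (hab : 0 < a + b) (hac : 0 < a + c) (hbc : 0 < b + c) :
    HilbertBasis ℕ ℂ (Lp ℂ 2 (dualHahnMeasure a b c)) :=
  HilbertBasis.mkOfOrthogonalEqBot (orthonormal_dualHahnON hab hac hbc)
    ((momentDeterminate_dualHahnMeasure hab hac hbc).orthogonal_span_eq_bot
      (hasExpMoment_dualHahnMeasure hab hac hbc) (w := fun _ => (1 : ℂ)) continuous_const (by simp)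
      (K := 1) (fun y => by simp) (span_hahnPoly hab hac hbc) fun n => by
        simpa [eval_hahnPoly] using (memLp_dualHahnON hab hac hbc n).coeFn_toLp)

theorem basisL2_ae (hab : 0 < a + b) (hac : 0 < a + c) (hbc : 0 < b + c) (n : ℕ) :
    basisL2 hab hac hbc n =ᵐ[dualHahnMeasure a b c] fun y => ((dualHahnON a b c n y : ℝ) : ℂ) := by
  rw [basisL2, HilbertBasis.coe_mkOfOrthogonalEqBot]
  exact (memLp_dualHahnON hab hac hbc n).coeFn_toLp

end

/-- The unitary operator from `H_p` onto the weighted `L²` space that sends `f_n^p` to the `n`-th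
orthonormal polynomial. -/
noncomputable def hahnTransform (p : ℤ) {a b c : ℝ} (hab : 0 < a + b) (hac : 0 < a + c)
    (hbc : 0 < b + c) : Hp p ≃ₗᵢ[ℂ] Lp ℂ 2 (dualHahnMeasure a b c) :=
  (basisHp p).repr.trans (basisL2 hab hac hbc).repr.symm

theorem hahnTransform_fHp (p : ℤ) {a b c : ℝ} (hab : 0 < a + b) (hac : 0 < a + c)
    (hbc : 0 < b + c) (n : ℕ) : hahnTransform p hab hac hbc (fHp p n) = basisL2 hab hac hbc n := by
  rw [hahnTransform, LinearIsometryEquiv.trans_apply, ← basisHp_apply, HilbertBasis.repr_self,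
    HilbertBasis.repr_symm_single]

/-! ### Multiplication operators -/

theorem mem_graph_mulOp {μ : Measure ℝ} {g : ℝ → ℂ} (f h : Lp ℂ 2 μ) :
    (f, h) ∈ (mulOp μ g).graph ↔ h =ᵐ[μ] fun y => g y * f y := by
  rw [LinearPMap.mem_graph_iff]
  constructor
  · rintro ⟨⟨f', hf⟩, h1, h2⟩
    obtain rfl : f' = f := h1
    obtain rfl : hf.toLp _ = h := h2
    exact hf.coeFn_toLp
  · intro hh
    have hf : MemLp (fun y => g y * f y) 2 μ := (memLp_congr_ae hh).1 (Lp.memLp h)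
    refine ⟨⟨f, hf⟩, rfl, ?_⟩
    exact Lp.ext (hf.coeFn_toLp.trans hh.symm)

theorem memLp_mul_of_norm_le_one {μ : Measure ℝ} {r : ℝ → ℂ} (hr : Continuous r)
    (hb : ∀ y, ‖r y‖ ≤ 1) (f : Lp ℂ 2 μ) : MemLp (fun y => r y * f y) 2 μ :=
  (Lp.memLp f).of_le (hr.aestronglyMeasurable.mul (Lp.aestronglyMeasurable f))
    (ae_of_all _ fun y => by
      rw [norm_mul]
      exact mul_le_of_le_one_left (norm_nonneg _) (hb y))

/-- Multiplication by a continuous function bounded by `1`, as a bounded operator. -/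
noncomputable def boundedMul (μ : Measure ℝ) (r : ℝ → ℂ) (hr : Continuous r) (hb : ∀ y, ‖r y‖ ≤ 1) :
    Lp ℂ 2 μ →L[ℂ] Lp ℂ 2 μ :=
  LinearMap.mkContinuous
    { toFun := fun f => (memLp_mul_of_norm_le_one hr hb f).toLp
      map_add' := fun f h => by
        rw [← MemLp.toLp_add]
        refine MemLp.toLp_congr _ _ ?_
        filter_upwards [Lp.coeFn_add f h] with y hy
        simp only [hy, Pi.add_apply, mul_add]
      map_smul' := fun t f => by
        rw [RingHom.id_apply, ← MemLp.toLp_const_smul]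
        refine MemLp.toLp_congr _ _ ?_
        filter_upwards [Lp.coeFn_smul t f] with y hy
        simp only [hy, Pi.smul_apply, smul_eq_mul, mul_left_comm] } 1 fun f => by
    rw [one_mul]
    refine Lp.norm_le_norm_of_ae_le ?_
    filter_upwards [(memLp_mul_of_norm_le_one hr hb f).coeFn_toLp] with y hy
    change ‖((memLp_mul_of_norm_le_one hr hb f).toLp : Lp ℂ 2 μ) y‖ ≤ _
    rw [hy, norm_mul]
    exact mul_le_of_le_one_left (norm_nonneg _) (hb y)

theorem boundedMul_ae (μ : Measure ℝ) (r : ℝ → ℂ) (hr : Continuous r) (hb : ∀ y, ‖r y‖ ≤ 1)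
    (f : Lp ℂ 2 μ) : boundedMul μ r hr hb f =ᵐ[μ] fun y => r y * f y :=
  (memLp_mul_of_norm_le_one hr hb f).coeFn_toLp

theorem add_I_ne_zero (t : ℝ) : (t : ℂ) + Complex.I ≠ 0 := fun h => by
  have := congrArg Complex.im h
  simp at this

theorem continuous_inv_add_I {g : ℝ → ℝ} (hg : Continuous g) :
    Continuous fun y => ((g y : ℂ) + Complex.I)⁻¹ :=
  ((Complex.continuous_ofReal.comp hg).add continuous_const).inv₀ fun y => add_I_ne_zero (g y)

theorem norm_inv_add_I_le (t : ℝ) : ‖((t : ℂ) + Complex.I)⁻¹‖ ≤ 1 := by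
  rw [norm_inv]
  refine inv_le_one_of_one_le₀ ?_
  simpa using Complex.abs_im_le_norm ((t : ℂ) + Complex.I)

/-- The resolvent `(M_g + i)⁻¹` of multiplication by a continuous real function. -/
noncomputable def mulResolvent (μ : Measure ℝ) (g : ℝ → ℝ) (hg : Continuous g) :
    Lp ℂ 2 μ →L[ℂ] Lp ℂ 2 μ :=
  boundedMul μ (fun y => ((g y : ℂ) + Complex.I)⁻¹) (continuous_inv_add_I hg)
    fun y => norm_inv_add_I_le (g y)

theorem mem_graph_mulOp_iff_resolvent {μ : Measure ℝ} {g : ℝ → ℝ} (hg : Continuous g)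
    (f h : Lp ℂ 2 μ) : (f, h) ∈ (mulOp μ fun y => (g y : ℂ)).graph ↔
      mulResolvent μ g hg (h + Complex.I • f) = f := by
  rw [mem_graph_mulOp]
  have e : mulResolvent μ g hg (h + Complex.I • f) =ᵐ[μ]
      fun y => ((g y : ℂ) + Complex.I)⁻¹ * (h y + Complex.I * f y) := by
    filter_upwards [boundedMul_ae μ (fun y => ((g y : ℂ) + Complex.I)⁻¹) (continuous_inv_add_I hg)
      (fun y => norm_inv_add_I_le (g y)) (h + Complex.I • f), Lp.coeFn_add h (Complex.I • f),
      Lp.coeFn_smul Complex.I f] with y h1 h2 h3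
    rw [mulResolvent, h1, h2, Pi.add_apply, h3]
    rfl
  constructor
  · intro hh
    refine Lp.ext ?_
    filter_upwards [e, hh] with y h1 h2
    rw [h1, h2, ← add_mul, inv_mul_cancel_left₀ (add_I_ne_zero (g y))]
  · intro hh
    rw [hh] at e
    filter_upwards [e] with y h1
    have h2 := add_I_ne_zero (g y)
    have h3 : ((g y : ℂ) + Complex.I) * f y = h y + Complex.I * f y := by
      rw [← mul_inv_cancel_left₀ h2 (h y + Complex.I * f y), ← h1]
    linear_combination -h3

theorem isClosed_mulOp {μ : Measure ℝ} {g : ℝ → ℝ} (hg : Continuous g) :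
    (mulOp μ fun y => (g y : ℂ)).IsClosed := by
  have : ((mulOp μ fun y => (g y : ℂ)).graph : Set (Lp ℂ 2 μ × Lp ℂ 2 μ)) =
      {x | mulResolvent μ g hg (x.2 + Complex.I • x.1) = x.1} := by
    ext ⟨f, h⟩
    exact mem_graph_mulOp_iff_resolvent hg f h
  change IsClosed ((mulOp μ fun y => (g y : ℂ)).graph : Set (Lp ℂ 2 μ × Lp ℂ 2 μ))
  rw [this]
  exact isClosed_eq (by fun_prop) (by fun_prop)

/-! ### Unitary equivalence of the closed operators -/

/-- Let a unitary operator intertwine `A` with the multiplication operator `M_g`. If the image of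
`A + i` is dense then the closure of `A` is carried onto `M_g`, as the inverse of `M_g + i` is
bounded. -/
theorem topologicalClosure_graph_eq {E : Type*} [AddCommGroup E] [Module ℂ E]
    [TopologicalSpace E] [ContinuousAdd E] [ContinuousSMul ℂ E]
    {μ : Measure ℝ} {g : ℝ → ℝ} (hg : Continuous g) (Λ : E ≃L[ℂ] Lp ℂ 2 μ) (A : E →ₗ.[ℂ] E)
    (hA : ∀ v : A.domain, (Λ v, Λ (A v)) ∈ (mulOp μ fun y => (g y : ℂ)).graph)
    (hd : Dense (Set.range fun v : A.domain => Λ (A v) + Complex.I • Λ v)) (v w : E) :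
    (v, w) ∈ A.graph.topologicalClosure ↔
      (Λ v, Λ w) ∈ (mulOp μ fun y => (g y : ℂ)).graph := by
  constructor
  · intro h
    have hcl : IsClosed {x : E × E | (Λ x.1, Λ x.2) ∈
        ((mulOp μ fun y => (g y : ℂ)).graph : Set (Lp ℂ 2 μ × Lp ℂ 2 μ))} :=
      (isClosed_mulOp hg).preimage (by fun_prop)
    refine closure_minimal (s := (A.graph : Set (E × E))) ?_ hcl h
    rintro ⟨x, y⟩ hxy
    obtain ⟨d, rfl, rfl⟩ := (LinearPMap.mem_graph_iff A).1 hxy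
    exact hA d
  · intro h
    set R := mulResolvent μ g hg
    have hR := (mem_graph_mulOp_iff_resolvent hg _ _).1 h
    let ψ : Lp ℂ 2 μ → E × E := fun u => (Λ.symm (R u), Λ.symm (u - Complex.I • R u))
    have hψ : Continuous ψ := by fun_prop
    have hu : ψ (Λ w + Complex.I • Λ v) = (v, w) := by
      simp only [ψ, R]
      rw [hR]
      simp
    rw [← hu]
    refine map_mem_closure hψ (hd _) ?_
    rintro _ ⟨d, rfl⟩
    have hRd := (mem_graph_mulOp_iff_resolvent hg _ _).1 (hA d)
    have : ψ (Λ (A d) + Complex.I • Λ d) = ((d : E), A d) := by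
      simp only [ψ, R]
      rw [hRd]
      simp
    change ψ (Λ (A d) + Complex.I • Λ d) ∈ (A.graph : Set (E × E))
    rw [this]
    exact LinearPMap.mem_graph A d

theorem isClosable_of_graph_iff {E : Type*} [AddCommGroup E] [Module ℂ E]
    [TopologicalSpace E] [ContinuousAdd E] [ContinuousSMul ℂ E]
    {μ : Measure ℝ} {g : ℝ → ℝ} (Λ : E ≃L[ℂ] Lp ℂ 2 μ) {A : E →ₗ.[ℂ] E}
    (h : ∀ v w, (v, w) ∈ A.graph.topologicalClosure ↔
      (Λ v, Λ w) ∈ (mulOp μ fun y => (g y : ℂ)).graph) : A.IsClosable := by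
  refine ⟨A.graph.topologicalClosure.toLinearPMap, ?_⟩
  rw [Submodule.toLinearPMap_graph_eq]
  rintro ⟨v, w⟩ hvw hv
  obtain rfl : v = 0 := hv
  have := (h 0 w).1 hvw
  rw [map_zero] at this
  exact Λ.map_eq_zero_iff.1 ((mulOp μ fun y => (g y : ℂ)).graph_fst_eq_zero_snd this rfl)

section

variable {k₁ k₂ : ℝ} {p : ℤ} {a b c : ℝ}

theorem hahnTransform_casimirHp_fHp_ae (hk₁ : 0 < k₁) (hk₂ : 0 < k₂)
    (h : IsHahnParam k₁ k₂ p a b c) (hab : 0 < a + b) (hac : 0 < a + c) (hbc : 0 < b + c) (n : ℕ) :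
    hahnTransform p hab hac hbc (casimirHp k₁ k₂ p ⟨fHp p n, fHp_mem_domain k₁ k₂ p n⟩)
      =ᵐ[dualHahnMeasure a b c]
        fun y => ((y + 1 / 4 : ℝ) : ℂ) * ((dualHahnON a b c n y : ℝ) : ℂ) := by
  rw [casimirHp_fHp hk₁ hk₂ h]
  simp only [map_add, map_smul, hahnTransform_fHp]
  set e := basisL2 hab hac hbc
  set x₁ : ℂ := ((√(hahnOffSq a b c n) : ℝ) : ℂ)
  set x₂ : ℂ := ((hahnDiag a b c n + 1 / 4 : ℝ) : ℂ)
  set x₃ : ℂ := ((hahnLower a b c n : ℝ) : ℂ)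
  filter_upwards [Lp.coeFn_add (x₁ • e (n + 1) + x₂ • e n) (x₃ • e (n - 1)),
    Lp.coeFn_add (x₁ • e (n + 1)) (x₂ • e n), Lp.coeFn_smul x₁ (e (n + 1)),
    Lp.coeFn_smul x₂ (e n), Lp.coeFn_smul x₃ (e (n - 1)), basisL2_ae hab hac hbc n,
    basisL2_ae hab hac hbc (n + 1), basisL2_ae hab hac hbc (n - 1)] with y h1 h2 h3 h4 h5 h6 h7 h8
  rw [h1, Pi.add_apply, h2, Pi.add_apply, h3, h4, h5, Pi.smul_apply, Pi.smul_apply, Pi.smul_apply,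
    h6, h7, h8]
  have := congrArg (fun t : ℝ => (t : ℂ)) (mul_dualHahnON hab hac hbc n y)
  simp only [x₁, x₂, x₃, smul_eq_mul]
  push_cast at this ⊢
  linear_combination -this

/-- On each `f_n^p` the claim is the recurrence relation of the polynomials. -/
theorem hahnTransform_graph (hk₁ : 0 < k₁) (hk₂ : 0 < k₂)
    (h : IsHahnParam k₁ k₂ p a b c) (hab : 0 < a + b) (hac : 0 < a + c) (hbc : 0 < b + c)
    (v : (casimirHp k₁ k₂ p).domain) :
    (hahnTransform p hab hac hbc v, hahnTransform p hab hac hbc (casimirHp k₁ k₂ p v)) ∈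
      (mulOp (dualHahnMeasure a b c) fun y => ((y + 1 / 4 : ℝ) : ℂ)).graph := by
  set Λ := hahnTransform p hab hac hbc
  set G := (mulOp (dualHahnMeasure a b c) fun y => ((y + 1 / 4 : ℝ) : ℂ)).graph
  have key : ∀ x ∈ Submodule.span ℂ (Set.range (fVec p)), ∀ d : (casimirHp k₁ k₂ p).domain,
      ((d : Hp p) : TensorEll2) = x → (Λ d, Λ (casimirHp k₁ k₂ p d)) ∈ G := by
    intro x hx
    have dom : ∀ x ∈ Submodule.span ℂ (Set.range (fVec p)), ∃ d : (casimirHp k₁ k₂ p).domain,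
        ((d : Hp p) : TensorEll2) = x := fun x hx => ⟨⟨⟨x, span_le_Hp p hx⟩, hx⟩, rfl⟩
    induction hx using Submodule.span_induction with
    | mem x hx =>
      rintro d hd
      obtain ⟨n, rfl⟩ := hx
      obtain rfl : d = ⟨fHp p n, fHp_mem_domain k₁ k₂ p n⟩ := Subtype.ext (Subtype.ext hd)
      rw [mem_graph_mulOp]
      have h1 := hahnTransform_casimirHp_fHp_ae hk₁ hk₂ h hab hac hbc n
      have h2 := basisL2_ae hab hac hbc n
      rw [← hahnTransform_fHp p hab hac hbc n] at h2
      filter_upwards [h1, h2] with y e1 e2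
      rw [e1, e2]
    | zero =>
      rintro d hd
      obtain rfl : d = 0 := Subtype.ext (Subtype.ext hd)
      rw [LinearPMap.map_zero, Submodule.coe_zero, map_zero]
      exact G.zero_mem
    | add x y hx hy ihx ihy =>
      rintro d hd
      obtain ⟨dx, hdx⟩ := dom x hx
      obtain ⟨dy, hdy⟩ := dom y hy
      obtain rfl : d = dx + dy := Subtype.ext (Subtype.ext (by
        rw [hd, ← hdx, ← hdy]; rfl))
      rw [LinearPMap.map_add, Submodule.coe_add, map_add, map_add]
      exact G.add_mem (ihx dx hdx) (ihy dy hdy)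
    | smul t x hx ihx =>
      rintro d hd
      obtain ⟨dx, hdx⟩ := dom x hx
      obtain rfl : d = t • dx := Subtype.ext (Subtype.ext (by rw [hd, ← hdx]; rfl))
      rw [LinearPMap.map_smul, Submodule.coe_smul, map_smul, map_smul]
      exact G.smul_mem t (ihx dx hdx)
  exact key _ v.2 v rfl

theorem dense_range_casimirHp_add_I (hk₁ : 0 < k₁) (hk₂ : 0 < k₂)
    (h : IsHahnParam k₁ k₂ p a b c) (hab : 0 < a + b) (hac : 0 < a + c) (hbc : 0 < b + c) :
    Dense (Set.range fun v : (casimirHp k₁ k₂ p).domain =>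
      hahnTransform p hab hac hbc (casimirHp k₁ k₂ p v) +
        Complex.I • hahnTransform p hab hac hbc v) := by
  set Λ := hahnTransform p hab hac hbc
  let φ : (casimirHp k₁ k₂ p).domain →ₗ[ℂ] Lp ℂ 2 (dualHahnMeasure a b c) :=
    Λ.toLinearEquiv.toLinearMap ∘ₗ (casimirHp k₁ k₂ p).toFun +
      Complex.I • (Λ.toLinearEquiv.toLinearMap ∘ₗ (casimirHp k₁ k₂ p).domain.subtype)
  let u : ℕ → (casimirHp k₁ k₂ p).domain := fun n => ⟨fHp p n, fHp_mem_domain k₁ k₂ p n⟩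
  have hbot := (momentDeterminate_dualHahnMeasure hab hac hbc).orthogonal_span_eq_bot
    (hasExpMoment_dualHahnMeasure hab hac hbc) (w := fun y => ((y + 1 / 4 : ℝ) : ℂ) + Complex.I)
    (by fun_prop) (fun y => add_I_ne_zero _) (K := 2 * (one_add_abs_pow_le_exp 1
      (show (0 : ℝ) < 1 / 4 by norm_num)).choose) (fun y => by
        have hK := (one_add_abs_pow_le_exp 1 (show (0 : ℝ) < 1 / 4 by norm_num)).choose_spec.2 y
        rw [pow_one] at hK
        have h1 : ‖((y + 1 / 4 : ℝ) : ℂ) + Complex.I‖ ≤ |y + 1 / 4| + 1 := by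
          refine (norm_add_le _ _).trans ?_
          rw [Complex.norm_real, Complex.norm_I, Real.norm_eq_abs]
        have h2 : |y + 1 / 4| ≤ |y| + 1 / 4 := by
          refine (abs_add_le _ _).trans ?_
          rw [abs_of_pos (show (0 : ℝ) < 1 / 4 by norm_num)]
        have := abs_nonneg y
        linarith) (span_hahnPoly hab hac hbc) (e := fun n => φ (u n)) (fun n => by
        have e1 := hahnTransform_casimirHp_fHp_ae hk₁ hk₂ h hab hac hbc n
        have e2 := basisL2_ae hab hac hbc n
        rw [← hahnTransform_fHp p hab hac hbc n] at e2
        change (Λ (casimirHp k₁ k₂ p (u n)) + Complex.I • Λ (fHp p n) : Lp ℂ 2 _) =ᵐ[_] _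
        filter_upwards [e1, e2, Lp.coeFn_add (Λ (casimirHp k₁ k₂ p (u n))) (Complex.I • Λ (fHp p n)),
          Lp.coeFn_smul Complex.I (Λ (fHp p n))] with y h1 h2 h3 h4
        rw [h3, Pi.add_apply, h4, Pi.smul_apply, h1, h2, smul_eq_mul, eval_hahnPoly,
          Complex.real_smul]
        ring)
  rw [← Submodule.topologicalClosure_eq_top_iff] at hbot
  have hle : Submodule.span ℂ (Set.range fun n => φ (u n)) ≤ LinearMap.range φ := by
    rw [Submodule.span_le]
    rintro _ ⟨n, rfl⟩
    exact ⟨u n, rfl⟩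
  have hd : Dense (Submodule.span ℂ (Set.range fun n => φ (u n)) : Set (Lp ℂ 2 (dualHahnMeasure a b c))) :=
    Submodule.dense_iff_topologicalClosure_eq_top.2 hbot
  exact hd.mono fun x hx => hle hx

theorem mem_domain_and_eq_of_mem_graph {μ : Measure ℝ} {g : ℝ → ℂ} {f h : Lp ℂ 2 μ}
    (hfh : (f, h) ∈ (mulOp μ g).graph) :
    ∃ hf : f ∈ (mulOp μ g).domain, h = mulOp μ g ⟨f, hf⟩ := by
  obtain ⟨d, rfl, rfl⟩ := (LinearPMap.mem_graph_iff _).1 hfh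
  exact ⟨d.2, rfl⟩

theorem eq_hahnTransform (hab : 0 < a + b) (hac : 0 < a + c) (hbc : 0 < b + c)
    (T : Hp p →L[ℂ] Lp ℂ 2 (dualHahnMeasure a b c))
    (hT : ∀ n : ℕ, T (fHp p n) =ᵐ[dualHahnMeasure a b c]
      fun y => ((dualHahnON a b c n y : ℝ) : ℂ)) (v : Hp p) :
    T v = hahnTransform p hab hac hbc v := by
  have e : T = (hahnTransform p hab hac hbc).toLinearIsometry.toContinuousLinearMap := by
    refine ContinuousLinearMap.ext_on (s := Set.range (fHp p)) ?_ ?_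
    · exact Submodule.dense_iff_topologicalClosure_eq_top.2
        (Submodule.topologicalClosure_eq_top_iff.2 (orthogonal_span_fHp p))
    · rintro _ ⟨n, rfl⟩
      refine Lp.ext ((hT n).trans ?_)
      change _ =ᵐ[_] hahnTransform p hab hac hbc (fHp p n)
      rw [hahnTransform_fHp]
      exact (basisL2_ae hab hac hbc n).symm
  rw [e]
  rfl

/-- The closure of the Casimir operator is carried onto the multiplication operator. -/
theorem topologicalClosure_graph_casimirHp (hk₁ : 0 < k₁) (hk₂ : 0 < k₂)
    (h : IsHahnParam k₁ k₂ p a b c) (hab : 0 < a + b) (hac : 0 < a + c) (hbc : 0 < b + c)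
    (v w : Hp p) : (v, w) ∈ (casimirHp k₁ k₂ p).graph.topologicalClosure ↔
      (hahnTransform p hab hac hbc v, hahnTransform p hab hac hbc w) ∈
        (mulOp (dualHahnMeasure a b c) fun y => ((y + 1 / 4 : ℝ) : ℂ)).graph :=
  topologicalClosure_graph_eq (show Continuous fun y : ℝ => y + 1 / 4 by fun_prop)
    (hahnTransform p hab hac hbc).toContinuousLinearEquiv
    (casimirHp k₁ k₂ p) (hahnTransform_graph hk₁ hk₂ h hab hac hbc)
    (dense_range_casimirHp_add_I hk₁ hk₂ h hab hac hbc) v w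

theorem isClosable_casimirHp (hk₁ : 0 < k₁) (hk₂ : 0 < k₂)
    (h : IsHahnParam k₁ k₂ p a b c) : (casimirHp k₁ k₂ p).IsClosable := by
  obtain ⟨hab, hac, hbc⟩ := h.pos hk₁ hk₂
  exact isClosable_of_graph_iff (g := fun y => y + 1 / 4)
    (hahnTransform p hab hac hbc).toContinuousLinearEquiv
    (topologicalClosure_graph_casimirHp hk₁ hk₂ h hab hac hbc)

end

end SU11

theorem proposition2p1 (k₁ k₂ : ℝ) (hk₁ : 0 < k₁) (hk₂ : 0 < k₂) (p : ℤ) (a b c : ℝ)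
    (hb : b = k₁ + k₂ - 1 / 2)
    (hac : (p ≤ 0 ∧ a = k₁ - k₂ + 1 / 2 ∧ c = k₂ - k₁ - p + 1 / 2) ∨
      (0 ≤ p ∧ a = k₂ - k₁ + 1 / 2 ∧ c = k₁ - k₂ + p + 1 / 2)) :
    ∃ Λ : SU11.Hp p ≃ₗᵢ[ℂ] MeasureTheory.Lp ℂ 2 (SU11.dualHahnMeasure a b c),
      -- `Λ` sends `f_n^p` to `Ŝ_n`, and it is the only bounded operator that does so
      (∀ n : ℕ, Λ (SU11.fHp p n) =ᵐ[SU11.dualHahnMeasure a b c]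
        fun y => ((SU11.dualHahnON a b c n y : ℝ) : ℂ)) ∧
      (∀ T : SU11.Hp p →L[ℂ] MeasureTheory.Lp ℂ 2 (SU11.dualHahnMeasure a b c),
        (∀ n : ℕ, T (SU11.fHp p n) =ᵐ[SU11.dualHahnMeasure a b c]
          fun y => ((SU11.dualHahnON a b c n y : ℝ) : ℂ)) → ∀ v, T v = Λ v) ∧
      -- `Λ` intertwines the Casimir operator on finite linear combinations of the `f_n^p`
      -- with multiplication by `y + 1/4`
      (∀ v : (SU11.casimirHp k₁ k₂ p).domain,
        ∃ hv : Λ (v : SU11.Hp p) ∈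
            (SU11.mulOp (SU11.dualHahnMeasure a b c) fun y => (y : ℂ) + 1 / 4).domain,
          Λ (SU11.casimirHp k₁ k₂ p v) =
            SU11.mulOp (SU11.dualHahnMeasure a b c) (fun y => (y : ℂ) + 1 / 4) ⟨Λ v, hv⟩) ∧
      -- and it carries the closure of the Casimir operator on `H_p` onto the multiplication operator
      (SU11.casimirHp k₁ k₂ p).IsClosable ∧
      (∀ v w : SU11.Hp p, (v, w) ∈ (SU11.casimirHp k₁ k₂ p).closure.graph ↔
        (Λ v, Λ w) ∈
          (SU11.mulOp (SU11.dualHahnMeasure a b c) fun y => (y : ℂ) + 1 / 4).graph) := by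
  have h : SU11.IsHahnParam k₁ k₂ p a b c := ⟨hb, hac⟩
  obtain ⟨h1, h2, h3⟩ := h.pos hk₁ hk₂
  have hg : (fun y : ℝ => (y : ℂ) + 1 / 4) = fun y => ((y + 1 / 4 : ℝ) : ℂ) := by
    ext y
    push_cast
    ring
  rw [hg]
  have closable := SU11.isClosable_casimirHp hk₁ hk₂ h
  refine ⟨SU11.hahnTransform p h1 h2 h3, fun n => ?_, SU11.eq_hahnTransform h1 h2 h3,
    fun v => SU11.mem_domain_and_eq_of_mem_graph (SU11.hahnTransform_graph hk₁ hk₂ h h1 h2 h3 v),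
    closable, fun v w => ?_⟩
  · rw [SU11.hahnTransform_fHp]
    exact SU11.basisL2_ae h1 h2 h3 n
  · rw [← closable.graph_closure_eq_closure_graph]
    exact SU11.topologicalClosure_graph_casimirHp hk₁ hk₂ h h1 h2 h3 v w
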